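/- Let $\mathcal R$ be a commutative ring with identity, $n,T,D\ge 1$ integers, $\mu\in(0,1)$ and $f\in\mathcal R[x_1,\dots,x_n]$ with at most $T$ terms ($\#f\le T$) and total degree at most $D$. For $\mathbf s\in\mathbb N^n$ write $f(x^{\mathbf s})=f(x^{s_1},\dots,x^{s_n})$, and let $\mathbf I_k$ be the $k$-th unit vector. Suppose that a univariate interpolation procedure is given which, from $\mathbf s$ and valid bounds for the degree and for the number of terms of $f(x^{\mathbf s})$, returns the nonzero terms of $f(x^{\mathbf s})$. Algorithm **MulPolySI**$(T,D,\mu)$: put $h=0$, $T_1=T$, $w=\lceil\log_2T\rceil+1$, $\nu=\mu/w$. While $T_1>0$: run HalfPoly$(h,T,T_1,D,\nu)$; if it fails, return failure; otherwise add its result to $h$ and replace $T_1$ by $\lfloor T_1/2\rfloor$. Finally return $h$. **HalfPoly**$(h,T,T_1,D,\nu)$: (1) Let $l=\lceil 32\ln(T_1\nu^{-1})\rceil$, $N=\max\{31\lfloor(T_1-1)\log_2D\rfloor,1\}$, and let $P$ consist of the first $N$ primes $p\ge 32(T_1-1)$. (2) Draw independently $l$ pairs $(p_i,\mathbf s_i)$,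 with $p_i$ uniform in $P$ and $\mathbf s_i$ uniform in $\{0,\dots,p_i-1\}^n$, and delete repetitions. (3) For each $i$ interpolate $f(x^{\mathbf s_i})$, with degree bound $\|\mathbf s_i\|_\infty D$ and term bound $T$, and compute $f_i=f(x^{\mathbf s_i})-h(x^{\mathbf s_i})$ and $\bar f_i=f_i \bmod (x^{p_i}-1)$. (4) Choose $(p,\mathbf s)=(p_j,\mathbf s_j)$ with $\#\bar f_j$ maximal; if $\#\bar f_j>T_1$, fail. (5) For $k=1,\dots,n$ interpolate $f(x^{\mathbf s+p\mathbf I_k})$, with degree bound $\|\mathbf s+p\mathbf I_k\|_\infty D$ and term bound $T$, and let $g_k=f(x^{\mathbf s+p\mathbf I_k})-h(x^{\mathbf s+p\mathbf I_k})$. (6) Return the sum of all $a\,x_1^{e_1}\cdots x_n^{e_n}$ such that $ax^d$ is a term of $\bar f_j$; $f_j$ has exactly one term $ax^u$ and each $g_k$ exactly one term $ax^{b_k}$ whose exponent is congruent to $d$ modulo $p$; $e_k=(b_k-u)/p\in\mathbb N$ for all $k$; $u=\sum_k e_ks_k$; and $\sum_k e_k\le D$. Then MulPolySI returns $f$ with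 probability at least $1-\mu$. Moreover, for all outcomes of the random choices, it uses * $O\bigl(n\log T+\log^2T+\log T\log\frac1\mu\bigr)$ interpolations of univariate polynomials $f(x^{\mathbf s})$, each called with valid bounds, the degree bound being $O^{\sim}(TD)$ and the term bound being at most $T$; * $O^{\sim}\bigl(nT\log\frac1\mu\bigr)$ additional ring operations in $\mathcal R$ (additions, negations, tests for zero); * $O^{\sim}\bigl(nT\log D\log\frac1\mu\bigr)$ additional bit operations. Here $\log y$ in the bounds stands for $\max(1,\log_2y)$, and $A\in O^{\sim}(g)$ means $A\le C\,g\,(\log g)^c$; the constants $C,c$ are absolute. Polynomials are stored as lists of terms; like terms are collected by merge sort and primes are found by a sieve. Integer operations are charged $(b+1)(\beta+1)^2$ bit operations, where $b$ is the total bit length of the operands, and also of the result for $+,-,\cdot$, quotient, remainder and power, and $\beta$ is the bit length of $b$. Loop counters are charged accordingly for every iteration. A draw from $\{0,\dots,m-1\}$ and a draw of an entry of a list are charged as operations on $m$, and on the list's length and the entry, respectively. The evaluation of $l$ is charged as an operation on $l$ plus the bit lengths of $T_1$ and $w$ bits. Moving data is free. -/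

import Mathlib

/-!
Sparse interpolation of a multivariate polynomial by randomized Kronecker substitutions, as a
program for a machine which counts univariate interpolations, ring operations and bit operations.
-/

universe u v w

namespace SparseInterp

/-! ### The machine

A program is a tree of elementary instructions.  The types `Z` (of the integers of the machine) and
`K` (of its ring elements) are arbitrary types without any structure, so a program, written for all
`Z` and `K`, can act on integers and ring elements through charged instructions only.  When a
program is executed, `Z` is `ℕ` and `K` is the coefficient ring. -/

/-- Binary operations on natural numbers; `sub` is truncated and `div` is the integer quotient. -/
inductive ArithOp
  | add | sub | mul | div | mod | pow

def ArithOp.eval : ArithOp → ℕ → ℕ → ℕ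
  | .add, a, b => a + b
  | .sub, a, b => a - b
  | .mul, a, b => a * b
  | .div, a, b => a / b
  | .mod, a, b => a % b
  | .pow, a, b => a ^ b

/-- Programs with result in `α`.  The argument `k` of an instruction is the rest of the program.
* `lit c`: the constant `c`;
* `arith op a b`: integer arithmetic;
* `bitlen a`: the number of binary digits of `a`;
* `cmp a b`: comparison of integers;
* `range a b`: the loop range `a, a + 1, …, b - 1`;
* `trials μ w t`: the number `⌈32 ln (t ν⁻¹)⌉` for the tolerance `ν = μ / w`;
* `rand m`: a uniformly random element of `{0, …, m - 1}`;
* `pick xs`: a uniformly random entry of the list `xs`;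
* `kadd a b`, `kneg a`, `kzero a`: addition, negation and test for zero in the ring;
* `interp s B t`: univariate interpolation of `f(x^s)` with degree bound `B`, term bound `t`;
* `interpShift s k p B t`: the same for `f(x^(s + p I_k))`, with `I_k` the `k`-th unit vector. -/
inductive Prog (Z : Type) (K : Type u) (α : Type v) : Type (max u v)
  | ret (a : α)
  | lit (c : ℕ) (k : Z → Prog Z K α)
  | arith (op : ArithOp) (a b : Z) (k : Z → Prog Z K α)
  | bitlen (a : Z) (k : Z → Prog Z K α)
  | cmp (a b : Z) (k : Ordering → Prog Z K α)
  | range (a b : Z) (k : List Z → Prog Z K α)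
  | trials (μ : ℝ) (w t : Z) (k : Z → Prog Z K α)
  | rand (m : Z) (k : Z → Prog Z K α)
  | pick (xs : List Z) (k : Z → Prog Z K α)
  | kadd (a b : K) (k : K → Prog Z K α)
  | kneg (a : K) (k : K → Prog Z K α)
  | kzero (a : K) (k : Bool → Prog Z K α)
  | interp (s : List Z) (B t : Z) (k : List (Z × K) → Prog Z K α)
  | interpShift (s : List Z) (j : ℕ) (p B t : Z) (k : List (Z × K) → Prog Z K α)

/-- Sequential composition. -/
def Prog.bind {Z : Type} {K : Type u} {α : Type v} {β : Type w} :
    Prog Z K α → (α → Prog Z K β) → Prog Z K β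
  | .ret a, g => g a
  | .lit c k, g => .lit c fun z => (k z).bind g
  | .arith op a b k, g => .arith op a b fun z => (k z).bind g
  | .bitlen a k, g => .bitlen a fun z => (k z).bind g
  | .cmp a b k, g => .cmp a b fun o => (k o).bind g
  | .range a b k, g => .range a b fun l => (k l).bind g
  | .trials μ w t k, g => .trials μ w t fun z => (k z).bind g
  | .rand m k, g => .rand m fun z => (k z).bind g
  | .pick xs k, g => .pick xs fun z => (k z).bind g
  | .kadd a b k, g => .kadd a b fun c => (k c).bind g
  | .kneg a k, g => .kneg a fun c => (k c).bind g
  | .kzero a k, g => .kzero a fun b => (k b).bind g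
  | .interp s B t k, g => .interp s B t fun l => (k l).bind g
  | .interpShift s j p B t k, g => .interpShift s j p B t fun l => (k l).bind g

section Programs

variable {Z : Type} {K : Type u} {α : Type v} {β : Type w}

/-! ### Single instructions and loops as programs -/

def lit (c : ℕ) : Prog Z K Z := .lit c .ret
def arith (op : ArithOp) (a b : Z) : Prog Z K Z := .arith op a b .ret
def bitlen (a : Z) : Prog Z K Z := .bitlen a .ret
def cmp (a b : Z) : Prog Z K Ordering := .cmp a b .ret
def range (a b : Z) : Prog Z K (List Z) := .range a b .ret

def mapP (g : α → Prog Z K β) : List α → Prog Z K (List β)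
  | [] => .ret []
  | a :: l => (g a).bind fun b => (mapP g l).bind fun l' => .ret (b :: l')

def maxP (a b : Z) : Prog Z K Z :=
  (cmp a b).bind fun o => .ret (if o = .lt then b else a)

/-- The length of a list. -/
def lengthP : List α → Prog Z K Z
  | [] => lit 0
  | _ :: l => (lengthP l).bind fun m => (lit 1).bind fun one => arith .add m one

/-- Lexicographic comparison of vectors. -/
def cmpVec : List Z → List Z → Prog Z K Ordering
  | [], [] => .ret .eq
  | [], _ :: _ => .ret .lt
  | _ :: _, [] => .ret .gt
  | a :: s, b :: t => (cmp a b).bind fun o => if o = .eq then cmpVec s t else .ret o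

/-- The inner product of two vectors. -/
def dot : List Z → List Z → Prog Z K Z
  | a :: s, b :: t => (arith .mul a b).bind fun c => (dot s t).bind fun d => arith .add c d
  | _, _ => lit 0

def sumP : List Z → Prog Z K Z
  | [] => lit 0
  | a :: s => (sumP s).bind fun d => arith .add a d

/-- The maximum norm of a vector. -/
def normP : List Z → Prog Z K Z
  | [] => lit 0
  | a :: s => (normP s).bind fun d => maxP a d

/-! ### Merge sort -/

def merge (c : α → α → Prog Z K Ordering) : List α → List α → Prog Z K (List α)
  | [], ys => .ret ys
  | x :: xs, [] => .ret (x :: xs)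
  | x :: xs, y :: ys => (c y x).bind fun o =>
      if o = .lt then (merge c (x :: xs) ys).bind fun l => .ret (y :: l)
      else (merge c xs (y :: ys)).bind fun l => .ret (x :: l)
termination_by xs ys => xs.length + ys.length

def sortP (c : α → α → Prog Z K Ordering) : List α → Prog Z K (List α)
  | [] => .ret []
  | [a] => .ret [a]
  | a :: b :: l =>
      (sortP c ((a :: b :: l).take ((l.length + 2) / 2))).bind fun xs =>
      (sortP c ((a :: b :: l).drop ((l.length + 2) / 2))).bind fun ys =>
      merge c xs ys
termination_by l => l.length
decreasing_by
  all_goals simp only [List.length_take, List.length_drop, List.length_cons]; omega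

/-- Delete the repetitions in a sorted list. -/
def dedupSorted (c : α → α → Prog Z K Ordering) : List α → Prog Z K (List α)
  | [] => .ret []
  | [a] => .ret [a]
  | a :: b :: l => (c a b).bind fun o => (dedupSorted c (b :: l)).bind fun r =>
      .ret (if o = .eq then r else a :: r)

/-! ### Sparse polynomials

A univariate polynomial is a list of pairs (exponent, coefficient), a multivariate one a list of
pairs (exponent vector, coefficient). -/

def consTerm (a : α) (c : K) (r : List (α × K)) : Prog Z K (List (α × K)) :=
  .kzero c fun b => .ret (if b then r else (a, c) :: r)

/-- Add up neighbouring terms with the same exponent and drop zero terms. -/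
def combine (c : α → α → Prog Z K Ordering) (a : α) (x : K) :
    List (α × K) → Prog Z K (List (α × K))
  | [] => consTerm a x []
  | (b, y) :: l => (c a b).bind fun o =>
      if o = .eq then .kadd x y fun z => combine c a z l
      else (combine c b y l).bind fun r => consTerm a x r

/-- The normal form of a sum of terms: increasing exponents, nonzero coefficients. -/
def collect (c : α → α → Prog Z K Ordering) (l : List (α × K)) : Prog Z K (List (α × K)) :=
  (sortP (fun x y => c x.1 y.1) l).bind fun l' =>
    match l' with
    | [] => .ret []
    | (a, x) :: r => combine c a x r

/-- `g - h`, for univariate polynomials. -/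
def subU (g h : List (Z × K)) : Prog Z K (List (Z × K)) :=
  (mapP (fun m => .kneg m.2 fun x => .ret (m.1, x)) h).bind fun h' => collect cmp (g ++ h')

/-- `g mod (x ^ p - 1)`. -/
def modU (p : Z) (g : List (Z × K)) : Prog Z K (List (Z × K)) :=
  (mapP (fun m => (arith .mod m.1 p).bind fun r => .ret (r, m.2)) g).bind fun g' =>
    collect cmp g'

/-- `g + h`, for multivariate polynomials. -/
def addM (g h : List (List Z × K)) : Prog Z K (List (List Z × K)) :=
  collect cmpVec (g ++ h)

/-- `g(x^s)`. -/
def substU (g : List (List Z × K)) (s : List Z) : Prog Z K (List (Z × K)) :=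
  (mapP (fun m => (dot m.1 s).bind fun d => .ret (d, m.2)) g).bind fun g' => collect cmp g'

/-- For the terms `(d, e, c)` and the first `n` positions `k` of `e`, the polynomials
`∑ c x ^ (d + e_k p)`. -/
def shifts (p : Z) : ℕ → List (Z × List Z × K) → Prog Z K (List (List (Z × K)))
  | 0, _ => .ret []
  | n + 1, ts =>
      (mapP (fun m => match m with
          | (d, e :: _, c) => (arith .mul e p).bind fun a =>
              (arith .add d a).bind fun b => .ret (b, c)
          | (d, [], c) => .ret (d, c)) ts).bind fun row =>
      (collect cmp row).bind fun h =>
      (shifts p n (ts.map fun m => (m.1, m.2.1.tail, m.2.2))).bind fun hs => .ret (h :: hs)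

/-- Algorithm PolySubs: the polynomials `g(x^(s + p I_k))`, `k = 1, …, n`. -/
def polySubs (n : ℕ) (g : List (List Z × K)) (s : List Z) (p : Z) :
    Prog Z K (List (List (Z × K))) :=
  (mapP (fun m => (dot m.1 s).bind fun d => .ret (d, m.1, m.2)) g).bind fun ts => shifts p n ts

/-! ### Algorithm TSTerms -/

/-- In a list of pairs (residue, exponent) with increasing residues, continued by `(r, u)` in front,
keep the pairs whose residue occurs only once; `single` tells whether `r` has occurred once. -/
def uniques (r u : Z) (single : Bool) : List (Z × Z) → Prog Z K (List (Z × Z))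
  | [] => .ret (if single then [(r, u)] else [])
  | (r', u') :: l => (cmp r r').bind fun o =>
      if o = .eq then uniques r u false l
      else (uniques r' u' true l).bind fun t => .ret (if single then (r, u) :: t else t)

/-- The pairs `(u mod p, u)` for the exponents `u` of `g` that are alone in their residue class
modulo `p`, by increasing residues. -/
def singles (p : Z) (g : List (Z × K)) : Prog Z K (List (Z × Z)) :=
  (mapP (fun m => (arith .mod m.1 p).bind fun r => .ret (r, m.1)) g).bind fun l =>
  (sortP (fun x y => cmp x.1 y.1) l).bind fun l' =>
    match l' with
    | [] => .ret []
    | (r, u) :: t => uniques r u true t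

/-- Join two lists with increasing first components on these components. -/
def join : List (Z × α) → List (Z × Z) → Prog Z K (List (Z × α × Z))
  | [], _ => .ret []
  | _ :: _, [] => .ret []
  | (d, a) :: xs, (r, b) :: ys => (cmp d r).bind fun o =>
      match o with
      | .lt => join xs ((r, b) :: ys)
      | .gt => join ((d, a) :: xs) ys
      | .eq => (join xs ys).bind fun t => .ret ((d, a, b) :: t)
termination_by xs ys => xs.length + ys.length

/-- The quotient `(b - u) / p` if it is a natural number. -/
def exactQuot (p u b : Z) : Prog Z K (Option Z) :=
  (cmp b u).bind fun o =>
    if o = .lt then .ret none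
    else (arith .sub b u).bind fun d => (arith .div d p).bind fun e =>
      (arith .mul e p).bind fun d' => (cmp d d').bind fun o' =>
        .ret (if o' = .eq then some e else none)

/-- For candidates `(d, a, u, e)`, with `e` an exponent vector to be completed in front, add the
entry `(b - u) / p`, where `b` is the only exponent of `g` in the class `d`; drop the candidate if
there is no such `b` or the quotient is not a natural number. -/
def extend (p : Z) (g : List (Z × K)) (cs : List (Z × K × Z × List Z)) :
    Prog Z K (List (Z × K × Z × List Z)) :=
  (singles p g).bind fun bs => (join cs bs).bind fun js =>
  (mapP (fun j => match j with
      | (d, (a, u, e), b) => (exactQuot p u b).bind fun q =>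
          .ret (q.map fun x => (d, a, u, x :: e))) js).bind fun l =>
  .ret (l.filterMap id)

def extendAll (p : Z) : List (List (Z × K)) → List (Z × K × Z × List Z) →
    Prog Z K (List (Z × K × Z × List Z))
  | [], cs => .ret cs
  | g :: gs, cs => (extendAll p gs cs).bind fun cs' => extend p g cs'

/-- Algorithm TSTerms for `fmod = f mod (x^p - 1)` at `x^s`, `f0 = f(x^s)` and
`gs = [f(x^(s + p I_1)), …, f(x^(s + p I_n))]`. -/
def tsTerms (fmod f0 : List (Z × K)) (gs : List (List (Z × K))) (p : Z) (s : List Z) (D : Z) :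
    Prog Z K (List (List Z × K)) :=
  (singles p f0).bind fun us => (join fmod us).bind fun js =>
  (extendAll p gs (js.map fun j => (j.1, j.2.1, j.2.2, []))).bind fun cs =>
  (mapP (fun j => match j with
      | (_, a, u, e) => (dot e s).bind fun u' => (cmp u u').bind fun o =>
          if o = .eq then (sumP e).bind fun d => (cmp d D).bind fun o' =>
            .ret (if o' = .gt then none else some (e, a))
          else .ret none) cs).bind fun l =>
  .ret (l.filterMap id)

/-! ### Primes by the sieve of Eratosthenes -/

/-- From an increasing list delete the elements of another increasing list. -/
def diffSorted : List Z → List Z → Prog Z K (List Z)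
  | [], _ => .ret []
  | x :: xs, [] => .ret (x :: xs)
  | x :: xs, y :: ys => (cmp x y).bind fun o =>
      match o with
      | .lt => (diffSorted xs (y :: ys)).bind fun l => .ret (x :: l)
      | .eq => diffSorted xs (y :: ys)
      | .gt => diffSorted (x :: xs) ys
termination_by xs ys => xs.length + ys.length

/-- The first `N` primes `p ≥ M`, found among the numbers up to `B = 16 X L`, where `X = M + N + 2`
and `L` is the bit length of `X`, by deleting all products `i j ≤ B` with `i, j ≥ 2`. -/
def firstPrimes (M N : Z) : Prog Z K (List Z) :=
  (lit 0).bind fun zero => (lit 1).bind fun one => (lit 2).bind fun two =>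
  (lit 16).bind fun c =>
  (arith .add M N).bind fun x0 => (arith .add x0 two).bind fun x => (bitlen x).bind fun L =>
  (arith .mul c x).bind fun y => (arith .mul y L).bind fun B => (arith .add B one).bind fun B' =>
  (range two B').bind fun is =>
  (mapP (fun i => (arith .div B i).bind fun q => (arith .add q one).bind fun q' =>
      (range two q').bind fun js => mapP (fun j => arith .mul i j) js) is).bind fun ms =>
  (sortP cmp ms.flatten).bind fun composites =>
  (maxP M two).bind fun a => (range a B').bind fun candidates =>
  (diffSorted candidates composites).bind fun ps =>
  (range zero N).bind fun idx => .ret ((ps.zip idx).map Prod.fst)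

/-! ### Algorithm HalfPoly -/

/-- `n` uniformly random elements of `{0, …, p - 1}`. -/
def randVec (p : Z) : ℕ → Prog Z K (List Z)
  | 0 => .ret []
  | n + 1 => .rand p fun a => (randVec p n).bind fun s => .ret (a :: s)

/-- The result of one substitution `(p, s)`: the prime, the vector, `f(x^s) - h(x^s)`, its remainder
modulo `x^p - 1`, and the number of terms of this remainder. -/
structure Trial (Z : Type) (K : Type u) where
  p : Z
  s : List Z
  fi : List (Z × K)
  fm : List (Z × K)
  terms : Z

/-- A trial with the largest number of terms, the first trial `t` being given separately. -/
def best (t : Trial Z K) : List (Trial Z K) → Prog Z K (Trial Z K)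
  | [] => .ret t
  | t' :: l => (cmp t.terms t'.terms).bind fun o => best (if o = .lt then t' else t) l

/-- Steps 5, 6 and 7: interpolate the `f(x^(s + p I_k))` and recover terms of `f - h`. -/
def recover (n : ℕ) (h : List (List Z × K)) (T D : Z) (t : Trial Z K) :
    Prog Z K (List (List Z × K)) :=
  (normP t.s).bind fun m =>
  (mapP (fun ka => (arith .add ka.1 t.p).bind fun a => (maxP m a).bind fun m' =>
      (arith .mul m' D).bind fun B => .interpShift t.s ka.2 t.p B T .ret) t.s.zipIdx).bind fun Fs =>
  (polySubs n h t.s t.p).bind fun hs =>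
  (mapP (fun x => subU x.1 x.2) (Fs.zip hs)).bind fun gs =>
  tsTerms t.fm t.fi gs t.p t.s D

/-- Algorithm HalfPoly with tolerance `ν = μ / w`; the result `none` means failure. -/
def halfPoly (n : ℕ) (h : List (List Z × K)) (T T₁ D : Z) (μ : ℝ) (w : Z) :
    Prog Z K (Option (List (List Z × K))) :=
  -- Step 1: `l`, `N = max (31 ⌊(T₁ - 1) log₂ D⌋) 1`, the primes
  (lit 0).bind fun zero => (lit 1).bind fun one => (lit 31).bind fun c31 =>
  (lit 32).bind fun c32 =>
  Prog.trials μ w T₁ fun l =>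
  (arith .sub T₁ one).bind fun t => (arith .pow D t).bind fun d => (bitlen d).bind fun b =>
  (arith .sub b one).bind fun b' => (arith .mul c31 b').bind fun N₀ =>
  (maxP N₀ one).bind fun N => (arith .mul c32 t).bind fun M =>
  (firstPrimes M N).bind fun ps =>
  -- Step 2: the random pairs `(p, s)`, without repetitions
  (range zero l).bind fun is =>
  (mapP (fun _ => Prog.pick ps fun p => (randVec p n).bind fun s => .ret (p :: s)) is).bind
    fun subs => (sortP cmpVec subs).bind fun sorted => (dedupSorted cmpVec sorted).bind fun ss =>
  -- Step 3: interpolate the `f(x^s)`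
  (mapP (fun v => match v with
      | [] => .ret none
      | p :: s => (normP s).bind fun m => (arith .mul m D).bind fun B =>
          Prog.interp s B T fun F => (substU h s).bind fun hs => (subU F hs).bind fun fi =>
          (modU p fi).bind fun fm => (lengthP fm).bind fun c =>
          .ret (some ⟨p, s, fi, fm, c⟩)) ss).bind fun trials =>
  -- Step 4: choose the best substitution
  match trials.filterMap id with
  | [] => .ret none
  | t :: ts => (best t ts).bind fun t₀ => (cmp t₀.terms T₁).bind fun o =>
      if o = .gt then .ret none
      else (recover n h T D t₀).bind fun g => .ret (some g)

/-! ### Algorithm MulPolySI -/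

/-- The loop `while T₁ > 0`; the first argument bounds the number of rounds. -/
def rounds (n : ℕ) (T D : Z) (μ : ℝ) (w : Z) :
    List Z → Z → List (List Z × K) → Prog Z K (Option (List (List Z × K)))
  | [], _, h => .ret (some h)
  | _ :: is, T₁, h => (lit 0).bind fun zero => (cmp T₁ zero).bind fun o =>
      if o = .gt then
        (halfPoly n h T T₁ D μ w).bind fun r =>
          match r with
          | none => .ret none
          | some g => (addM h g).bind fun h' => (lit 2).bind fun two =>
              (arith .div T₁ two).bind fun T₁' => rounds n T D μ w is T₁' h'
      else .ret (some h)

/-- Algorithm MulPolySI, for `n` variables, term bound `T ≥ 1`, degree bound `D` and tolerance `μ`.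
Here `w = ⌈log₂ T⌉ + 1`, as `⌈log₂ T⌉` is the bit length of `T - 1`; there are at most `w` rounds,
since `T₁` is halved in every round. -/
def mulPolySI (n : ℕ) (T D : Z) (μ : ℝ) : Prog Z K (Option (List (List Z × K))) :=
  (lit 0).bind fun zero => (lit 1).bind fun one => (arith .sub T one).bind fun t =>
  (bitlen t).bind fun b => (arith .add b one).bind fun w =>
  (range zero w).bind fun is => rounds n T D μ w is T []

end Programs

/-! ### Execution and cost -/

/-- One call of the univariate interpolation: the exponents `s` of the substitution `x_i = x^(s_i)`,
the degree bound and the term bound which are handed over. -/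
structure Query where
  exps : List ℕ
  degBound : ℕ
  termBound : ℕ

structure Cost where
  queries : List Query
  ringOps : ℕ
  bitOps : ℕ

def Cost.zero : Cost := ⟨[], 0, 0⟩
def Cost.bits (b : ℕ) (c : Cost) : Cost := { c with bitOps := b + c.bitOps }
def Cost.ring (c : Cost) : Cost := { c with ringOps := 1 + c.ringOps }
def Cost.query (q : Query) (c : Cost) : Cost := { c with queries := q :: c.queries }

/-- The charge for an elementary operation on integers with `b` bits altogether.  It dominates, up
to a constant factor, the bit complexity of addition, comparison, fast multiplication, and fast
division of such integers. -/
def opCost (b : ℕ) : ℕ := (b + 1) * (Nat.size b + 1) ^ 2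

/-- The uniform distribution on `{0, …, m - 1}` (and the number `0` if `m = 0`). -/
noncomputable def uniformBelow (m : ℕ) : PMF ℕ :=
  if h : 0 < m then PMF.uniformOfFinset (Finset.range m) (Finset.nonempty_range_iff.2 h.ne')
  else PMF.pure 0

/-- A univariate interpolation procedure: from `s` and bounds for the degree and for the number of
terms of `f(x^s)` it computes a list of terms. -/
abbrev Interpolator (R : Type u) := List ℕ → ℕ → ℕ → List (ℕ × R)

open Classical in
/-- The distribution of result and cost of a program, run with the univariate interpolation
procedure `U`. -/
noncomputable def run {R : Type u} [CommRing R] (U : Interpolator R) {α : Type v} :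
    Prog ℕ R α → PMF (α × Cost)
  | .ret a => PMF.pure (a, Cost.zero)
  | .lit c k => (run U (k c)).map (Prod.map id (Cost.bits (opCost c.size)))
  | .arith op a b k => (run U (k (op.eval a b))).map
      (Prod.map id (Cost.bits (opCost (a.size + b.size + (op.eval a b).size))))
  | .bitlen a k => (run U (k a.size)).map (Prod.map id (Cost.bits (opCost a.size)))
  | .cmp a b k => (run U (k (compare a b))).map
      (Prod.map id (Cost.bits (opCost (a.size + b.size))))
  | .range a b k => (run U (k (List.range' a (b - a)))).map
      (Prod.map id (Cost.bits ((b - a + 1) * opCost (a.size + b.size))))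
  | .trials μ w t k => (run U (k ⌈32 * Real.log (t * (μ / w)⁻¹)⌉₊)).map
      (Prod.map id (Cost.bits (opCost
        (w.size + t.size + ⌈32 * Real.log (t * (μ / w)⁻¹)⌉₊))))
  | .rand m k => (uniformBelow m).bind fun i =>
      (run U (k i)).map (Prod.map id (Cost.bits (opCost m.size)))
  | .pick xs k => (uniformBelow xs.length).bind fun i =>
      (run U (k (xs.getD i 0))).map
        (Prod.map id (Cost.bits (opCost (xs.length.size + (xs.getD i 0).size))))
  | .kadd a b k => (run U (k (a + b))).map (Prod.map id Cost.ring)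
  | .kneg a k => (run U (k (-a))).map (Prod.map id Cost.ring)
  | .kzero a k => (run U (k (decide (a = 0)))).map (Prod.map id Cost.ring)
  | .interp s B t k => (run U (k (U s B t))).map (Prod.map id (Cost.query ⟨s, B, t⟩))
  | .interpShift s j p B t k =>
      (run U (k (U (s.modify j (· + p)) B t))).map
        (Prod.map id (Cost.query ⟨s.modify j (· + p), B, t⟩))

/-! ### The specification -/

/-- The substitution `f(x^s) = f(x^(s_1), …, x^(s_n))`. -/
noncomputable def kron {R : Type u} [CommRing R] {n : ℕ} (f : MvPolynomial (Fin n) R)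
    (s : List ℕ) : Polynomial R :=
  MvPolynomial.aeval (fun i : Fin n => (Polynomial.X : Polynomial R) ^ s.getD i 0) f

/-- `l` is a list of the nonzero terms of the univariate polynomial `g`, each occurring once. -/
def ListsTerms {R : Type u} [CommRing R] (l : List (ℕ × R)) (g : Polynomial R) : Prop :=
  (l.map Prod.fst).Nodup ∧ (∀ m ∈ l, m.2 ≠ 0) ∧
    (l.map fun m => Polynomial.monomial m.1 m.2).sum = g

/-- The interpolation procedure `U` is correct for the univariate images of `f`: whenever the bounds
are valid for `f(x^s)`, it returns the terms of `f(x^s)`. -/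
def Interpolates {R : Type u} [CommRing R] {n : ℕ} (U : Interpolator R)
    (f : MvPolynomial (Fin n) R) : Prop :=
  ∀ (s : List ℕ) (B t : ℕ), s.length = n → (kron f s).natDegree ≤ B →
    (kron f s).support.card ≤ t → ListsTerms (U s B t) (kron f s)

/-- `l` is a list of the nonzero terms of the multivariate polynomial `f`, each occurring once. -/
def Represents {R : Type u} [CommRing R] {n : ℕ} (l : List (List ℕ × R))
    (f : MvPolynomial (Fin n) R) : Prop :=
  (l.map Prod.fst).Nodup ∧ (∀ m ∈ l, m.1.length = n ∧ m.2 ≠ 0) ∧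
    (l.map fun m =>
      MvPolynomial.monomial (Finsupp.equivFunOnFinite.symm fun i : Fin n => m.1.getD i 0) m.2).sum
      = f

/-- The logarithm of complexity bounds: `max(1, log₂ x)`. -/
noncomputable def lg (x : ℝ) : ℝ := max 1 (Real.logb 2 x)

/-- `g (log g)^c`, so that `O~(g)` is `O(soft c g)` for some constant `c`. -/
noncomputable def soft (c : ℕ) (g : ℝ) : ℝ := g * lg g ^ c

end SparseInterp

open scoped ENNReal

/-!
Let `f` have at most `T` terms and let `h` be the sum of the terms found so far, such that
`F = f - h` has at most `T₁` terms. A pair `(p, s)` sends the term `x^e` to the residue class of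
`⟨e, s⟩` modulo `p`, that is, to its exponent in `F(x^s) mod (x^p - 1)`.

*Correctness of one call of HalfPoly.* A term of `F` collides if another term is sent to the same
class. Two distinct exponent vectors agree modulo fewer than `D.size` primes
(`card_primes_lt_size`), and for every other prime `p` a random `s` identifies their images with
probability at most `1 / p` (`expect_randVec_le`). By the choice of the list of primes, the expected
number of collided terms is at most `(1/31 + 1/32) T₁`, so by Markov's inequality more than `T₁ / 6`
terms collide with probability at most `1/2` (`expect_bad_le`), and `l` independent pairs are all
bad with probability at most `2⁻ˡ ≤ ν`. The algorithm cannot see the collisions, but it picks the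
pair with the largest image. If some pair has at most `c ≤ T₁ / 6` collisions, then the picked pair
loses at most `c` terms in its image. As every class with collisions is met by at least two collided
terms, the number of collided terms plus the number of these classes is at most `3 c`. The recovery
procedure returns all terms without collisions and at most one wrong term for every class with
collisions, and thus at most `3 c ≤ T₁ / 2` terms are missing or wrong afterwards
(`two_mul_card_support_sub_le`). After `w` rounds nothing is left, and the failure probabilities add
up to at most `w ν = μ` (`expect_rounds_le`).

*Costs.* `Spec U V p q r b Q` states that in every execution of `p` the result satisfies `Q` and at
most `q` queries, all of them satisfying `V`, `r` ring operations and `b` bit operations are used.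
Such specifications compose along the program and yield explicit bounds (`Spec.mulPolySI`). The
integers which occur are at most `wordBound`, except for the power `D ^ (T₁ - 1)`, from which
`⌊(T₁ - 1) log₂ D⌋` is computed; the primes are at most `primeBound`, by Chebyshev's estimate
(`le_primeCounting`). The predicate `Soft` then turns the explicit bounds into `O~`-bounds: it is
compatible with sums and products, and bit lengths of quantities of polynomial size are
polylogarithmic (`Soft.size`).

Sparse polynomials are compared through their coefficient functions, of type `List ℕ →₀ R` and
`ℕ →₀ R`; a substitution is then `Finsupp.mapDomain` along the map of the exponents.
-/

namespace SparseInterp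

/-! ### Execution of composite programs -/

/-- The accumulated cost of two consecutive program parts. -/
def Cost.add (c d : Cost) : Cost :=
  ⟨c.queries ++ d.queries, c.ringOps + d.ringOps, c.bitOps + d.bitOps⟩

section Execution

variable {R : Type u} [CommRing R] {α : Type v} {β : Type w}

/-- `run_bind` passes through an instruction which changes the cost by `F`. -/
theorem run_bind_step {γ : Type*} (p : PMF (γ × Cost)) (g : γ → PMF (β × Cost))
    (F : Cost → Cost) (hF : ∀ c d : Cost, F (c.add d) = (F c).add d) :
    (p.bind fun x => (g x.1).map (Prod.map id x.2.add)).map (Prod.map id F) =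
      (p.map (Prod.map id F)).bind fun x => (g x.1).map (Prod.map id x.2.add) := by
  rw [PMF.map_bind, PMF.bind_map]
  congr 1
  funext x
  rw [PMF.map_comp]
  simp only [Function.comp, Prod.map_fst, Prod.map_snd, id]
  congr 1
  funext y
  simp [Prod.map, hF]

theorem Cost.bits_add (b : ℕ) (c d : Cost) : (c.add d).bits b = (c.bits b).add d := by
  simp [Cost.bits, Cost.add, add_assoc]

theorem Cost.ring_add (c d : Cost) : (c.add d).ring = c.ring.add d := by
  simp [Cost.ring, Cost.add, add_assoc]

theorem Cost.query_add (q : Query) (c d : Cost) : (c.add d).query q = (c.query q).add d := by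
  simp [Cost.query, Cost.add]

/-- Executing a sequential composition: the parts are executed one after the other and the costs
add up. -/
theorem run_bind (U : Interpolator R) (p : Prog ℕ R α) (g : α → Prog ℕ R β) :
    run U (p.bind g) = (run U p).bind fun x => (run U (g x.1)).map (Prod.map id x.2.add) := by
  induction p with
  | ret a =>
    have h : Cost.zero.add = id := by funext c; simp [Cost.add, Cost.zero]
    simp only [Prog.bind, run, PMF.pure_bind, h, Prod.map_id, PMF.map_id]
  | rand m k ih =>
    simp only [Prog.bind, run, PMF.bind_bind, ih]
    congr 1; funext i
    exact run_bind_step _ (fun a => run U (g a)) _ (Cost.bits_add _)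
  | pick xs k ih =>
    simp only [Prog.bind, run, PMF.bind_bind, ih]
    congr 1; funext i
    exact run_bind_step _ (fun a => run U (g a)) _ (Cost.bits_add _)
  | lit c k ih | arith op a b k ih | bitlen a k ih | cmp a b k ih | range a b k ih
  | trials μ w t k ih =>
    simp only [Prog.bind, run, ih]
    exact run_bind_step _ (fun a => run U (g a)) _ (Cost.bits_add _)
  | kadd a b k ih | kneg a k ih | kzero a k ih =>
    simp only [Prog.bind, run, ih]
    exact run_bind_step _ (fun a => run U (g a)) _ Cost.ring_add
  | interp s B t k ih | interpShift s j p B t k ih =>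
    simp only [Prog.bind, run, ih]
    exact run_bind_step _ (fun a => run U (g a)) _ (Cost.query_add _)

/-! ### Worst-case specifications of programs -/

/-- Worst-case specification of a program: for all outcomes of the random choices the result
satisfies `Q`, at most `q` queries are made, all of them satisfying `V`, and at most `r` ring
operations and `b` bit operations are charged. -/
def Spec (U : Interpolator R) (V : Query → Prop) (p : Prog ℕ R α) (q r b : ℕ) (Q : α → Prop) :
    Prop :=
  ∀ x ∈ (run U p).support, Q x.1 ∧ x.2.queries.length ≤ q ∧ (∀ y ∈ x.2.queries, V y) ∧
    x.2.ringOps ≤ r ∧ x.2.bitOps ≤ b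

variable {U : Interpolator R} {V : Query → Prop} {q r b q' r' b' : ℕ}

theorem Spec.mono {p : Prog ℕ R α} {Q Q' : α → Prop} (h : Spec U V p q r b Q)
    (hq : q ≤ q') (hr : r ≤ r') (hb : b ≤ b') (hQ : ∀ a, Q a → Q' a) :
    Spec U V p q' r' b' Q' := fun x hx =>
  let ⟨h1, h2, h3, h4, h5⟩ := h x hx
  ⟨hQ _ h1, h2.trans hq, h3, h4.trans hr, h5.trans hb⟩

theorem Spec.le {p : Prog ℕ R α} {Q : α → Prop} (h : Spec U V p q r b Q)
    (hq : q ≤ q' := by omega) (hr : r ≤ r' := by omega) (hb : b ≤ b' := by omega) :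
    Spec U V p q' r' b' Q := h.mono hq hr hb fun _ => id

/-- Programs without queries and ring operations. -/
theorem Spec.leB {p : Prog ℕ R α} {Q : α → Prop} (h : Spec U V p 0 0 b Q)
    (hb : b ≤ b' := by simp) : Spec U V p 0 0 b' Q := h.mono le_rfl le_rfl hb fun _ => id

theorem Spec.imp {p : Prog ℕ R α} {Q Q' : α → Prop} (h : Spec U V p q r b Q)
    (hQ : ∀ a, Q a → Q' a) : Spec U V p q r b Q' := h.mono le_rfl le_rfl le_rfl hQ

theorem Spec.bind {p : Prog ℕ R α} {g : α → Prog ℕ R β} {Q : α → Prop} {Q' : β → Prop}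
    (h : Spec U V p q r b Q) (h' : ∀ a, Q a → Spec U V (g a) q' r' b' Q') :
    Spec U V (p.bind g) (q + q') (r + r') (b + b') Q' := by
  intro x hx
  rw [run_bind, PMF.mem_support_bind_iff] at hx
  obtain ⟨y, hy, hx⟩ := hx
  rw [PMF.mem_support_map_iff] at hx
  obtain ⟨z, hz, rfl⟩ := hx
  obtain ⟨h1, h2, h3, h4, h5⟩ := h y hy
  obtain ⟨g1, g2, g3, g4, g5⟩ := h' _ h1 z hz
  refine ⟨g1, ?_, ?_, ?_, ?_⟩ <;> simp only [Cost.add, Prod.map]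
  · rw [List.length_append]; omega
  · intro w hw
    rcases List.mem_append.1 hw with hw | hw
    exacts [h3 _ hw, g3 _ hw]
  · omega
  · omega

theorem Spec.bindB {p : Prog ℕ R α} {g : α → Prog ℕ R β} {Q : α → Prop} {Q' : β → Prop}
    (h : Spec U V p 0 0 b Q) (h' : ∀ a, Q a → Spec U V (g a) 0 0 b' Q') :
    Spec U V (p.bind g) 0 0 (b + b') Q' := Spec.bind h h'

theorem Spec.ret {a : α} {Q : α → Prop} (h : Q a) : Spec U V (.ret a) 0 0 0 Q := by
  intro x hx
  simp only [run, PMF.mem_support_pure_iff] at hx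
  subst hx
  simp [h, Cost.zero]

theorem Spec.map_bits {p : PMF (α × Cost)} {c : ℕ} {Q : α → Prop}
    (h : ∀ x ∈ p.support, Q x.1 ∧ x.2.queries.length ≤ q ∧ (∀ y ∈ x.2.queries, V y) ∧
      x.2.ringOps ≤ r ∧ x.2.bitOps ≤ b) :
    ∀ x ∈ (p.map (Prod.map id (Cost.bits c))).support, Q x.1 ∧ x.2.queries.length ≤ q ∧
      (∀ y ∈ x.2.queries, V y) ∧ x.2.ringOps ≤ r ∧ x.2.bitOps ≤ c + b := by
  intro x hx
  rw [PMF.mem_support_map_iff] at hx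
  obtain ⟨z, hz, rfl⟩ := hx
  obtain ⟨h1, h2, h3, h4, h5⟩ := h z hz
  exact ⟨h1, h2, h3, h4, by simpa [Cost.bits] using h5⟩

theorem Spec.map_ring {p : PMF (α × Cost)} {Q : α → Prop}
    (h : ∀ x ∈ p.support, Q x.1 ∧ x.2.queries.length ≤ q ∧ (∀ y ∈ x.2.queries, V y) ∧
      x.2.ringOps ≤ r ∧ x.2.bitOps ≤ b) :
    ∀ x ∈ (p.map (Prod.map id Cost.ring)).support, Q x.1 ∧ x.2.queries.length ≤ q ∧
      (∀ y ∈ x.2.queries, V y) ∧ x.2.ringOps ≤ 1 + r ∧ x.2.bitOps ≤ b := by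
  intro x hx
  rw [PMF.mem_support_map_iff] at hx
  obtain ⟨z, hz, rfl⟩ := hx
  obtain ⟨h1, h2, h3, h4, h5⟩ := h z hz
  exact ⟨h1, h2, h3, by simpa [Cost.ring] using h4, h5⟩

theorem Spec.map_query {p : PMF (α × Cost)} {Q : α → Prop} {y : Query} (hy : V y)
    (h : ∀ x ∈ p.support, Q x.1 ∧ x.2.queries.length ≤ q ∧ (∀ y ∈ x.2.queries, V y) ∧
      x.2.ringOps ≤ r ∧ x.2.bitOps ≤ b) :
    ∀ x ∈ (p.map (Prod.map id (Cost.query y))).support, Q x.1 ∧ x.2.queries.length ≤ 1 + q ∧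
      (∀ y ∈ x.2.queries, V y) ∧ x.2.ringOps ≤ r ∧ x.2.bitOps ≤ b := by
  intro x hx
  rw [PMF.mem_support_map_iff] at hx
  obtain ⟨z, hz, rfl⟩ := hx
  obtain ⟨h1, h2, h3, h4, h5⟩ := h z hz
  refine ⟨h1, ?_, ?_, h4, h5⟩
  · simp [Cost.query]; omega
  · simpa [Cost.query, hy] using h3

/-- The charge for an operation on three integers which are at most `W`; it serves as the unit of
the bit costs. -/
def unit (W : ℕ) : ℕ := opCost (3 * W.size)

theorem opCost_mono {a b : ℕ} (h : a ≤ b) : opCost a ≤ opCost b := by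
  unfold opCost
  have := Nat.size_le_size h
  gcongr

theorem opCost_le_unit {s W : ℕ} (h : s ≤ 3 * W.size) : opCost s ≤ unit W := opCost_mono h

variable {W : ℕ} {Q : α → Prop}

theorem Spec.lit_bind {c : ℕ} {k : ℕ → Prog ℕ R α} (hc : c ≤ W)
    (h : Spec U V (k c) q r b Q) : Spec U V ((lit c).bind k) q r (unit W + b) Q := by
  refine Spec.le (b := opCost c.size + b) (Spec.map_bits h) le_rfl le_rfl ?_
  have := Nat.size_le_size hc
  exact Nat.add_le_add_right (opCost_le_unit (by omega)) _

theorem Spec.arith_bind {op : ArithOp} {x y : ℕ} {k : ℕ → Prog ℕ R α} (hx : x ≤ W) (hy : y ≤ W)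
    (hz : op.eval x y ≤ W) (h : Spec U V (k (op.eval x y)) q r b Q) :
    Spec U V ((arith op x y).bind k) q r (unit W + b) Q := by
  refine Spec.le (Spec.map_bits h) le_rfl le_rfl ?_
  have := Nat.size_le_size hx
  have := Nat.size_le_size hy
  have := Nat.size_le_size hz
  exact Nat.add_le_add_right (opCost_le_unit (by omega)) _

theorem Spec.bitlen_bind {x : ℕ} {k : ℕ → Prog ℕ R α} (hx : x ≤ W)
    (h : Spec U V (k x.size) q r b Q) :
    Spec U V ((bitlen x).bind k) q r (unit W + b) Q := by
  refine Spec.le (Spec.map_bits h) le_rfl le_rfl ?_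
  have := Nat.size_le_size hx
  exact Nat.add_le_add_right (opCost_le_unit (by omega)) _

theorem Spec.cmp_bind {x y : ℕ} {k : Ordering → Prog ℕ R α} (hx : x ≤ W) (hy : y ≤ W)
    (h : Spec U V (k (compare x y)) q r b Q) :
    Spec U V ((cmp x y).bind k) q r (unit W + b) Q := by
  refine Spec.le (Spec.map_bits h) le_rfl le_rfl ?_
  have := Nat.size_le_size hx
  have := Nat.size_le_size hy
  exact Nat.add_le_add_right (opCost_le_unit (by omega)) _

theorem Spec.range_bind {x y : ℕ} {k : List ℕ → Prog ℕ R α} (hx : x ≤ W) (hy : y ≤ W)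
    (h : Spec U V (k (List.range' x (y - x))) q r b Q) :
    Spec U V ((range x y).bind k) q r ((y - x + 1) * unit W + b) Q := by
  refine Spec.le (Spec.map_bits h) le_rfl le_rfl ?_
  have := Nat.size_le_size hx
  have := Nat.size_le_size hy
  exact Nat.add_le_add_right (Nat.mul_le_mul_left _ (opCost_le_unit (by omega))) _

theorem Spec.lit {c : ℕ} (hc : c ≤ W) :
    Spec U V (lit c : Prog ℕ R ℕ) 0 0 (unit W) fun z => z = c :=
  Spec.lit_bind (k := .ret) hc (Spec.ret (Q := fun z => z = c) rfl)

theorem Spec.arith {op : ArithOp} {x y : ℕ} (hx : x ≤ W) (hy : y ≤ W)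
    (hz : op.eval x y ≤ W) :
    Spec U V (arith op x y : Prog ℕ R ℕ) 0 0 (unit W) fun z => z = op.eval x y :=
  Spec.arith_bind (k := .ret) hx hy hz (Spec.ret (Q := fun z => z = op.eval x y) rfl)

theorem Spec.cmp {x y : ℕ} (hx : x ≤ W) (hy : y ≤ W) :
    Spec U V (cmp x y : Prog ℕ R Ordering) 0 0 (unit W) fun z => z = compare x y :=
  Spec.cmp_bind (k := .ret) hx hy (Spec.ret (Q := fun z => z = compare x y) rfl)

theorem Spec.kadd {x y : R} {k : R → Prog ℕ R α} (h : Spec U V (k (x + y)) q r b Q) :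
    Spec U V (.kadd x y k) q (1 + r) b Q := Spec.map_ring h

theorem Spec.kneg {x : R} {k : R → Prog ℕ R α} (h : Spec U V (k (-x)) q r b Q) :
    Spec U V (.kneg x k) q (1 + r) b Q := Spec.map_ring h

open Classical in
theorem Spec.kzero {x : R} {k : Bool → Prog ℕ R α} (h : Spec U V (k (decide (x = 0))) q r b Q) :
    Spec U V (.kzero x k) q (1 + r) b Q := Spec.map_ring h

theorem Spec.interp {s : List ℕ} {B t : ℕ} {k : List (ℕ × R) → Prog ℕ R α}
    (hV : V ⟨s, B, t⟩) (h : Spec U V (k (U s B t)) q r b Q) :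
    Spec U V (.interp s B t k) (1 + q) r b Q := Spec.map_query hV h

theorem Spec.interpShift {s : List ℕ} {j p B t : ℕ} {k : List (ℕ × R) → Prog ℕ R α}
    (hV : V ⟨s.modify j (· + p), B, t⟩)
    (h : Spec U V (k (U (s.modify j (· + p)) B t)) q r b Q) :
    Spec U V (.interpShift s j p B t k) (1 + q) r b Q := Spec.map_query hV h

theorem mem_support_uniformBelow {m i : ℕ} (hm : 0 < m) (h : i ∈ (uniformBelow m).support) :
    i < m := by
  unfold uniformBelow at h
  rw [dif_pos hm, PMF.mem_support_uniformOfFinset_iff] at h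
  exact Finset.mem_range.1 h

theorem Spec.rand {m : ℕ} {k : ℕ → Prog ℕ R α} (hm : 0 < m) (hW : m ≤ W)
    (h : ∀ i < m, Spec U V (k i) q r b Q) : Spec U V (.rand m k) q r (unit W + b) Q := by
  intro x hx
  simp only [run, PMF.mem_support_bind_iff] at hx
  obtain ⟨i, hi, hx⟩ := hx
  have hu : opCost m.size ≤ unit W :=
    opCost_le_unit (by have := Nat.size_le_size hW; omega)
  obtain ⟨h1, h2, h3, h4, h5⟩ := Spec.map_bits (h i (mem_support_uniformBelow hm hi)) x hx
  exact ⟨h1, h2, h3, h4, h5.trans (by omega)⟩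

theorem Spec.pick {xs : List ℕ} {k : ℕ → Prog ℕ R α} (hm : 0 < xs.length) (hl : xs.length ≤ W)
    (hW : ∀ x ∈ xs, x ≤ W) (h : ∀ x ∈ xs, Spec U V (k x) q r b Q) :
    Spec U V (.pick xs k) q r (unit W + b) Q := by
  intro x hx
  simp only [run, PMF.mem_support_bind_iff] at hx
  obtain ⟨i, hi, hx⟩ := hx
  have hi' := mem_support_uniformBelow hm hi
  have hmem : xs.getD i 0 ∈ xs := by
    rw [List.getD_eq_getElem _ _ hi']; exact List.getElem_mem _
  have hu : opCost (xs.length.size + (xs.getD i 0).size) ≤ unit W :=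
    opCost_le_unit (by
      have := Nat.size_le_size hl
      have := Nat.size_le_size (hW _ hmem)
      omega)
  obtain ⟨h1, h2, h3, h4, h5⟩ := Spec.map_bits (h _ hmem) x hx
  exact ⟨h1, h2, h3, h4, h5.trans (by omega)⟩

/-! ### Expected values of program results -/

/-- The expected value of `φ` at the result of a program. -/
noncomputable def expect (U : Interpolator R) (p : Prog ℕ R α) (φ : α → ℝ≥0∞) : ℝ≥0∞ :=
  ∑' x, run U p x * φ x.1

theorem tsum_bind_mul {γ δ : Type*} (p : PMF γ) (g : γ → PMF δ) (φ : δ → ℝ≥0∞) :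
    ∑' y, p.bind g y * φ y = ∑' x, p x * ∑' y, g x y * φ y := by
  simp only [PMF.bind_apply, ← ENNReal.tsum_mul_right, ← ENNReal.tsum_mul_left]
  rw [ENNReal.tsum_comm]
  simp only [mul_assoc]

theorem tsum_pure_mul {γ : Type*} (a : γ) (φ : γ → ℝ≥0∞) : ∑' y, PMF.pure a y * φ y = φ a := by
  rw [tsum_eq_single a]
  · simp
  · intro b hb
    simp [PMF.pure_apply, hb]

theorem tsum_map_mul {γ δ : Type*} (p : PMF γ) (g : γ → δ) (φ : δ → ℝ≥0∞) :
    ∑' y, p.map g y * φ y = ∑' x, p x * φ (g x) := by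
  unfold PMF.map
  rw [tsum_bind_mul]
  simp only [Function.comp, tsum_pure_mul]

theorem expect_bind (p : Prog ℕ R α) (g : α → Prog ℕ R β) (φ : β → ℝ≥0∞) :
    expect U (p.bind g) φ = expect U p fun a => expect U (g a) φ := by
  unfold expect
  rw [run_bind, tsum_bind_mul]
  simp only [tsum_map_mul, Prod.map_fst, id]

theorem expect_ret (a : α) (φ : α → ℝ≥0∞) : expect U (.ret a) φ = φ a := by
  unfold expect
  simp only [run]
  exact tsum_pure_mul _ fun x : α × Cost => φ x.1

theorem tsum_uniformBelow {m : ℕ} (hm : 0 < m) (φ : ℕ → ℝ≥0∞) :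
    ∑' i, uniformBelow m i * φ i = (∑ i ∈ Finset.range m, φ i) / m := by
  unfold uniformBelow
  rw [dif_pos hm, tsum_eq_sum (s := Finset.range m)]
  · rw [div_eq_mul_inv, Finset.sum_mul]
    refine Finset.sum_congr rfl fun i hi => ?_
    rw [PMF.uniformOfFinset_apply_of_mem _ hi, Finset.card_range, mul_comm]
  · intro i hi
    rw [PMF.uniformOfFinset_apply_of_notMem _ hi, zero_mul]

theorem expect_rand {m : ℕ} (hm : 0 < m) (k : ℕ → Prog ℕ R α) (φ : α → ℝ≥0∞) :
    expect U (.rand m k) φ = (∑ i ∈ Finset.range m, expect U (k i) φ) / m := by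
  rw [← tsum_uniformBelow hm]
  unfold expect
  simp only [run]
  rw [tsum_bind_mul]
  simp only [tsum_map_mul, Prod.map_fst, id]

theorem expect_pick {xs : List ℕ} (hm : 0 < xs.length) (k : ℕ → Prog ℕ R α) (φ : α → ℝ≥0∞) :
    expect U (.pick xs k) φ =
      (∑ i ∈ Finset.range xs.length, expect U (k (xs.getD i 0)) φ) / xs.length := by
  rw [← tsum_uniformBelow hm (fun i => expect U (k (xs.getD i 0)) φ)]
  unfold expect
  simp only [run]
  rw [tsum_bind_mul]
  simp only [tsum_map_mul, Prod.map_fst, id]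

theorem Spec.expect_le {p : Prog ℕ R α} (h : Spec U V p q r b Q) {φ ψ : α → ℝ≥0∞}
    (hφ : ∀ a, Q a → φ a ≤ ψ a) : expect U p φ ≤ expect U p ψ := by
  refine ENNReal.tsum_le_tsum fun x => ?_
  by_cases hx : run U p x = 0
  · simp [hx]
  · exact mul_le_mul_right (hφ _ (h x ((PMF.mem_support_iff _ _).2 hx)).1) _

theorem expect_mono {p : Prog ℕ R α} {φ ψ : α → ℝ≥0∞} (hφ : ∀ a, φ a ≤ ψ a) :
    expect U p φ ≤ expect U p ψ :=
  ENNReal.tsum_le_tsum fun _ => mul_le_mul_right (hφ _) _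

theorem expect_const (p : Prog ℕ R α) (c : ℝ≥0∞) : expect U p (fun _ => c) = c := by
  unfold expect
  rw [ENNReal.tsum_mul_right, PMF.tsum_coe, one_mul]

theorem expect_add (p : Prog ℕ R α) (φ ψ : α → ℝ≥0∞) :
    expect U p (fun a => φ a + ψ a) = expect U p φ + expect U p ψ := by
  unfold expect
  simp only [mul_add]
  exact ENNReal.tsum_add

theorem expect_mul_left (p : Prog ℕ R α) (c : ℝ≥0∞) (φ : α → ℝ≥0∞) :
    expect U p (fun a => c * φ a) = c * expect U p φ := by
  unfold expect
  rw [← ENNReal.tsum_mul_left]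
  simp only [mul_left_comm]

theorem expect_sum {ι : Type*} (p : Prog ℕ R α) (s : Finset ι) (φ : ι → α → ℝ≥0∞) :
    expect U p (fun a => ∑ i ∈ s, φ i a) = ∑ i ∈ s, expect U p (φ i) := by
  classical
  induction s using Finset.induction_on with
  | empty => simp [expect]
  | insert i s hi ih =>
    simp only [Finset.sum_insert hi, expect_add, ih]

/-- If the second part has expectation at most `ε` after each possible outcome of the first part,
then so has the composition. -/
theorem Spec.expect_bind_le {p : Prog ℕ R α} (h : Spec U V p q r b Q) {g : α → Prog ℕ R β}
    {φ : β → ℝ≥0∞} {ε : ℝ≥0∞} (hg : ∀ a, Q a → expect U (g a) φ ≤ ε) :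
    expect U (p.bind g) φ ≤ ε := by
  rw [expect_bind, ← expect_const (U := U) p ε]
  exact h.expect_le hg

end Execution

/-! ### Loops and lists of integers -/

section Loops

variable {R : Type u} [CommRing R] {α : Type v} {β : Type w} {U : Interpolator R}
  {V : Query → Prop} {W : ℕ}

theorem Spec.mapP {g : α → Prog ℕ R β} {l : List α} {q r : ℕ} {b : α → ℕ} {Q : α → β → Prop}
    (h : ∀ a ∈ l, Spec U V (g a) q r (b a) (Q a)) :
    Spec U V (mapP g l) (l.length * q) (l.length * r) (l.map b).sum
      fun l' => List.Forall₂ Q l l' := by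
  induction l with
  | nil => exact (Spec.ret (by simp)).le
  | cons a l ih =>
    refine Spec.le (Spec.bind (h a (by simp)) fun y hy => Spec.bind
        (ih fun a ha => h a (by simp [ha]))
      fun l' hl' => Spec.ret (List.Forall₂.cons hy hl')) ?_ ?_ ?_
    · simp only [List.length_cons]; linarith
    · simp only [List.length_cons]; linarith
    · simp

theorem Spec.mapP_const {g : α → Prog ℕ R β} {l : List α} {q r b : ℕ} {Q : α → β → Prop}
    (h : ∀ a ∈ l, Spec U V (g a) q r b (Q a)) :
    Spec U V (SparseInterp.mapP g l) (l.length * q) (l.length * r) (l.length * b)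
      fun l' => List.Forall₂ Q l l' :=
  Spec.le (Spec.mapP (b := fun _ => b) h) le_rfl le_rfl (by simp)

theorem Spec.mapP_eq {g : α → Prog ℕ R β} {l : List α} {q r b : ℕ} {f : α → β}
    (h : ∀ a ∈ l, Spec U V (g a) q r b fun y => y = f a) :
    Spec U V (SparseInterp.mapP g l) (l.length * q) (l.length * r) (l.length * b)
      fun l' => l' = l.map f := by
  refine Spec.imp (Spec.mapP_const h) fun l' hl' => ?_
  clear h
  induction hl' with
  | nil => rfl
  | cons h1 _ ih => rw [List.map_cons, h1, ih]

theorem Spec.maxP {x y : ℕ} (hx : x ≤ W) (hy : y ≤ W) :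
    Spec U V (maxP x y : Prog ℕ R ℕ) 0 0 (unit W) fun z => z = max x y := by
  refine Spec.cmp_bind (k := fun o => .ret (if o = .lt then y else x)) hx hy (Spec.ret ?_)
  split_ifs with h <;> rw [compare_lt_iff_lt] at h
  · rw [max_eq_right h.le]
  · rw [max_eq_left (not_lt.1 h)]

theorem Spec.lengthP {l : List α} (hl : l.length ≤ W) (hW : 1 ≤ W) :
    Spec U V (lengthP l : Prog ℕ R ℕ) 0 0 ((2 * l.length + 1) * unit W)
      fun z => z = l.length := by
  induction l with
  | nil => exact Spec.leB (Spec.lit (W := W) (Nat.zero_le _))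
  | cons a l ih =>
    rw [List.length_cons] at hl
    refine Spec.leB (b := (2 * l.length + 1) * unit W + (unit W + unit W))
      (Spec.bindB (ih (by omega)) fun m hm => Spec.lit_bind hW ?_)
      (by simp only [List.length_cons]; linarith)
    subst hm
    exact Spec.arith (op := .add) (by omega) hW hl

/-- The inner product of two lists. -/
def dotN (e s : List ℕ) : ℕ := (List.zipWith (· * ·) e s).sum

theorem dotN_le {e s : List ℕ} {A S : ℕ} (he : ∀ a ∈ e, a ≤ A) (hs : ∀ a ∈ s, a ≤ S) :
    dotN e s ≤ e.length * (A * S) := by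
  induction e generalizing s with
  | nil => simp [dotN]
  | cons a e ih =>
    cases s with
    | nil => simp [dotN]
    | cons b s =>
      simp only [List.mem_cons, forall_eq_or_imp] at he hs
      have := ih he.2 hs.2
      have := Nat.mul_le_mul he.1 hs.1
      simp only [dotN, List.zipWith_cons_cons, List.sum_cons, List.length_cons] at *
      linarith

theorem dotN_le_sum_mul {e s : List ℕ} {S : ℕ} (hs : ∀ a ∈ s, a ≤ S) :
    dotN e s ≤ e.sum * S := by
  induction e generalizing s with
  | nil => simp [dotN]
  | cons a e ih =>
    cases s with
    | nil => simp [dotN]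
    | cons b s =>
      simp only [List.mem_cons, forall_eq_or_imp] at hs
      have := ih hs.2
      have := Nat.mul_le_mul_left a hs.1
      simp only [dotN, List.zipWith_cons_cons, List.sum_cons] at *
      linarith

theorem Spec.dot {e s : List ℕ} {A S : ℕ} (he : ∀ a ∈ e, a ≤ A) (hs : ∀ a ∈ s, a ≤ S)
    (hA : A ≤ W) (hS : S ≤ W) (h : e.length * (A * S) ≤ W) :
    Spec U V (dot e s : Prog ℕ R ℕ) 0 0 ((2 * e.length + 1) * unit W) fun z => z = dotN e s := by
  induction e generalizing s with
  | nil => rw [SparseInterp.dot.eq_def]; exact Spec.leB (Spec.lit (W := W) (Nat.zero_le _))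
  | cons a e ih =>
    cases s with
    | nil =>
      rw [SparseInterp.dot.eq_def]
      exact Spec.leB (Spec.lit (W := W) (Nat.zero_le _))  (by nlinarith)
    | cons b s =>
      have h0 := dotN_le he hs
      simp only [List.mem_cons, forall_eq_or_imp] at he hs
      have h1 := dotN_le he.2 hs.2
      rw [List.length_cons] at h h0
      have h2 := Nat.mul_le_mul he.1 hs.1
      refine Spec.leB (b := unit W + ((2 * e.length + 1) * unit W + unit W))
        (Spec.arith_bind (op := .mul) (by omega) (by omega) ?_
          (Spec.bindB (ih he.2 hs.2 (by nlinarith)) fun d hd => ?_))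
        (by simp only [List.length_cons]; linarith)
      · simp only [ArithOp.eval]; nlinarith
      · subst hd
        have : a * b + dotN e s = dotN (a :: e) (b :: s) := by
          simp [dotN]
        refine Spec.imp (Spec.arith (op := .add) ?_ ?_ ?_) ?_
        · simp only [ArithOp.eval]; nlinarith
        · nlinarith
        · simp only [ArithOp.eval]; linarith
        · rintro z rfl
          simpa [ArithOp.eval] using this

theorem Spec.sumP {e : List ℕ} (h : e.sum ≤ W) :
    Spec U V (sumP e : Prog ℕ R ℕ) 0 0 ((e.length + 1) * unit W) fun z => z = e.sum := by
  induction e with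
  | nil => exact Spec.leB (Spec.lit (W := W) (Nat.zero_le _))
  | cons a e ih =>
    rw [List.sum_cons] at h
    refine Spec.leB (b := (e.length + 1) * unit W + unit W)
      (Spec.bindB (ih (by omega)) fun d hd => ?_)
      (by simp only [List.length_cons]; linarith)
    subst hd
    refine Spec.imp (Spec.arith (op := .add) (by omega) (by omega) h) ?_
    rintro z rfl
    simp [ArithOp.eval]

/-- The maximum of a list of natural numbers. -/
def maxN (s : List ℕ) : ℕ := s.foldr max 0

theorem le_maxN {s : List ℕ} {a : ℕ} (h : a ∈ s) : a ≤ maxN s := by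
  induction s with
  | nil => simp at h
  | cons b s ih =>
    rcases List.mem_cons.1 h with rfl | h
    · exact le_max_left _ _
    · exact (ih h).trans (le_max_right _ _)

theorem maxN_le {s : List ℕ} {S : ℕ} (h : ∀ a ∈ s, a ≤ S) : maxN s ≤ S := by
  induction s with
  | nil => exact Nat.zero_le _
  | cons b s ih =>
    simp only [List.mem_cons, forall_eq_or_imp] at h
    exact max_le h.1 (ih h.2)

theorem Spec.normP {s : List ℕ} (h : ∀ a ∈ s, a ≤ W) :
    Spec U V (normP s : Prog ℕ R ℕ) 0 0 ((s.length + 1) * unit W) fun z => z = maxN s := by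
  induction s with
  | nil => exact Spec.leB (Spec.lit (W := W) (Nat.zero_le _))
  | cons a s ih =>
    simp only [List.mem_cons, forall_eq_or_imp] at h
    refine Spec.leB (b := (s.length + 1) * unit W + unit W)
      (Spec.bindB (ih h.2) fun d hd => ?_)
      (by simp only [List.length_cons]; linarith)
    subst hd
    exact Spec.maxP h.1 (maxN_le h.2)

end Loops

/-! ### Comparisons and merge sort -/

/-- `o` is the result of comparing `x` with `y`. -/
def OrdSpec {κ : Type*} [LinearOrder κ] (o : Ordering) (x y : κ) : Prop :=
  (o = .lt ↔ x < y) ∧ (o = .eq ↔ x = y)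

theorem OrdSpec.compare {κ : Type*} [LinearOrder κ] (x y : κ) : OrdSpec (compare x y) x y :=
  ⟨compare_lt_iff_lt, compare_eq_iff_eq⟩

section Sorting

variable {R : Type u} [CommRing R] {α : Type v} {U : Interpolator R}
  {V : Query → Prop} {W : ℕ} {κ : Type w} [LinearOrder κ]

theorem Spec.cmpVec {s t : List ℕ} (hs : ∀ a ∈ s, a ≤ W) (ht : ∀ a ∈ t, a ≤ W) :
    Spec U V (cmpVec s t : Prog ℕ R Ordering) 0 0 (s.length * unit W) fun o => OrdSpec o s t := by
  induction s generalizing t with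
  | nil =>
    cases t with
    | nil => exact Spec.leB (Spec.ret (by simp [OrdSpec]))
    | cons b t => exact Spec.leB (Spec.ret (by simp [OrdSpec]))
  | cons a s ih =>
    cases t with
    | nil => exact Spec.leB (Spec.ret (by simp [OrdSpec]))
    | cons b t =>
      simp only [List.mem_cons, forall_eq_or_imp] at hs ht
      refine Spec.leB (b := unit W + s.length * unit W) (Spec.cmp_bind hs.1 ht.1 ?_)
        (by simp only [List.length_cons]; linarith)
      obtain ⟨h1, h2⟩ := OrdSpec.compare a b
      split_ifs with h
      · rw [h2] at h
        subst h
        refine Spec.imp (ih hs.2 ht.2) fun o ho => ?_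
        simpa [OrdSpec, List.cons_lt_cons_iff] using ho
      · refine Spec.leB (Spec.ret ?_)
        rw [h2] at h
        simp [OrdSpec, List.cons_lt_cons_iff, h1, h2, h]

/-- The program `c` compares objects which satisfy `P` by their keys. -/
def Compares (U : Interpolator R) (V : Query → Prop) (c : α → α → Prog ℕ R Ordering)
    (key : α → κ) (P : α → Prop) (b : ℕ) : Prop :=
  ∀ x y, P x → P y → Spec U V (c x y) 0 0 b fun o => OrdSpec o (key x) (key y)

theorem compares_cmp : Compares U V (cmp (K := R)) (id : ℕ → ℕ) (· ≤ W) (unit W) :=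
  fun _ _ hx hy => Spec.imp (Spec.cmp hx hy) (by rintro _ rfl; exact OrdSpec.compare _ _)

theorem compares_cmpVec {n : ℕ} : Compares U V (cmpVec (K := R)) (id : List ℕ → List ℕ)
    (fun s => s.length = n ∧ ∀ a ∈ s, a ≤ W) (n * unit W) :=
  fun _ _ hx hy => hx.1 ▸ Spec.cmpVec hx.2 hy.2

theorem Compares.comp {γ : Type*} {c : α → α → Prog ℕ R Ordering} {key : α → κ} {P : α → Prop}
    {b : ℕ} (h : Compares U V c key P b) (φ : γ → α) :
    Compares U V (fun x y => c (φ x) (φ y)) (fun x => key (φ x)) (fun x => P (φ x)) b :=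
  fun _ _ hx hy => h _ _ hx hy

variable {c : α → α → Prog ℕ R Ordering} {key : α → κ} {P : α → Prop} {b : ℕ}

theorem Spec.merge (hc : Compares U V c key P b) {xs ys : List α} (hx : ∀ x ∈ xs, P x)
    (hy : ∀ y ∈ ys, P y) (sx : xs.Pairwise fun x y => key x ≤ key y)
    (sy : ys.Pairwise fun x y => key x ≤ key y) :
    Spec U V (merge c xs ys) 0 0 ((xs.length + ys.length) * b)
      fun l => l.Perm (xs ++ ys) ∧ l.Pairwise fun x y => key x ≤ key y := by
  induction xs generalizing ys with
  | nil => rw [SparseInterp.merge]; exact Spec.leB (Spec.ret ⟨by simp, sy⟩)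
  | cons x xs ihx =>
    induction ys with
    | nil => rw [SparseInterp.merge]; exact Spec.leB (Spec.ret ⟨by simp, sx⟩)
    | cons y ys ihy =>
      rw [SparseInterp.merge]
      simp only [List.mem_cons, forall_eq_or_imp, List.pairwise_cons] at hx hy sx sy ihy
      refine Spec.leB (b := b + (xs.length + ys.length + 1) * b)
        (Spec.bindB (hc y x hy.1 hx.1) fun o ho => ?_)
        (by simp only [List.length_cons]; linarith)
      split_ifs with h
      · rw [ho.1] at h
        refine Spec.leB (Spec.bindB (ihy hy.2 sy.2) fun l hl => Spec.ret ⟨?_, ?_⟩)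
          (by simp only [List.length_cons]; linarith)
        · exact (hl.1.cons y).trans List.perm_middle.symm
        · refine List.pairwise_cons.2 ⟨fun z hz => ?_, hl.2⟩
          have := hl.1.mem_iff.1 hz
          simp only [List.mem_append, List.mem_cons] at this
          rcases this with (rfl | hz) | hz
          · exact h.le
          · exact h.le.trans (sx.1 _ hz)
          · exact sy.1 _ hz
      · rw [ho.1, not_lt] at h
        refine Spec.leB (Spec.bindB (ihx hx.2 (by simpa using hy) sx.2 (by simpa using sy))
          fun l hl => Spec.ret ⟨?_, ?_⟩)
          (by simp only [List.length_cons]; linarith)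
        · exact hl.1.cons x
        · refine List.pairwise_cons.2 ⟨fun z hz => ?_, hl.2⟩
          have := hl.1.mem_iff.1 hz
          simp only [List.mem_append, List.mem_cons] at this
          rcases this with hz | (rfl | hz)
          · exact sx.1 _ hz
          · exact h
          · exact h.trans (sy.1 _ hz)

theorem size_half (m : ℕ) : m.size = (m / 2).size + if m = 0 then 0 else 1 := by
  split_ifs with h
  · simp [h]
  · have h1 : m = Nat.bit (m.bodd) (m / 2) := by
      conv_lhs => rw [← Nat.bit_bodd_div2 m, Nat.div2_val]
    conv_lhs => rw [h1]
    rw [Nat.size_bit]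
    rwa [← h1]

theorem Spec.sortP (hc : Compares U V c key P b) {l : List α} (hl : ∀ x ∈ l, P x) :
    Spec U V (sortP c l) 0 0 (l.length * (l.length - 1).size * b)
      fun l' => l'.Perm l ∧ l'.Pairwise fun x y => key x ≤ key y := by
  induction h : l.length using Nat.strong_induction_on generalizing l with
  | _ m ih =>
    subst h
    match l, ih with
    | [], _ => rw [SparseInterp.sortP]; exact Spec.leB (Spec.ret ⟨by simp, by simp⟩)
    | [a], _ => rw [SparseInterp.sortP]; exact Spec.leB (Spec.ret ⟨by simp, by simp⟩)
    | x :: y :: l, ih =>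
      rw [SparseInterp.sortP]
      set L := x :: y :: l with hL
      have hlen : L.length = l.length + 2 := by simp [hL]
      set t := (l.length + 2) / 2 with ht
      have h1 : (L.take t).length = t := by rw [List.length_take]; omega
      have h2 : (L.drop t).length = l.length + 2 - t := by rw [List.length_drop, hlen]
      refine Spec.leB (Spec.bindB (ih _ (by omega) (fun x hx => hl x (List.mem_of_mem_take hx)) rfl)
        fun xs hxs => Spec.bindB (ih _ (by omega) (fun x hx => hl x (List.mem_of_mem_drop hx)) rfl)
        fun ys hys => Spec.imp (Spec.merge (b := b) hc
          (fun x hx => hl x (List.mem_of_mem_take (hxs.1.mem_iff.1 hx)))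
          (fun x hx => hl x (List.mem_of_mem_drop (hys.1.mem_iff.1 hx))) hxs.2 hys.2 |>.leB
            (b' := L.length * b)
            (by rw [hxs.1.length_eq, hys.1.length_eq, h1, h2, hlen]
                exact Nat.mul_le_mul_right _ (by omega))) fun l' hl' => ⟨?_, hl'.2⟩)  ?_
      · exact hl'.1.trans ((hxs.1.append hys.1).trans (by rw [List.take_append_drop]))
      · rw [h1, h2, hlen]
        have e := size_half (l.length + 2 - 1)
        rw [if_neg (by omega)] at e
        have e1 : (t - 1).size ≤ ((l.length + 2 - 1) / 2).size := Nat.size_le_size (by omega)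
        have e2 : (l.length + 2 - t - 1).size ≤ ((l.length + 2 - 1) / 2).size :=
          Nat.size_le_size (by omega)
        rw [e]
        set z := ((l.length + 2 - 1) / 2).size
        calc _ ≤ t * z * b + ((l.length + 2 - t) * z * b + (l.length + 2) * b) := by gcongr
          _ = (t + (l.length + 2 - t)) * z * b + (l.length + 2) * b := by ring
          _ = (l.length + 2) * (z + 1) * b := by
            rw [show t + (l.length + 2 - t) = l.length + 2 by omega]; ring

theorem Spec.dedupSorted {c : κ → κ → Prog ℕ R Ordering} {P : κ → Prop}
    (hc : Compares U V c id P b) {l : List κ}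
    (hl : ∀ x ∈ l, P x) :
    Spec U V (dedupSorted c l) 0 0 (l.length * b)
      fun l' => l'.length ≤ l.length ∧ ∀ x, x ∈ l' ↔ x ∈ l := by
  induction l with
  | nil => exact Spec.leB (Spec.ret (by simp))
  | cons x l ih =>
    cases l with
    | nil => exact Spec.leB (Spec.ret (by simp))
    | cons y l =>
      simp only [List.mem_cons, forall_eq_or_imp] at hl ih
      refine Spec.leB (b := b + (y :: l).length * b) (Spec.bindB (hc x y hl.1 hl.2.1) fun o ho =>
        Spec.bindB (ih hl.2) fun r hr => Spec.ret ?_)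
        (by simp only [List.length_cons]; linarith)
      obtain ⟨h1, h2⟩ := hr
      simp only [List.length_cons] at *
      split_ifs with h
      · rw [ho.2] at h
        simp only [id] at h
        subst h
        refine ⟨by omega, fun z => ?_⟩
        rw [h2]; simp
      · refine ⟨by simp only [List.length_cons]; omega, fun z => ?_⟩
        simp [h2]

theorem Spec.best {t : Trial ℕ R} {l : List (Trial ℕ R)} (h : ∀ x ∈ t :: l, x.terms ≤ W) :
    Spec U V (best t l) 0 0 (l.length * unit W)
      fun t₀ => t₀ ∈ t :: l ∧ ∀ x ∈ t :: l, x.terms ≤ t₀.terms := by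
  induction l generalizing t with
  | nil => exact Spec.leB (Spec.ret (by simp))
  | cons t' l ih =>
    simp only [List.mem_cons, forall_eq_or_imp] at h ih ⊢
    refine Spec.leB (b := unit W + l.length * unit W) (Spec.cmp_bind h.1 h.2.1
      (Spec.imp (ih (t := if compare t.terms t'.terms = .lt then t' else t) ?_) ?_))
      (by simp only [List.length_cons]; linarith)
    · split_ifs
      exacts [h.2, ⟨h.1, h.2.2⟩]
    · intro t₀ ht
      split_ifs at ht with h' <;> rw [compare_lt_iff_lt] at h' <;> obtain ⟨h1, h2, h3⟩ := ht
      · exact ⟨by tauto, by omega, h2, h3⟩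
      · exact ⟨by tauto, h2, by omega, h3⟩

end Sorting

/-! ### Lists of terms as finitely supported functions -/

section Terms

variable {R : Type u} [CommRing R] {κ : Type w}

/-- The coefficient function of a list of terms; like terms are added up. -/
noncomputable def coeffs (l : List (κ × R)) : κ →₀ R :=
  (l.map fun m => Finsupp.single m.1 m.2).sum

@[simp] theorem coeffs_nil : coeffs ([] : List (κ × R)) = 0 := rfl

@[simp] theorem coeffs_cons (m : κ × R) (l : List (κ × R)) :
    coeffs (m :: l) = Finsupp.single m.1 m.2 + coeffs l := by simp [coeffs]

@[simp] theorem coeffs_append (l l' : List (κ × R)) :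
    coeffs (l ++ l') = coeffs l + coeffs l' := by simp [coeffs]

theorem coeffs_perm {l l' : List (κ × R)} (h : l.Perm l') : coeffs l = coeffs l' :=
  (h.map _).sum_eq

theorem coeffs_map {κ' : Type*} (φ : κ → κ') (l : List (κ × R)) :
    coeffs (l.map fun m => (φ m.1, m.2)) = (coeffs l).mapDomain φ := by
  induction l with
  | nil => simp
  | cons m l ih => simp [ih, Finsupp.mapDomain_add, Finsupp.mapDomain_single]

theorem coeffs_neg (l : List (κ × R)) : coeffs (l.map fun m => (m.1, -m.2)) = -coeffs l := by
  induction l with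
  | nil => simp
  | cons m l ih => simp [ih, add_comm]

theorem coeffs_apply_of_notMem {l : List (κ × R)} {a : κ} (h : ∀ m ∈ l, m.1 ≠ a) :
    coeffs l a = 0 := by
  induction l with
  | nil => simp
  | cons m l ih =>
    simp only [List.mem_cons, forall_eq_or_imp] at h
    simp [ih h.2, h.1]

theorem exists_mem_of_mem_support_coeffs {l : List (κ × R)} {a : κ}
    (h : a ∈ (coeffs l).support) : ∃ m ∈ l, m.1 = a := by
  by_contra! H
  exact Finsupp.mem_support_iff.1 h (coeffs_apply_of_notMem H)

theorem card_support_coeffs_le (l : List (κ × R)) : (coeffs l).support.card ≤ l.length := by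
  classical
  induction l with
  | nil => simp
  | cons m l ih =>
    rw [coeffs_cons, List.length_cons]
    refine (Finset.card_le_card Finsupp.support_add).trans ((Finset.card_union_le _ _).trans ?_)
    have : (Finsupp.single m.1 m.2).support.card ≤ 1 := by
      simpa using Finset.card_le_card (Finsupp.support_single_subset (a := m.1) (b := m.2))
    omega

/-- `l` lists the terms of `F`: the keys are distinct and the coefficients nonzero. -/
def Terms (l : List (κ × R)) (F : κ →₀ R) : Prop :=
  (l.map Prod.fst).Nodup ∧ (∀ m ∈ l, m.2 ≠ 0) ∧ coeffs l = F

theorem coeffs_apply_of_mem {l : List (κ × R)} (h : (l.map Prod.fst).Nodup) {m : κ × R}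
    (hm : m ∈ l) : coeffs l m.1 = m.2 := by
  induction l with
  | nil => simp at hm
  | cons x l ih =>
    rw [List.map_cons, List.nodup_cons] at h
    rcases List.mem_cons.1 hm with rfl | hm
    · rw [coeffs_cons, Finsupp.add_apply, Finsupp.single_eq_same, coeffs_apply_of_notMem, add_zero]
      rintro y hy e
      exact h.1 (e ▸ List.mem_map_of_mem hy)
    · have : x.1 ≠ m.1 := fun e => h.1 (e ▸ List.mem_map_of_mem hm)
      rw [coeffs_cons, Finsupp.add_apply, ih h.2 hm, Finsupp.single_eq_of_ne this.symm, zero_add]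

theorem Terms.mem_iff {l : List (κ × R)} {F : κ →₀ R} (h : Terms l F) {m : κ × R} :
    m ∈ l ↔ m.1 ∈ F.support ∧ m.2 = F m.1 := by
  obtain ⟨h1, h2, rfl⟩ := h
  constructor
  · intro hm
    have := coeffs_apply_of_mem h1 hm
    exact ⟨by rw [Finsupp.mem_support_iff, this]; exact h2 _ hm, this.symm⟩
  · rintro ⟨hm, e⟩
    obtain ⟨m', hm', e'⟩ := exists_mem_of_mem_support_coeffs hm
    have := coeffs_apply_of_mem h1 hm'
    rw [e', ← e] at this
    have : m = m' := Prod.ext e'.symm this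
    rwa [this]

theorem Terms.exists_mem {l : List (κ × R)} {F : κ →₀ R} (h : Terms l F) {a : κ}
    (ha : a ∈ F.support) : ∃ m ∈ l, m.1 = a := ⟨(a, F a), h.mem_iff.2 ⟨ha, rfl⟩, rfl⟩

theorem Terms.length_eq {l : List (κ × R)} {F : κ →₀ R} (h : Terms l F) :
    l.length = F.support.card := by
  classical
  have : F.support = (l.map Prod.fst).toFinset := by
    ext a
    simp only [List.mem_toFinset, List.mem_map]
    constructor
    · exact fun ha => h.exists_mem ha
    · rintro ⟨m, hm, rfl⟩
      exact (h.mem_iff.1 hm).1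
  rw [this, List.toFinset_card_of_nodup h.1, List.length_map]

theorem Terms.key_mem {l l' : List (κ × R)} (h : Terms l (coeffs l')) {m : κ × R} (hm : m ∈ l) :
    ∃ m' ∈ l', m'.1 = m.1 := exists_mem_of_mem_support_coeffs (h.mem_iff.1 hm).1

theorem card_support_mapDomain_le {κ' : Type*} (φ : κ → κ') (F : κ →₀ R) :
    (F.mapDomain φ).support.card ≤ F.support.card := by
  classical
  exact (Finset.card_le_card Finsupp.mapDomain_support).trans Finset.card_image_le

theorem exists_of_mem_support_mapDomain {κ' : Type*} {φ : κ → κ'} {F : κ →₀ R} {a : κ'}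
    (h : a ∈ (F.mapDomain φ).support) : ∃ e ∈ F.support, φ e = a := by
  classical
  simpa using Finsupp.mapDomain_support h

theorem Spec.consTerm {U : Interpolator R} {V : Query → Prop} (a : κ) (x : R) (r : List (κ × R)) :
    Spec U V (consTerm a x r) 0 1 0 fun l => (x = 0 ∧ l = r) ∨ (x ≠ 0 ∧ l = (a, x) :: r) := by
  refine Spec.kzero (r := 0) (Spec.ret ?_)
  by_cases h : x = 0 <;> simp [h]

end Terms

/-- A list of terms in normal form: the keys are strictly increasing. -/
def Sorted {R : Type u} {κ : Type w} [LinearOrder κ] (l : List (κ × R)) : Prop :=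
  l.Pairwise fun x y => x.1 < y.1

theorem Sorted.nodup {R : Type u} {κ : Type w} [LinearOrder κ] {l : List (κ × R)} (h : Sorted l) :
    (l.map Prod.fst).Nodup := by
  rw [List.Nodup, List.pairwise_map]
  exact h.imp fun h => h.ne

/-! ### Arithmetic of sparse polynomials -/

section Arithmetic

variable {R : Type u} [CommRing R] {U : Interpolator R}
  {V : Query → Prop} {W : ℕ} {κ : Type w} [LinearOrder κ]

variable {c : κ → κ → Prog ℕ R Ordering} {P : κ → Prop} {b : ℕ}

/-- Each term causes one addition or one test for zero. -/
theorem Spec.combine (hc : Compares U V c id P b) {a : κ} {x : R} {l : List (κ × R)} (ha : P a)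
    (hl : ∀ m ∈ l, P m.1) (hs : l.Pairwise fun x y => x.1 ≤ y.1) (hal : ∀ m ∈ l, a ≤ m.1) :
    Spec U V (combine c a x l) 0 (l.length + 1) (l.length * b) fun l' =>
      Sorted l' ∧ (∀ m ∈ l', m.2 ≠ 0 ∧ a ≤ m.1) ∧ coeffs l' = Finsupp.single a x + coeffs l := by
  induction l generalizing a x with
  | nil =>
    refine Spec.mono (Spec.consTerm a x []) (by simp) (by simp) (by simp) ?_
    rintro l' (⟨h, rfl⟩ | ⟨h, rfl⟩) <;> simp [h, Sorted]
  | cons m l ih =>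
    obtain ⟨k, y⟩ := m
    simp only [List.mem_cons, forall_eq_or_imp, List.pairwise_cons] at hl hs hal
    refine Spec.mono (q := 0 + 0) (r := 0 + (l.length + 2)) (b := b + l.length * b)
      (Q := fun l' => Sorted l' ∧ (∀ m ∈ l', m.2 ≠ 0 ∧ a ≤ m.1) ∧
        coeffs l' = Finsupp.single a x + coeffs ((k, y) :: l)) ?_
      le_rfl (by simp) (by simp only [List.length_cons]; linarith) fun _ h => h
    refine Spec.bind (hc a k ha hl.1) fun o ho => ?_
    obtain ⟨-, ho⟩ := ho
    simp only [id] at ho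
    split_ifs with h
    · obtain rfl := ho.1 h
      refine Spec.mono (Spec.kadd (ih (x := x + y) ha hl.2 hs.2 hal.2)) le_rfl (by omega) le_rfl ?_
      rintro l' ⟨h1, h2, h3⟩
      refine ⟨h1, h2, ?_⟩
      rw [h3, coeffs_cons, Finsupp.single_add, add_assoc]
    · have hlt : a < k := lt_of_le_of_ne hal.1 (fun e => h (ho.2 e))
      refine Spec.mono (Spec.bind (ih (x := y) hl.1 hl.2 hs.2 hs.1)
        fun r hr => Spec.imp (Spec.consTerm a x r)
          (Q' := fun l' => Sorted l' ∧ (∀ m ∈ l', m.2 ≠ 0 ∧ a ≤ m.1) ∧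
        coeffs l' = Finsupp.single a x + coeffs ((k, y) :: l)) ?_)
        le_rfl (by omega) (by omega) fun _ h => h
      obtain ⟨h1, h2, h3⟩ := hr
      rintro l' (⟨h, rfl⟩ | ⟨h, rfl⟩)
      · exact ⟨h1, fun m hm => ⟨(h2 m hm).1, hlt.le.trans (h2 m hm).2⟩, by simp [h, h3]⟩
      · refine ⟨List.pairwise_cons.2 ⟨fun m hm => hlt.trans_le (h2 m hm).2, h1⟩, ?_, by simp [h3]⟩
        simp only [List.mem_cons, forall_eq_or_imp]
        exact ⟨⟨h, le_rfl⟩, fun m hm => ⟨(h2 m hm).1, hlt.le.trans (h2 m hm).2⟩⟩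

/-- The bit operations spent on collecting `m` terms when a comparison costs `b`. -/
def collectCost (m b : ℕ) : ℕ := m * ((m - 1).size + 1) * b

theorem collectCost_mono {m m' b b' : ℕ} (h : m ≤ m') (hb : b ≤ b') :
    collectCost m b ≤ collectCost m' b' := by
  unfold collectCost
  have := Nat.size_le_size (Nat.sub_le_sub_right h 1)
  gcongr

theorem Spec.collect (hc : Compares U V c id P b) {l : List (κ × R)} (hl : ∀ m ∈ l, P m.1) :
    Spec U V (collect c l) 0 l.length (collectCost l.length b) fun l' =>
      Sorted l' ∧ Terms l' (coeffs l) := by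
  refine Spec.mono (Spec.bind (b' := l.length * b) (q' := 0) (r' := l.length)
    (Q' := fun l' => Sorted l' ∧ Terms l' (coeffs l))
    (Spec.sortP (hc.comp Prod.fst) hl) fun l' hl' => ?_)
    le_rfl (by omega) (by unfold collectCost; linarith) fun _ h => h
  obtain ⟨h1, h2⟩ := hl'
  rw [← coeffs_perm h1, ← h1.length_eq]
  have hl' : ∀ m ∈ l', P m.1 := fun m hm => hl m (h1.mem_iff.1 hm)
  clear h1 hl
  match l' with
  | [] =>
    exact Spec.le (Spec.ret (by simp [Sorted, Terms])) (Nat.zero_le _) (Nat.zero_le _)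
      (Nat.zero_le _)
  | (a, x) :: r =>
    simp only [List.mem_cons, forall_eq_or_imp, List.pairwise_cons, id] at hl' h2
    refine Spec.mono (Spec.combine hc hl'.1 hl'.2 h2.2 h2.1) le_rfl (by simp)
      (by simp only [List.length_cons]; linarith) ?_
    rintro l ⟨h3, h4, h5⟩
    exact ⟨h3, h3.nodup, fun m hm => (h4 m hm).1, by rw [h5, coeffs_cons]⟩

theorem Spec.subU {g h : List (ℕ × R)} (hg : ∀ m ∈ g, m.1 ≤ W) (hh : ∀ m ∈ h, m.1 ≤ W) :
    Spec U V (subU g h) 0 (g.length + 2 * h.length)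
      (collectCost (g.length + h.length) (unit W)) fun l =>
      Sorted l ∧ Terms l (coeffs g - coeffs h) := by
  refine Spec.mono (Spec.bind (q' := 0) (r' := g.length + h.length)
    (b' := collectCost (g.length + h.length) (unit W)) (Spec.mapP_eq (q := 0) (r := 1) (b := 0)
    (f := fun m => (m.1, -m.2)) fun m _ => ?_)
    fun h' hh' => ?_) (by simp) (by simp; try omega) (by simp) fun _ h => h
  · exact Spec.kneg (r := 0) (Spec.ret rfl)
  · subst hh'
    refine Spec.mono (Spec.collect (compares_cmp (W := W))
      (l := g ++ h.map fun m => (m.1, -m.2)) ?_) le_rfl (by simp) (by simp) ?_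
    · intro m hm
      simp only [List.mem_append, List.mem_map] at hm
      rcases hm with hm | ⟨m₀, hm₀, rfl⟩
      exacts [hg _ hm, hh m₀ hm₀]
    · intro l hl
      rwa [coeffs_append, coeffs_neg, ← sub_eq_add_neg] at hl

theorem Spec.modU {p : ℕ} {g : List (ℕ × R)} (hp : p ≤ W) (hg : ∀ m ∈ g, m.1 ≤ W) :
    Spec U V (modU p g) 0 g.length (g.length * unit W + collectCost g.length (unit W)) fun l =>
      Sorted l ∧ Terms l ((coeffs g).mapDomain (· % p)) := by
  have hle : ∀ m ∈ g, m.1 % p ≤ W := fun m hm => (Nat.mod_le _ _).trans (hg m hm)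
  refine Spec.mono (Spec.bind (q' := 0) (r' := g.length) (b' := collectCost g.length (unit W))
    (Spec.mapP_eq (q := 0) (r := 0) (b := unit W)
    (f := fun m => (m.1 % p, m.2)) fun m hm => ?_)
    fun h' hh' => ?_) (by simp) (by simp; try omega) (by simp) fun _ h => h
  · exact Spec.arith_bind (op := .mod) (b := 0) (hg m hm) hp (hle m hm) (Spec.ret rfl)
  · subst hh'
    refine Spec.mono (Spec.collect (compares_cmp (W := W)) (l := g.map fun m => (m.1 % p, m.2)) ?_)
      le_rfl (by simp) (by simp) ?_
    · intro m hm
      obtain ⟨m₀, hm₀, rfl⟩ := List.mem_map.1 hm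
      exact hle m₀ hm₀
    · intro l hl
      rwa [coeffs_map (· % p)] at hl

theorem Spec.addM {n : ℕ} {g h : List (List ℕ × R)}
    (hg : ∀ m ∈ g, m.1.length = n ∧ ∀ a ∈ m.1, a ≤ W)
    (hh : ∀ m ∈ h, m.1.length = n ∧ ∀ a ∈ m.1, a ≤ W) :
    Spec U V (addM g h) 0 (g.length + h.length)
      (collectCost (g.length + h.length) (n * unit W)) fun l =>
      Sorted l ∧ Terms l (coeffs g + coeffs h) := by
  refine Spec.mono (Spec.collect (compares_cmpVec (W := W) (n := n)) (l := g ++ h) ?_)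
    le_rfl (by simp) (by simp) ?_
  · intro m hm
    rcases List.mem_append.1 hm with hm | hm
    exacts [hg _ hm, hh _ hm]
  · intro l hl
    rwa [coeffs_append] at hl

theorem Spec.substU {n A S : ℕ} {g : List (List ℕ × R)} {s : List ℕ}
    (hg : ∀ m ∈ g, m.1.length = n ∧ ∀ a ∈ m.1, a ≤ A) (hs : ∀ a ∈ s, a ≤ S)
    (hA : A ≤ W) (hS : S ≤ W) (h : n * (A * S) ≤ W) :
    Spec U V (substU g s) 0 g.length
      (g.length * ((2 * n + 1) * unit W) + collectCost g.length (unit W)) fun l =>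
      Sorted l ∧ Terms l ((coeffs g).mapDomain (dotN · s)) := by
  refine Spec.mono (Spec.bind (q' := 0) (r' := g.length) (b' := collectCost g.length (unit W))
    (Spec.mapP_eq (q := 0) (r := 0) (b := (2 * n + 1) * unit W)
    (f := fun m => (dotN m.1 s, m.2)) fun m hm => ?_)
    fun h' hh' => ?_) (by simp) (by simp; try omega) (by simp) fun _ h => h
  · refine Spec.leB (Spec.bindB (b' := 0)
      (Spec.dot (hg m hm).2 hs hA hS ((hg m hm).1 ▸ h)) fun z hz => ?_)
      (by rw [(hg m hm).1]; exact le_rfl)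
    exact Spec.ret (by rw [hz])
  · subst hh'
    refine Spec.mono (Spec.collect (compares_cmp (W := W))
        (l := g.map fun m => (dotN m.1 s, m.2)) ?_)
      le_rfl (by simp) (by simp) ?_
    · intro m hm
      obtain ⟨m₀, hm₀, rfl⟩ := List.mem_map.1 hm
      exact (dotN_le (hg m₀ hm₀).2 hs).trans ((hg m₀ hm₀).1 ▸ h)
    · intro l hl
      rwa [coeffs_map (dotN · s)] at hl

theorem Spec.shifts {p n A E K : ℕ} {ts : List (ℕ × List ℕ × R)} (hp : p ≤ W)
    (h1 : ∀ m ∈ ts, m.1 ≤ A) (h2 : ∀ m ∈ ts, ∀ a ∈ m.2.1, a ≤ E) (hK : A + E * p ≤ K)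
    (hE : E ≤ W) (hW : K ≤ W) :
    Spec U V (shifts p n ts) 0 (n * ts.length)
      (n * (ts.length * (2 * unit W) + collectCost ts.length (unit W))) fun hs =>
      hs.length = n ∧ ∀ k (hk : k < hs.length), (Sorted hs[k] ∧
        Terms hs[k] (coeffs (ts.map fun m => (m.1 + m.2.1.getD k 0 * p, m.2.2)))) ∧
        ∀ m ∈ hs[k], m.1 ≤ K := by
  induction n generalizing ts with
  | zero => exact Spec.le (Spec.mono (Spec.ret (Q := fun l => l = []) rfl) le_rfl le_rfl le_rfl
      (by rintro _ rfl; simp))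
  | succ n ih =>
    have hle : ∀ m ∈ ts, ∀ k, m.1 + m.2.1.getD k 0 * p ≤ K := by
      intro m hm k
      refine le_trans ?_ hK
      gcongr
      · exact h1 m hm
      · rcases lt_or_ge k m.2.1.length with hk | hk
        · rw [List.getD_eq_getElem _ _ hk]; exact h2 m hm _ (List.getElem_mem _)
        · rw [List.getD_eq_default _ _ hk]; exact Nat.zero_le _
    refine Spec.mono (Spec.bind (q' := 0) (r' := ts.length + (n * ts.length + 0))
      (b' := collectCost ts.length (unit W) +
        (n * (ts.length * (2 * unit W) + collectCost ts.length (unit W)) + 0))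
      (Spec.mapP_eq (q := 0) (r := 0) (b := 2 * unit W)
      (f := fun m => (m.1 + m.2.1.getD 0 0 * p, m.2.2)) fun m hm => ?_)
      fun row hrow => Spec.bind (q := 0) (q' := 0)
        (Q := fun h => (Sorted h ∧ Terms h (coeffs row)) ∧ ∀ m ∈ h, m.1 ≤ K)
        ?_ fun h hh => Spec.bind (q := 0) (q' := 0) (Spec.mono (ih
          (ts := ts.map fun m => (m.1, m.2.1.tail, m.2.2)) ?_ ?_) le_rfl (by simp) (by simp)
            fun _ h => h) fun hs hhs => Spec.ret ?_)
      le_rfl (by linarith) (by linarith) fun _ h => h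
    rotate_left 4
    · refine ⟨by simp [hhs.1], fun k hk => ?_⟩
      cases k with
      | zero => rw [← hrow]; exact hh
      | succ k =>
        have := hhs.2 k (by simpa using hk)
        rw [List.map_map] at this
        simpa [Function.comp_def, List.getD_eq_getElem?_getD] using this
    · obtain ⟨d, e, x⟩ := m
      have h3 := hle _ hm 0
      cases e with
      | nil => exact Spec.leB (Spec.ret (by simp)) (by omega)
      | cons a e =>
        have h4 := h1 _ hm
        have h5 := h2 _ hm a (by simp)
        simp only [List.getD_cons_zero] at h3
        refine Spec.leB (b := unit W + (unit W + 0)) (Spec.arith_bind (op := .mul)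
          (by omega) hp (by simp only [ArithOp.eval]; omega)
          (Spec.arith_bind (op := .add) (by simp only [] at h4; omega)
            (by simp only [ArithOp.eval]; omega)
            (by simp only [ArithOp.eval]; omega) (Spec.ret ?_))) (by omega)
        simp [ArithOp.eval]
    · subst hrow
      refine Spec.mono (Spec.collect (compares_cmp (W := W)) ?_) le_rfl (by simp) (by simp)
        fun h hh => ⟨hh, fun m hm => ?_⟩
      · intro m hm
        obtain ⟨m₀, hm₀, rfl⟩ := List.mem_map.1 hm
        exact (hle m₀ hm₀ 0).trans hW
      · obtain ⟨m', hm', e⟩ := hh.2.key_mem hm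
        obtain ⟨m0, hm0, rfl⟩ := List.mem_map.1 hm'
        exact e ▸ hle m0 hm0 0
    · intro m hm
      obtain ⟨m₀, hm₀, rfl⟩ := List.mem_map.1 hm
      exact h1 m₀ hm₀
    · intro m hm a ha
      obtain ⟨m₀, hm₀, rfl⟩ := List.mem_map.1 hm
      exact h2 m₀ hm₀ a (List.mem_of_mem_tail ha)

theorem Spec.polySubs {p n A S K : ℕ} {g : List (List ℕ × R)} {s : List ℕ} (hp : p ≤ W)
    (hg : ∀ m ∈ g, m.1.length = n ∧ m.1.sum ≤ A) (hs : ∀ a ∈ s, a ≤ S) (hA : A ≤ W) (hS : S ≤ W)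
    (h : n * (A * S) ≤ W) (hK : A * S + A * p ≤ K) (hW : K ≤ W) :
    Spec U V (polySubs n g s p) 0 (n * g.length)
      (g.length * ((2 * n + 1) * unit W) +
        n * (g.length * (2 * unit W) + collectCost g.length (unit W))) fun hs =>
      hs.length = n ∧ ∀ k (hk : k < hs.length), (Sorted hs[k] ∧
        Terms hs[k] ((coeffs g).mapDomain fun e => dotN e s + e.getD k 0 * p)) ∧
        ∀ m ∈ hs[k], m.1 ≤ K := by
  have hg' : ∀ m ∈ g, ∀ a ∈ m.1, a ≤ A := fun m hm a ha =>
    (List.le_sum_of_mem ha).trans (hg m hm).2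
  refine Spec.mono (Spec.bind (q' := 0) (r' := n * g.length)
    (b' := n * (g.length * (2 * unit W) + collectCost g.length (unit W)))
    (Spec.mapP_eq (q := 0) (r := 0) (b := (2 * n + 1) * unit W)
    (f := fun m => (dotN m.1 s, m.1, m.2)) fun m hm => ?_)
    fun ts hts => Spec.mono (Spec.shifts (W := W) (A := A * S) (E := A) (K := K) hp ?_ ?_ hK hA hW)
      le_rfl (by simp [hts]) (by simp [hts]) ?_) (by simp) (by simp) le_rfl fun _ h => h
  · refine Spec.leB (Spec.bindB (b' := 0) (Spec.dot (hg' m hm) hs hA hS ((hg m hm).1 ▸ h))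
      fun z hz => ?_)
      (by rw [(hg m hm).1]; exact le_rfl)
    exact Spec.ret (by rw [hz])
  · subst hts
    intro m hm
    obtain ⟨m₀, hm₀, rfl⟩ := List.mem_map.1 hm
    exact (dotN_le_sum_mul hs).trans (Nat.mul_le_mul_right _ (hg m₀ hm₀).2)
  · subst hts
    intro m hm
    obtain ⟨m₀, hm₀, rfl⟩ := List.mem_map.1 hm
    exact hg' m₀ hm₀
  · subst hts
    rintro l ⟨h1, h2⟩
    refine ⟨h1, fun k hk => ?_⟩
    have := h2 k hk
    rw [List.map_map] at this
    simpa only [Function.comp_def, coeffs_map (fun e => dotN e s + e.getD k 0 * p)] using this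

end Arithmetic

/-! ### Recovering terms from their images -/

theorem sublist_map_filterMap {α : Type*} {β : Type*} {γ : Type*} {l : List α} {f : α → Option β}
    {φ : β → γ} {ψ : α → γ} (h : ∀ j ∈ l, ∀ y, f j = some y → φ y = ψ j) :
    ((l.filterMap f).map φ).Sublist (l.map ψ) := by
  induction l with
  | nil => simp
  | cons j l ih =>
    simp only [List.mem_cons, forall_eq_or_imp] at h
    rw [List.filterMap_cons]
    cases hj : f j with
    | none => exact (ih h.2).cons _
    | some y =>
      simp only [List.map_cons, h.1 y hj]
      exact (ih h.2).cons_cons _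

theorem filter_eq_singleton_iff {α : Type*} {l : List α} (hl : l.Nodup) {p : α → Bool} {x : α} :
    l.filter p = [x] ↔ ∀ y, (y ∈ l ∧ p y = true) ↔ y = x := by
  rw [← List.perm_singleton, List.perm_ext_iff_of_nodup (hl.filter _) (List.nodup_singleton x)]
  simp

section Recover

variable {R : Type u} [CommRing R] {U : Interpolator R}
  {V : Query → Prop} {W : ℕ}

/-- The flag `single` records whether the class `r` has been met once; otherwise the class `r` has
to be skipped. -/
theorem Spec.uniques {r v : ℕ} {single : Bool} {l : List (ℕ × ℕ)} (hr : r ≤ W)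
    (hl : ∀ m ∈ l, m.1 ≤ W) (hs : l.Pairwise fun x y => x.1 ≤ y.1) (hrl : ∀ m ∈ l, r ≤ m.1) :
    Spec U V (uniques r v single l : Prog ℕ R _) 0 0 (l.length * unit W) fun t =>
      Sorted t ∧ (∀ m ∈ t, r ≤ m.1) ∧ t.length ≤ l.length + 1 ∧
      ∀ r' v', (r', v') ∈ t ↔ if single then ((r, v) :: l).filter (·.1 = r') = [(r', v')]
        else r' ≠ r ∧ l.filter (·.1 = r') = [(r', v')] := by
  induction l generalizing r v single with
  | nil =>
    refine Spec.leB (Spec.ret ?_)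
    cases single
    · simp [Sorted]
    · refine ⟨by simp [Sorted], by simp, by simp, fun r' v' => ?_⟩
      by_cases h : r = r'
      · subst h; simp [eq_comm]
      · have h' : ¬ r' = r := fun e => h e.symm
        simp [h, h']
  | cons m l ih =>
    obtain ⟨r1, v1⟩ := m
    simp only [List.mem_cons, forall_eq_or_imp, List.pairwise_cons] at hl hs hrl
    refine Spec.leB (b := unit W + l.length * unit W) (Spec.cmp_bind hr hl.1 ?_)
      (by simp only [List.length_cons]; linarith)
    by_cases h : compare r r1 = .eq
    · rw [if_pos h]
      rw [compare_eq_iff_eq] at h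
      subst h
      refine Spec.imp (ih hr hl.2 hs.2 hrl.2) fun t ht => ?_
      obtain ⟨h1, h2, h3, h4⟩ := ht
      refine ⟨h1, h2, by simp only [List.length_cons]; omega, fun r' v' => ?_⟩
      rw [h4]
      by_cases h : r' = r
      · subst h; cases single <;> simp
      · have h' : ¬ r = r' := fun e => h e.symm
        cases single <;> simp [h, h']
    · rw [if_neg h]
      rw [compare_eq_iff_eq] at h
      have hlt : r < r1 := lt_of_le_of_ne hrl.1 h
      refine Spec.leB (Spec.bindB (ih (v := v1) (single := true) hl.1 hl.2 hs.2 hs.1)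
        fun t ht => Spec.ret ?_)
      obtain ⟨h1, h2, h3, h4⟩ := ht
      simp only [if_true] at h4
      have hnot : ∀ m ∈ t, m.1 ≠ r := fun m hm => (hlt.trans_le (h2 m hm)).ne'
      have hrest : ((r1, v1) :: l).filter (fun x => decide (x.1 = r)) = [] := by
        rw [List.filter_eq_nil_iff]
        simp only [List.mem_cons, forall_eq_or_imp, decide_eq_true_eq]
        exact ⟨hlt.ne', fun m hm => (hlt.trans_le (hs.1 m hm)).ne'⟩
      cases single
      · refine ⟨h1, fun m hm => hlt.le.trans (h2 m hm), by simp; omega, fun r' v' => ?_⟩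
        simp only [Bool.false_eq_true, if_false]
        rw [h4]
        refine ⟨fun h' => ⟨?_, h'⟩, fun h => h.2⟩
        rintro rfl
        exact hnot _ ((h4 _ _).2 h') rfl
      · simp only [if_true]
        refine ⟨List.pairwise_cons.2 ⟨fun m hm => hlt.trans_le (h2 m hm), h1⟩, ?_,
          by simp; omega, fun r' v' => ?_⟩
        · simp only [List.mem_cons, forall_eq_or_imp]
          exact ⟨le_rfl, fun m hm => hlt.le.trans (h2 m hm)⟩
        · by_cases h : r' = r
          · subst h
            rw [List.filter_cons_of_pos (by simp), hrest]
            have : (r', v') ∉ t := fun h => hnot _ h rfl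
            simp [this, eq_comm]
          · rw [List.filter_cons_of_neg (by simpa using fun e : r = r' => h e.symm), ← h4]
            simp [h]

/-- The exponent `v` of `G` is the only one in the residue class `d` modulo `p`. -/
def IsSingle (p : ℕ) (G : ℕ →₀ R) (d v : ℕ) : Prop :=
  v ∈ G.support ∧ v % p = d ∧ ∀ v' ∈ G.support, v' % p = d → v' = v

theorem Spec.singles {p : ℕ} {g : List (ℕ × R)} {G : ℕ →₀ R} (hp : p ≤ W) (hg : Terms g G)
    (hW : ∀ m ∈ g, m.1 ≤ W) :
    Spec U V (singles p g) 0 0 (collectCost g.length (unit W) + g.length * unit W) fun t =>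
      Sorted t ∧ t.length ≤ g.length ∧ (∀ m ∈ t, m.1 ≤ W) ∧
        ∀ d v, (d, v) ∈ t ↔ IsSingle p G d v := by
  have hle : ∀ m ∈ g, m.1 % p ≤ W := fun m hm => (Nat.mod_le _ _).trans (hW m hm)
  refine Spec.leB (Spec.bindB (b' := g.length * (g.length - 1).size * unit W + g.length * unit W)
    (Spec.mapP_eq (q := 0) (r := 0) (b := unit W)
    (f := fun m => (m.1 % p, m.1)) fun m hm => ?_) fun l hl => ?_)
    (by unfold collectCost; linarith)
  · exact Spec.arith_bind (op := .mod) (b := 0) (hW m hm) hp (hle m hm) (Spec.ret rfl)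
  have hlen : l.length = g.length := by simp [hl]
  have hlW : ∀ m ∈ l, m.1 ≤ W := by
    intro m hm
    rw [hl] at hm
    obtain ⟨m₀, hm₀, rfl⟩ := List.mem_map.1 hm
    exact hle m₀ hm₀
  refine Spec.bindB (Spec.leB (Spec.sortP ((compares_cmp (W := W)).comp Prod.fst) hlW)
    (by rw [hlen])) fun l' hl' => ?_
  obtain ⟨h1, h2⟩ := hl'
  have hlen' : l'.length = g.length := by rw [h1.length_eq, hlen]
  have hl'W : ∀ m ∈ l', m.1 ≤ W := fun m hm => hlW m (h1.mem_iff.1 hm)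
  have hnd : l.Nodup := by
    refine List.Nodup.of_map Prod.snd ?_
    rw [hl, List.map_map]
    exact hg.1
  have key : ∀ d v, l'.filter (·.1 = d) = [(d, v)] ↔ IsSingle p G d v := by
    intro d v
    rw [filter_eq_singleton_iff (h1.nodup_iff.2 hnd)]
    have hmem : ∀ y : ℕ × ℕ, y ∈ l' ↔ y.2 ∈ G.support ∧ y.2 % p = y.1 := by
      intro y
      rw [h1.mem_iff, hl, List.mem_map]
      constructor
      · rintro ⟨m, hm, rfl⟩
        exact ⟨(hg.mem_iff.1 hm).1, rfl⟩
      · rintro ⟨h, h'⟩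
        obtain ⟨m, hm, e⟩ := hg.exists_mem h
        exact ⟨m, hm, by rw [e, h']⟩
    simp only [hmem, decide_eq_true_eq]
    constructor
    · intro h
      have h0 := (h (d, v)).2 rfl
      exact ⟨h0.1.1, h0.1.2, fun v' hv' e => congrArg Prod.snd ((h (d, v')).1 ⟨⟨hv', e⟩, rfl⟩)⟩
    · rintro ⟨h3, h4, h5⟩ ⟨d', v'⟩
      simp only [Prod.mk.injEq]
      constructor
      · rintro ⟨⟨h6, h7⟩, rfl⟩
        exact ⟨rfl, h5 v' h6 h7⟩
      · rintro ⟨rfl, rfl⟩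
        exact ⟨⟨h3, h4⟩, rfl⟩
  clear h1 hl
  cases l' with
  | nil =>
    refine Spec.leB (Spec.ret ⟨by simp [Sorted], by simp, by simp, fun d v => ?_⟩) (Nat.zero_le _)
    rw [← key]; simp
  | cons m t =>
    obtain ⟨r, v⟩ := m
    simp only [List.mem_cons, forall_eq_or_imp, List.pairwise_cons,
      List.length_cons] at hl'W h2 hlen'
    refine Spec.mono (Spec.uniques (single := true) hl'W.1 hl'W.2 h2.2 h2.1) le_rfl le_rfl
      (Nat.mul_le_mul_right _ (by omega)) ?_
    rintro t' ⟨h3, h4, h5, h6⟩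
    simp only [if_true] at h6
    refine ⟨h3, by omega, fun m hm => ?_, fun d v => by rw [h6, key]⟩
    obtain ⟨h7, h8, -⟩ := (key _ _).1 ((h6 m.1 m.2).1 hm)
    obtain ⟨m', hm', e⟩ := hg.exists_mem h7
    rw [← h8, ← e]
    exact hle m' hm'

theorem Spec.join {α : Type v} {xs : List (ℕ × α)} {ys : List (ℕ × ℕ)} (hx : ∀ m ∈ xs, m.1 ≤ W)
    (hy : ∀ m ∈ ys, m.1 ≤ W) (sx : Sorted xs) (sy : Sorted ys) :
    Spec U V (join xs ys : Prog ℕ R _) 0 0 ((xs.length + ys.length) * unit W) fun t =>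
      (t.map Prod.fst).Sublist (xs.map Prod.fst) ∧
      ∀ d a b, (d, a, b) ∈ t ↔ (d, a) ∈ xs ∧ (d, b) ∈ ys := by
  induction xs generalizing ys with
  | nil => rw [SparseInterp.join]; exact Spec.leB (Spec.ret (by simp))
  | cons m xs ihx =>
    induction ys with
    | nil => rw [SparseInterp.join]; exact Spec.leB (Spec.ret (by simp))
    | cons m' ys ihy =>
      obtain ⟨d, a⟩ := m
      obtain ⟨r, b⟩ := m'
      rw [SparseInterp.join]
      have sx' := sx
      have sy' := sy
      have hx' := hx
      have hy' := hy
      simp only [Sorted, List.mem_cons, forall_eq_or_imp, List.pairwise_cons] at hx sx' hy sy'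
      refine Spec.leB (b := unit W + (xs.length + ys.length + 1) * unit W)
        (Spec.cmp_bind hx.1 hy.1 ?_) (by simp only [List.length_cons]; linarith)
      rcases lt_trichotomy d r with h | h | h
      · rw [compare_lt_iff_lt.2 h]
        refine Spec.mono (ihx hx.2 hy' sx'.2 sy) le_rfl le_rfl
          (by simp only [List.length_cons]; linarith) ?_
        rintro t ⟨h1, h2⟩
        refine ⟨h1.cons _, fun d' a' b' => ?_⟩
        rw [h2]
        simp only [List.mem_cons, Prod.mk.injEq]
        constructor
        · rintro ⟨h3, h4⟩
          exact ⟨Or.inr h3, h4⟩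
        · rintro ⟨⟨rfl, rfl⟩ | h3, h4⟩
          · rcases h4 with ⟨rfl, rfl⟩ | h4
            · exact absurd h (lt_irrefl _)
            · exact absurd (h.trans (sy'.1 _ h4)) (lt_irrefl _)
          · exact ⟨h3, h4⟩
      · subst h
        rw [compare_eq_iff_eq.2 rfl]
        refine Spec.leB (Spec.bindB (b' := 0) (ihx hx.2 hy.2 sx'.2 sy'.2) fun t ht => Spec.ret ?_)
          (by linarith)
        obtain ⟨h1, h2⟩ := ht
        refine ⟨h1.cons_cons _, fun d' a' b' => ?_⟩
        simp only [List.mem_cons, Prod.mk.injEq, h2]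
        constructor
        · rintro (⟨rfl, rfl, rfl⟩ | ⟨h3, h4⟩)
          · simp
          · exact ⟨Or.inr h3, Or.inr h4⟩
        · rintro ⟨⟨rfl, rfl⟩ | h3, ⟨h5, rfl⟩ | h4⟩
          · simp
          · exact absurd (sy'.1 _ h4) (lt_irrefl _)
          · exact absurd (h5 ▸ sx'.1 _ h3) (lt_irrefl _)
          · exact Or.inr ⟨h3, h4⟩
      · rw [compare_gt_iff_gt.2 h]
        refine Spec.mono (ihy hy.2 sy'.2) le_rfl le_rfl
          (by simp only [List.length_cons]; linarith) ?_
        rintro t ⟨h1, h2⟩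
        refine ⟨h1, fun d' a' b' => ?_⟩
        rw [h2]
        simp only [List.mem_cons, Prod.mk.injEq]
        constructor
        · rintro ⟨h3, h4⟩
          exact ⟨h3, Or.inr h4⟩
        · rintro ⟨h4, ⟨rfl, rfl⟩ | h3⟩
          · rcases h4 with ⟨rfl, rfl⟩ | h4
            · exact absurd h (lt_irrefl _)
            · exact absurd (h.trans (sx'.1 _ h4)) (lt_irrefl _)
          · exact ⟨h4, h3⟩

theorem Spec.exactQuot {p v b : ℕ} (hp : 0 < p) (hpW : p ≤ W) (hv : v ≤ W) (hb : b ≤ W) :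
    Spec U V (exactQuot p v b : Prog ℕ R _) 0 0 (5 * unit W) fun o =>
      ∀ x, o = some x ↔ b = v + p * x := by
  refine Spec.leB (b := unit W + (unit W + (unit W + (unit W + (unit W + 0)))))
    (Spec.cmp_bind hb hv ?_) (by linarith)
  split_ifs with h <;> rw [compare_lt_iff_lt] at h
  · refine Spec.leB (Spec.ret fun x => ?_) (Nat.zero_le _)
    have : b ≠ v + p * x := by
      rintro rfl
      exact absurd h (by have := Nat.zero_le (p * x); omega)
    simp [this]
  · rw [not_lt] at h
    have h1 : (b - v) / p ≤ b - v := Nat.div_le_self _ _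
    have h2 : (b - v) / p * p ≤ b - v := Nat.div_mul_le_self _ _
    refine Spec.arith_bind (op := .sub) hb hv (by simp only [ArithOp.eval]; omega)
      (Spec.arith_bind (op := .div) (by simp only [ArithOp.eval]; omega) hpW
        (by simp only [ArithOp.eval]; omega)
      (Spec.arith_bind (op := .mul) (by simp only [ArithOp.eval]; omega) hpW
        (by simp only [ArithOp.eval]; omega)
      (Spec.cmp_bind (by simp only [ArithOp.eval]; omega) (by simp only [ArithOp.eval]; omega)
        (Spec.ret fun x => ?_))))
    split_ifs with h3 <;> rw [compare_eq_iff_eq] at h3 <;> simp only [ArithOp.eval] at h3 ⊢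
    · rw [Option.some_inj]
      constructor
      · rintro rfl
        rw [mul_comm]; omega
      · rintro rfl
        rw [Nat.add_sub_cancel_left, Nat.mul_div_cancel_left _ hp]
    · simp only [false_iff]
      rintro rfl
      rw [Nat.add_sub_cancel_left, Nat.mul_div_cancel_left _ hp, mul_comm] at h3
      exact h3 rfl

/-- The bit operations spent on extending at most `m` candidates by one entry. -/
def extendCost (W m : ℕ) : ℕ := collectCost m (unit W) + 8 * (m * unit W)

theorem Spec.extend {p m : ℕ} {g : List (ℕ × R)} {cs : List (ℕ × R × ℕ × List ℕ)} (hp : 0 < p)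
    (hpW : p ≤ W) (hg : (g.map Prod.fst).Nodup ∧ ∀ m ∈ g, m.2 ≠ 0) (hW : ∀ m ∈ g, m.1 ≤ W)
    (hcs : Sorted cs) (hcW : ∀ j ∈ cs, j.1 ≤ W ∧ j.2.2.1 ≤ W) (hgm : g.length ≤ m)
    (hcm : cs.length ≤ m) :
    Spec U V (extend p g cs) 0 0 (extendCost W m) fun t =>
      (t.map Prod.fst).Sublist (cs.map Prod.fst) ∧
      ∀ d a v e', (d, a, v, e') ∈ t ↔ ∃ x e, e' = x :: e ∧ (d, a, v, e) ∈ cs ∧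
        IsSingle p (coeffs g) d (v + p * x) := by
  have hT : Terms g (coeffs g) := ⟨hg.1, hg.2, rfl⟩
  have hc1 : collectCost g.length (unit W) ≤ collectCost m (unit W) := collectCost_mono hgm le_rfl
  have hc2 : g.length * unit W ≤ m * unit W := Nat.mul_le_mul_right _ hgm
  have hc3 : cs.length * unit W ≤ m * unit W := Nat.mul_le_mul_right _ hcm
  refine Spec.leB (b := collectCost g.length (unit W) + g.length * unit W +
    ((cs.length + g.length) * unit W + (cs.length * (5 * unit W) + 0)))
    (Spec.bindB (Spec.singles hpW hT hW) fun bs hbs => ?_) (by unfold extendCost; linarith)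
  obtain ⟨h1, h2, h3, h4⟩ := hbs
  refine Spec.bindB (Spec.leB (Spec.join (fun j hj => (hcW j hj).1) h3 hcs h1)
    (Nat.mul_le_mul_right _ (by omega))) fun js hjs => ?_
  obtain ⟨h5, h6⟩ := hjs
  have hjl : js.length ≤ cs.length := by simpa using h5.length_le
  have hbW : ∀ d v, IsSingle p (coeffs g) d v → v ≤ W := by
    rintro d v ⟨h, -⟩
    obtain ⟨m, hm, rfl⟩ := hT.exists_mem h
    exact hW m hm
  refine Spec.bindB (Spec.leB (Spec.mapP_const (q := 0) (r := 0) (b := 5 * unit W)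
    (Q := fun j o => ∀ y, o = some y ↔ ∃ x, j.2.2 = j.2.1.2.1 + p * x ∧
      y = (j.1, j.2.1.1, j.2.1.2.1, x :: j.2.1.2.2)) fun j hj => ?_)
    (Nat.mul_le_mul_right _ hjl)) fun l hl => Spec.ret ?_
  · obtain ⟨d, ⟨a, v, e⟩, b⟩ := j
    have hj' := (h6 _ _ _).1 hj
    refine Spec.leB (Spec.bindB (b' := 0) (Spec.exactQuot hp hpW (hcW _ hj'.1).2
      (hbW d b ((h4 _ _).1 hj'.2))) fun o ho => Spec.ret fun y => ?_)
    simp only [Option.map_eq_some_iff, ho]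
    simp only [eq_comm (a := y)]
  · have hfm : ∃ f : ℕ × (R × ℕ × List ℕ) × ℕ → Option (ℕ × R × ℕ × List ℕ),
        (∀ j y, f j = some y ↔ ∃ x, j.2.2 = j.2.1.2.1 + p * x ∧
        y = (j.1, j.2.1.1, j.2.1.2.1, x :: j.2.1.2.2)) ∧ l = js.map f := by
      classical
      refine ⟨fun j => if h : ∃ x, j.2.2 = j.2.1.2.1 + p * x then
        some (j.1, j.2.1.1, j.2.1.2.1, h.choose :: j.2.1.2.2) else none, ?_, ?_⟩
      · intro j y
        dsimp only
        split_ifs with h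
        · have := h.choose_spec
          constructor
          · intro hy
            exact ⟨_, this, by simpa [eq_comm] using hy⟩
          · rintro ⟨x, hx, rfl⟩
            have : p * h.choose = p * x := by omega
            rw [Nat.eq_of_mul_eq_mul_left hp this]
        · simp only [false_iff, not_exists, not_and]
          exact fun x hx => absurd ⟨x, hx⟩ h
      · clear h5 h6 hjl
        induction hl with
        | nil => rfl
        | @cons j o js l hj _ ih =>
          rw [List.map_cons, ← ih]
          congr 1
          ext y
          rw [hj]
          split_ifs with h
          · have := h.choose_spec
            constructor
            · rintro ⟨x, hx, rfl⟩
              have : p * h.choose = p * x := by omega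
              rw [Nat.eq_of_mul_eq_mul_left hp this]
            · intro hy
              exact ⟨_, this, by simpa [eq_comm] using hy⟩
          · simp only [iff_false, not_exists, not_and]
            exact fun x hx => absurd ⟨x, hx⟩ h
    obtain ⟨f, hf, rfl⟩ := hfm
    rw [List.filterMap_map, Function.id_comp]
    refine ⟨(sublist_map_filterMap (ψ := Prod.fst) fun j _ y hy => ?_).trans h5,
      fun d a v e' => ?_⟩
    · obtain ⟨x, -, rfl⟩ := (hf _ _).1 hy
      rfl
    · simp only [List.mem_filterMap, hf]
      constructor
      · rintro ⟨⟨d', ⟨a', v', e⟩, b⟩, hj, x, hx, hy⟩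
        simp only [Prod.mk.injEq] at hy hx
        obtain ⟨rfl, rfl, rfl, rfl⟩ := hy
        subst hx
        obtain ⟨h7, h8⟩ := (h6 _ _ _).1 hj
        exact ⟨x, e, rfl, h7, (h4 _ _).1 h8⟩
      · rintro ⟨x, e, rfl, h7, h8⟩
        exact ⟨(d, (a, v, e), v + p * x), (h6 _ _ _).2 ⟨h7, (h4 _ _).2 h8⟩, x, rfl, rfl⟩

theorem Spec.extendAll {p m : ℕ} {gs : List (List (ℕ × R))} {cs : List (ℕ × R × ℕ × List ℕ)}
    (hp : 0 < p) (hpW : p ≤ W)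
    (hg : ∀ g ∈ gs, ((g.map Prod.fst).Nodup ∧ ∀ m ∈ g, m.2 ≠ 0) ∧ (∀ m ∈ g, m.1 ≤ W) ∧
      g.length ≤ m)
    (hcs : Sorted cs) (hcW : ∀ j ∈ cs, j.1 ≤ W ∧ j.2.2.1 ≤ W) (hcm : cs.length ≤ m) :
    Spec U V (extendAll p gs cs) 0 0 (gs.length * extendCost W m) fun t =>
      (t.map Prod.fst).Sublist (cs.map Prod.fst) ∧
      ∀ d a v e', (d, a, v, e') ∈ t ↔ ∃ xs e, e' = xs ++ e ∧ (d, a, v, e) ∈ cs ∧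
        List.Forall₂ (fun g x => IsSingle p (coeffs g) d (v + p * x)) gs xs := by
  induction gs with
  | nil => exact Spec.leB (Spec.ret (by simp))
  | cons g gs ih =>
    simp only [List.mem_cons, forall_eq_or_imp] at hg
    refine Spec.leB (b := gs.length * extendCost W m + extendCost W m)
      (Spec.bindB (ih hg.2) fun t ht => ?_) (by simp only [List.length_cons]; linarith)
    obtain ⟨h1, h2⟩ := ht
    have ht : Sorted t := by
      have : (t.map Prod.fst).Pairwise (· < ·) := by
        refine List.Pairwise.sublist h1 ?_
        rw [List.pairwise_map]
        exact hcs
      rwa [List.pairwise_map] at this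
    refine Spec.imp (Spec.extend hp hpW hg.1.1 hg.1.2.1 ht ?_ hg.1.2.2
      ((by simpa using h1.length_le : t.length ≤ cs.length).trans hcm)) ?_
    · rintro ⟨d, a, v, e⟩ hj
      obtain ⟨xs, e₀, -, h3, -⟩ := (h2 _ _ _ _).1 hj
      exact hcW (d, a, v, e₀) h3
    · rintro t' ⟨h3, h4⟩
      refine ⟨h3.trans h1, fun d a v e' => ?_⟩
      rw [h4]
      constructor
      · rintro ⟨x, e, rfl, h5, h6⟩
        obtain ⟨xs, e, rfl, h7, h8⟩ := (h2 _ _ _ _).1 h5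
        exact ⟨x :: xs, e, rfl, h7, List.Forall₂.cons h6 h8⟩
      · rintro ⟨xs, e, rfl, h7, h8⟩
        cases h8 with
        | cons h9 h10 => exact ⟨_, _, rfl, (h2 _ _ _ _).2 ⟨_, _, rfl, h7, h10⟩, h9⟩

/-- The recovery of terms: `(e, a)` is returned if and only if `e` has sum at most `D`, some term of
`fm`, with exponent `d`, has the coefficient `a`, and the class `d` contains exactly one exponent of
`f0`, which is `⟨e, s⟩`, and exactly one exponent of each `g_k`, which is `⟨e, s⟩ + p e_k`. -/
theorem Spec.tsTerms {p n m S K D : ℕ} {fm f0 : List (ℕ × R)} {gs : List (List (ℕ × R))}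
    {s : List ℕ} (hp : 0 < p) (hpW : p ≤ W)
    (hfm : Sorted fm) (hfmW : ∀ m ∈ fm, m.1 ≤ W) (hfml : fm.length ≤ m)
    (hf0 : Terms f0 (coeffs f0)) (hf0W : ∀ m ∈ f0, m.1 ≤ K) (hf0l : f0.length ≤ m)
    (hgn : gs.length = n)
    (hg : ∀ g ∈ gs, Terms g (coeffs g) ∧ (∀ m ∈ g, m.1 ≤ K) ∧ g.length ≤ m)
    (hs : ∀ a ∈ s, a ≤ S) (hS : S ≤ W) (hK : K ≤ W) (hD : D ≤ W)
    (hnK : n * K ≤ W) (hnKS : n * (K * S) ≤ W) :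
    Spec U V (tsTerms fm f0 gs p s D) 0 0
      ((n + 1) * extendCost W m + m * ((3 * n + 4) * unit W)) fun t =>
      (t.map fun m => dotN m.1 s % p).Sublist (fm.map Prod.fst) ∧
      ∀ e a, (e, a) ∈ t ↔ ∃ d, (d, a) ∈ fm ∧ IsSingle p (coeffs f0) d (dotN e s) ∧
        List.Forall₂ (fun g x => IsSingle p (coeffs g) d (dotN e s + p * x)) gs e ∧ e.sum ≤ D := by
  have hc1 : collectCost f0.length (unit W) ≤ collectCost m (unit W) := collectCost_mono hf0l le_rfl
  have hc2 : f0.length * unit W ≤ m * unit W := Nat.mul_le_mul_right _ hf0l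
  have hc3 : fm.length * unit W ≤ m * unit W := Nat.mul_le_mul_right _ hfml
  refine Spec.leB (b := collectCost f0.length (unit W) + f0.length * unit W +
    ((fm.length + f0.length) * unit W + (n * extendCost W m +
      (fm.length * ((3 * n + 4) * unit W) + 0))))
    (Spec.bindB (Spec.singles hpW hf0 fun m hm => (hf0W m hm).trans hK) fun us hus => ?_) ?_
  swap
  · have : fm.length * ((3 * n + 4) * unit W) ≤ m * ((3 * n + 4) * unit W) :=
      Nat.mul_le_mul_right _ hfml
    have e : (n + 1) * extendCost W m = n * extendCost W m + extendCost W m := by ring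
    rw [e]
    have : extendCost W m = collectCost m (unit W) + 8 * (m * unit W) := rfl
    linarith [Nat.zero_le (m * unit W)]
  obtain ⟨h1, h2, h3, h4⟩ := hus
  refine Spec.bindB (Spec.leB (Spec.join hfmW h3 hfm h1)
    (Nat.mul_le_mul_right _ (by omega))) fun js hjs => ?_
  obtain ⟨h5, h6⟩ := hjs
  have hjl : js.length ≤ fm.length := by simpa using h5.length_le
  have hjs : Sorted js := by
    have : (js.map Prod.fst).Pairwise (· < ·) := by
      refine List.Pairwise.sublist h5 ?_
      rw [List.pairwise_map]
      exact hfm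
    rwa [List.pairwise_map] at this
  have hKs : ∀ g : List (ℕ × R), Terms g (coeffs g) → (∀ m ∈ g, m.1 ≤ K) → ∀ d v,
      IsSingle p (coeffs g) d v → v ≤ K := by
    rintro g h h' d v ⟨h'', -⟩
    obtain ⟨m, hm, rfl⟩ := h.exists_mem h''
    exact h' m hm
  refine Spec.bindB (Spec.leB (Spec.extendAll (m := m) hp hpW
    (fun g h => ⟨⟨(hg g h).1.1, (hg g h).1.2.1⟩, fun m hm => ((hg g h).2.1 m hm).trans hK,
      (hg g h).2.2⟩)
    (cs := js.map fun j => (j.1, j.2.1, j.2.2, [])) ?_ ?_ ?_) (by rw [hgn])) fun cs hcs => ?_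
  · rw [Sorted, List.pairwise_map]
    exact hjs
  · intro j hj
    obtain ⟨⟨d, a, v⟩, hj', rfl⟩ := List.mem_map.1 hj
    obtain ⟨h7, h8⟩ := (h6 _ _ _).1 hj'
    exact ⟨hfmW _ h7, (hKs f0 hf0 hf0W _ _ ((h4 _ _).1 h8)).trans hK⟩
  · simpa using hjl.trans hfml
  obtain ⟨h7, h8⟩ := hcs
  rw [List.map_map] at h7
  have h7' : (cs.map Prod.fst).Sublist (fm.map Prod.fst) := h7.trans h5
  have hmem : ∀ d a v e, (d, a, v, e) ∈ cs ↔ (d, a) ∈ fm ∧ IsSingle p (coeffs f0) d v ∧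
      List.Forall₂ (fun g x => IsSingle p (coeffs g) d (v + p * x)) gs e := by
    intro d a v e
    rw [h8]
    constructor
    · rintro ⟨xs, e, rfl, h9, h10⟩
      obtain ⟨⟨d', a', v'⟩, hj', e'⟩ := List.mem_map.1 h9
      simp only [Prod.mk.injEq] at e'
      obtain ⟨rfl, rfl, rfl, rfl⟩ := e'
      obtain ⟨h11, h12⟩ := (h6 _ _ _).1 hj'
      exact ⟨h11, (h4 _ _).1 h12, by simpa using h10⟩
    · rintro ⟨h9, h10, h11⟩
      exact ⟨e, [], by simp, List.mem_map.2 ⟨(d, a, v), (h6 _ _ _).2 ⟨h9, (h4 _ _).2 h10⟩, rfl⟩,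
          h11⟩
  have hcl : cs.length ≤ fm.length := by simpa using h7'.length_le
  have he : ∀ d a v e, (d, a, v, e) ∈ cs → e.length = n ∧ ∀ x ∈ e, x ≤ K := by
    intro d a v e hj
    obtain ⟨-, -, h10⟩ := (hmem _ _ _ _).1 hj
    refine ⟨by rw [← hgn, h10.length_eq], fun x hx => ?_⟩
    obtain ⟨i, hi, rfl⟩ := List.getElem_of_mem hx
    have hi' : i < gs.length := by rw [h10.length_eq]; exact hi
    have h11 := h10.get hi' hi
    have h12 := hKs _ (hg _ (List.getElem_mem hi')).1 (hg _ (List.getElem_mem hi')).2.1 _ _ h11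
    have h13 := Nat.le_mul_of_pos_left (e.get ⟨i, hi⟩) hp
    simp only [List.get_eq_getElem] at *
    omega
  refine Spec.bindB (Spec.leB (Spec.mapP_eq (q := 0) (r := 0) (b := (3 * n + 4) * unit W)
    (f := fun j => if j.2.2.1 = dotN j.2.2.2 s ∧ j.2.2.2.sum ≤ D then some (j.2.2.2, j.2.1)
      else none) fun j hj => ?_)
    (Nat.mul_le_mul_right _ hcl)) fun l hl => Spec.ret ?_
  · obtain ⟨d, a, v, e⟩ := j
    obtain ⟨h9, h10⟩ := he _ _ _ _ hj
    have hv : v ≤ W := (hKs f0 hf0 hf0W _ _ ((hmem _ _ _ _).1 hj).2.1).trans hK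
    have hdot : dotN e s ≤ W := (dotN_le h10 hs).trans (h9 ▸ hnKS)
    have hsum : e.sum ≤ W := by
      refine (List.sum_le_card_nsmul e K h10).trans ?_
      rw [h9]
      simpa using hnK
    refine Spec.leB (b := (2 * e.length + 1) * unit W + (unit W + ((e.length + 1) * unit W +
      (unit W + 0)))) (Spec.bindB (Spec.dot h10 hs hK hS (h9 ▸ hnKS)) fun z hz => ?_)
      (by rw [h9]; linarith)
    subst hz
    refine Spec.cmp_bind hv hdot ?_
    split_ifs with h11 h12 h12 <;> rw [compare_eq_iff_eq] at h11
    · refine Spec.bindB (Spec.sumP hsum) fun z hz => ?_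
      subst hz
      refine Spec.cmp_bind hsum hD (Spec.ret ?_)
      rw [if_neg]
      rw [compare_gt_iff_gt]
      exact not_lt.2 h12.2
    · refine Spec.bindB (Spec.sumP hsum) fun z hz => ?_
      subst hz
      refine Spec.cmp_bind hsum hD (Spec.ret ?_)
      rw [if_pos]
      rw [compare_gt_iff_gt]
      exact not_le.1 fun h => h12 ⟨h11, h⟩
    · exact absurd h12.1 h11
    · exact Spec.leB (Spec.ret rfl) (Nat.zero_le _)
  · subst hl
    rw [List.filterMap_map, Function.id_comp]
    refine ⟨(sublist_map_filterMap (ψ := Prod.fst) fun j hj y hy => ?_).trans h7',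
      fun e a => ?_⟩
    · obtain ⟨d, a, v, e⟩ := j
      simp only [Option.ite_none_right_eq_some, Option.some_inj] at hy
      obtain ⟨⟨rfl, -⟩, rfl⟩ := hy
      exact ((hmem _ _ _ _).1 hj).2.1.2.1
    · simp only [List.mem_filterMap, Option.ite_none_right_eq_some, Option.some_inj]
      constructor
      · rintro ⟨⟨d, a', v, e'⟩, hj, ⟨h14, h10⟩, h9⟩
        simp only [Prod.mk.injEq] at h9
        obtain ⟨rfl, rfl⟩ := h9
        dsimp only at h14 h10
        subst h14
        obtain ⟨h11, h12, h13⟩ := (hmem _ _ _ _).1 hj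
        exact ⟨d, h11, h12, h13, h10⟩
      · rintro ⟨d, h11, h12, h13, h10⟩
        exact ⟨(d, a, dotN e s, e), (hmem _ _ _ _).2 ⟨h11, h12, h13⟩, ⟨rfl, h10⟩, rfl⟩

end Recover

/-! ### The sieve -/

/-- The harmonic sum which governs the running time of the sieve. -/
theorem sum_div_le (B : ℕ) :
    ((List.range' 2 (B - 1)).map fun i => B / i).sum ≤ B * B.size := by
  rcases Nat.eq_zero_or_pos B with rfl | hB
  · simp
  have h1 : ((List.range' 2 (B - 1)).map fun i => B / i).sum + B = ∑ i ∈ Finset.Icc 1 B, B / i := by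
    have h2 : Finset.Icc 1 B = (List.range' 1 B).toFinset := by
      ext i; simp [List.mem_range'_1]; omega
    rw [h2, List.sum_toFinset _ List.nodup_range']
    obtain ⟨b, rfl⟩ : ∃ b, B = b + 1 := ⟨B - 1, by omega⟩
    rw [List.range'_succ]
    simp [add_comm]
  have h3 : ((∑ i ∈ Finset.Icc 1 B, B / i : ℕ) : ℝ) ≤ B * (1 + Real.log B) := by
    have := harmonic_le_one_add_log B
    rw [harmonic_eq_sum_Icc] at this
    push_cast at this ⊢
    calc _ ≤ ∑ i ∈ Finset.Icc 1 B, (B : ℝ) * (i : ℝ)⁻¹ := by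
          refine Finset.sum_le_sum fun i _ => ?_
          rw [← div_eq_mul_inv]
          exact Nat.cast_div_le
      _ = B * ∑ i ∈ Finset.Icc 1 B, (i : ℝ)⁻¹ := by rw [Finset.mul_sum]
      _ ≤ _ := by gcongr
  have h4 : Real.log B ≤ B.size := by
    have : (B : ℝ) ≤ 2 ^ B.size := by exact_mod_cast (Nat.lt_size_self B).le
    calc Real.log B ≤ Real.log (2 ^ B.size) := Real.log_le_log (by exact_mod_cast hB) this
      _ = B.size * Real.log 2 := by rw [Real.log_pow]
      _ ≤ B.size * 1 := by
        gcongr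
        linarith [Real.log_two_lt_d9]
      _ = _ := mul_one _
  have h5 : ((((List.range' 2 (B - 1)).map fun i => B / i).sum + B : ℕ) : ℝ) ≤
      B * B.size + B := by
    rw [h1]
    refine h3.trans ?_
    have : (B : ℝ) * Real.log B ≤ B * B.size := by gcongr
    linarith
  have h6 : ((List.range' 2 (B - 1)).map fun i => B / i).sum + B ≤ B * B.size + B := by
    exact_mod_cast h5
  omega

/-- Chebyshev's bound in the form needed for the sieve. -/
theorem le_primeCounting {X : ℕ} (hX : 2 ≤ X) : X ≤ Nat.primeCounting (16 * X * X.size) + 2 := by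
  set L := X.size with hL
  set B := 16 * X * L with hB
  have hL2 : 2 ≤ L := by
    exact Nat.lt_size.2 (by simpa using hX)
  have hB2 : 2 ≤ B := by nlinarith
  have hBr : (2 : ℝ) ≤ B := by exact_mod_cast hB2
  have hXr : (2 : ℝ) ≤ X := by exact_mod_cast hX
  have hLr : (2 : ℝ) ≤ L := by exact_mod_cast hL2
  have hlogB : 0 < Real.log B := Real.log_pos (by linarith)
  have h2 : 0 < Real.log 2 := Real.log_pos (by norm_num)
  -- Chebyshev's lower bound for `π(B)`; the factor `16 L` in `B` makes up for `log B`
  have h := Chebyshev.pi_ge B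
  rw [div_le_iff₀ hlogB] at h
  have h3 : Real.log (B + 1) ≤ 2 * Real.log B := by
    rw [← Real.log_rpow (by linarith)]
    refine Real.log_le_log (by linarith) ?_
    norm_num
    nlinarith
  have h4 : Real.log B ≤ (4 + 2 * L) * Real.log 2 := by
    have e : (B : ℝ) = 2 ^ 4 * X * L := by rw [hB]; push_cast; norm_num
    rw [e, Real.log_mul (by positivity) (by positivity), Real.log_mul (by positivity)
      (by positivity), Real.log_pow]
    have hx : Real.log X ≤ L * Real.log 2 := by
      rw [← Real.log_pow]
      exact Real.log_le_log (by linarith) (by exact_mod_cast (Nat.lt_size_self X).le)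
    have hl : Real.log L ≤ L * Real.log 2 := by
      rw [← Real.log_pow]
      exact Real.log_le_log (by linarith) (by exact_mod_cast (Nat.lt_two_pow_self).le)
    push_cast
    linarith
  have h5 : (X : ℝ) * Real.log B ≤ B * Real.log 2 := by
    have e : (B : ℝ) = X * (16 * L) := by rw [hB]; push_cast; ring
    calc (X : ℝ) * Real.log B ≤ X * (16 * L * Real.log 2) := by
          refine mul_le_mul_of_nonneg_left (h4.trans ?_) (by linarith)
          exact mul_le_mul_of_nonneg_right (by linarith) h2.le
      _ = B * Real.log 2 := by rw [e]; ring
  have h6 : ((X : ℝ) - 2) * Real.log B ≤ Nat.primeCounting B * Real.log B := by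
    linarith
  have h7 := le_of_mul_le_mul_right h6 hlogB
  have h8 : (X : ℝ) ≤ (Nat.primeCounting B + 2 : ℕ) := by push_cast; linarith
  exact_mod_cast h8

section Sieve

variable {R : Type u} [CommRing R] {U : Interpolator R}
  {V : Query → Prop} {W : ℕ}

theorem Spec.mapP_eq_sum {α : Type v} {β : Type w} {g : α → Prog ℕ R β} {l : List α} {q r : ℕ}
    {b : α → ℕ} {f : α → β} (h : ∀ a ∈ l, Spec U V (g a) q r (b a) fun y => y = f a) :
    Spec U V (SparseInterp.mapP g l) (l.length * q) (l.length * r) (l.map b).sum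
      fun l' => l' = l.map f := by
  refine Spec.imp (Spec.mapP h) fun l' hl' => ?_
  clear h
  induction hl' with
  | nil => rfl
  | cons h1 _ ih => rw [List.map_cons, h1, ih]

theorem Spec.diffSorted {xs ys : List ℕ} (hx : ∀ x ∈ xs, x ≤ W) (hy : ∀ y ∈ ys, y ≤ W)
    (sx : xs.Pairwise (· < ·)) (sy : ys.Pairwise (· ≤ ·)) :
    Spec U V (diffSorted xs ys : Prog ℕ R _) 0 0 ((xs.length + ys.length) * unit W) fun t =>
      t.Sublist xs ∧ ∀ x, x ∈ t ↔ x ∈ xs ∧ x ∉ ys := by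
  induction xs generalizing ys with
  | nil => rw [SparseInterp.diffSorted]; exact Spec.leB (Spec.ret (by simp))
  | cons x xs ihx =>
    induction ys with
    | nil => rw [SparseInterp.diffSorted]; exact Spec.leB (Spec.ret (by simp))
    | cons y ys ihy =>
      rw [SparseInterp.diffSorted]
      have sx' := sx
      have sy' := sy
      have hx' := hx
      have hy' := hy
      simp only [List.mem_cons, forall_eq_or_imp, List.pairwise_cons] at hx sx' hy sy'
      refine Spec.leB (b := unit W + (xs.length + ys.length + 1) * unit W)
        (Spec.cmp_bind hx.1 hy.1 ?_) (by simp only [List.length_cons]; linarith)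
      rcases lt_trichotomy x y with h | h | h
      · rw [compare_lt_iff_lt.2 h]
        refine Spec.leB (Spec.bindB (b' := 0) (ihx hx.2 hy' sx'.2 sy) fun t ht => Spec.ret ?_)
          (by simp only [List.length_cons]; linarith)
        obtain ⟨h1, h2⟩ := ht
        refine ⟨h1.cons_cons _, fun z => ?_⟩
        have hz : z = x → z ∉ y :: ys := by
          rintro rfl hz
          rcases List.mem_cons.1 hz with rfl | hz
          · exact lt_irrefl _ h
          · exact absurd (h.trans_le (sy'.1 _ hz)) (lt_irrefl _)
        rw [List.mem_cons, List.mem_cons, h2]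
        tauto
      · subst h
        rw [compare_eq_iff_eq.2 rfl]
        refine Spec.mono (ihx hx.2 hy' sx'.2 sy) le_rfl le_rfl
          (by simp only [List.length_cons]; linarith) ?_
        rintro t ⟨h1, h2⟩
        refine ⟨h1.cons _, fun z => ?_⟩
        rw [h2, List.mem_cons, List.mem_cons]
        tauto
      · rw [compare_gt_iff_gt.2 h]
        refine Spec.mono (ihy hy.2 sy'.2) le_rfl le_rfl
          (by simp only [List.length_cons]; linarith) ?_
        rintro t ⟨h1, h2⟩
        refine ⟨h1, fun z => ?_⟩
        have hz : z ∈ x :: xs → z ≠ y := by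
          rintro hz rfl
          rcases List.mem_cons.1 hz with rfl | hz
          · exact lt_irrefl _ h
          · exact absurd (h.trans (sx'.1 _ hz)) (lt_irrefl _)
        rw [h2, List.mem_cons (b := y)]
        tauto

/-- The bound up to which the sieve searches for `N` primes from `M` on. -/
def sieveBound (M N : ℕ) : ℕ := 16 * (M + N + 2) * (M + N + 2).size

/-- The bit operations spent on sieving the numbers up to `B`. -/
def sieveCost (W B : ℕ) : ℕ :=
  (20 * (B + 1) + 3 * (B * B.size) + B * B.size * (B * B.size).size) * unit W

theorem map_fst_zip_eq_take {α β : Type*} (l : List α) (l' : List β) :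
    (l.zip l').map Prod.fst = l.take l'.length := by
  induction l generalizing l' with
  | nil => simp
  | cons a l ih => cases l' <;> simp [ih]

/-- There are at least `N` primes from `M` to `sieveBound M N` by `le_primeCounting`, as at most `M`
primes are smaller than `M`. -/
theorem Spec.firstPrimes {M N : ℕ} (hW : sieveBound M N + 1 ≤ W) :
    Spec U V (firstPrimes M N : Prog ℕ R _) 0 0 (sieveCost W (sieveBound M N)) fun ps =>
      ps.length = N ∧ ps.Nodup ∧ ∀ p ∈ ps, p.Prime ∧ M ≤ p ∧ p ≤ sieveBound M N := by
  have hcheb := le_primeCounting (X := M + N + 2) (by omega)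
  change M + N + 2 ≤ Nat.primeCounting (sieveBound M N) + 2 at hcheb
  have hXL : 16 * (M + N + 2) * (M + N + 2).size = sieveBound M N := rfl
  set B := sieveBound M N with hB
  set X := M + N + 2 with hX
  have hL1 : 1 ≤ X.size := Nat.size_pos.2 (by omega)
  have hXB : 16 * X ≤ B := by rw [← hXL]; exact Nat.le_mul_of_pos_right _ hL1
  have hLX : X.size ≤ X := Nat.size_le.2 Nat.lt_two_pow_self
  have hsum := sum_div_le B
  set H := B * B.size with hH
  set u := unit W with hu
  have h16 : (16 : ℕ) ≤ W := by omega
  refine Spec.leB (b := u + (u + (u + (u + (u + (u + (u + (u + (u + (u +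
    ((B + 1 - 2 + 1) * u + ((2 * H + 3 * B) * u + (H * H.size * u + (u + ((B + 2) * u +
      ((B + H + 1) * u + ((N - 0 + 1) * u + 0))))))))))))))))) ?_ ?_
  swap
  · have hN : N + 1 ≤ B := by omega
    have : sieveCost W B = (20 * (B + 1) + 3 * H + H * H.size) * u := rfl
    rw [this]
    have e : B + 1 - 2 + 1 = B := by omega
    have := Nat.mul_le_mul_right u hN
    rw [e, Nat.sub_zero]
    linarith [Nat.zero_le (H * u), Nat.zero_le (B * u)]
  refine Spec.lit_bind (by omega) (Spec.lit_bind (by omega) (Spec.lit_bind (by omega)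
    (Spec.lit_bind h16 (Spec.arith_bind (op := .add) (by omega) (by omega)
    (by simp only [ArithOp.eval]; omega) (Spec.arith_bind (op := .add)
      (by simp only [ArithOp.eval]; omega) (by omega) (by simp only [ArithOp.eval]; omega) ?_)))))
  simp only [ArithOp.eval]
  rw [← hX]
  refine Spec.bitlen_bind (by omega) (Spec.arith_bind (op := .mul) h16 (by omega)
    (by simp only [ArithOp.eval]; omega) (Spec.arith_bind (op := .mul)
      (by simp only [ArithOp.eval]; omega) (by omega) (by simp only [ArithOp.eval]; omega) ?_))
  simp only [ArithOp.eval]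
  rw [hXL]
  refine Spec.arith_bind (op := .add) (by omega) (by omega) (by simp only [ArithOp.eval]; omega) ?_
  simp only [ArithOp.eval]
  refine Spec.range_bind (by omega) (by omega) ?_
  have hmem : ∀ i ∈ List.range' 2 (B + 1 - 2), 2 ≤ i ∧ i ≤ B := by
    intro i hi
    rw [List.mem_range'_1] at hi
    omega
  refine Spec.bindB (Q := fun ms => ms = (List.range' 2 (B + 1 - 2)).map fun i =>
    (List.range' 2 (B / i + 1 - 2)).map (i * ·)) (Spec.mono (Spec.mapP_eq_sum (q := 0) (r := 0)
      (b := fun i => (2 * (B / i) + 3) * u) fun i hi => ?_) (by simp) (by simp) ?_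
      fun _ h => h) fun ms hms => ?_
  · obtain ⟨hi2, hiB⟩ := hmem i hi
    have hq : B / i ≤ B := Nat.div_le_self _ _
    refine Spec.leB (b := u + (u + ((B / i + 1 - 2 + 1) * u + (B / i + 1 - 2) * u)))
      (Spec.arith_bind (op := .div) (by omega) (by omega) (by simp only [ArithOp.eval]; omega)
      (Spec.arith_bind (op := .add) (by simp only [ArithOp.eval]; omega) (by omega)
        (by simp only [ArithOp.eval]; omega) (Spec.range_bind (by omega)
          (by simp only [ArithOp.eval]; omega) ?_))) ?_
    · simp only [ArithOp.eval]
      refine Spec.mono (Spec.mapP_eq (q := 0) (r := 0) (b := u) (f := fun j => i * j)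
        fun j hj => ?_) (by simp) (by simp) (by simp) fun _ h => h
      rw [List.mem_range'_1] at hj
      have hjq : j ≤ B / i := by omega
      have : i * j ≤ B := (Nat.mul_le_mul_left i hjq).trans (Nat.mul_div_le _ _)
      exact Spec.arith (op := .mul) (by omega) (by omega) (by simp only [ArithOp.eval]; omega)
    · calc _ = (2 + (B / i + 1 - 2 + 1) + (B / i + 1 - 2)) * u := by ring
        _ ≤ _ := Nat.mul_le_mul_right _ (by omega)
  · rw [List.sum_map_mul_right, List.sum_map_add, List.sum_map_mul_left]
    refine Nat.mul_le_mul_right _ ?_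
    have : B + 1 - 2 = B - 1 := by omega
    rw [this]
    have hsum' : ((List.range' 2 (B - 1)).map (HDiv.hDiv B)).sum ≤ H := hsum
    simp only [List.map_const', List.sum_replicate, List.length_range', smul_eq_mul]
    omega
  -- the products are exactly the composite numbers up to `B`
  have hcomp : ∀ x, x ∈ ms.flatten ↔ x ≤ B ∧ ∃ i j, 2 ≤ i ∧ 2 ≤ j ∧ x = i * j := by
    intro x
    subst hms
    simp only [List.mem_flatten, List.mem_map, List.mem_range'_1]
    constructor
    · rintro ⟨_, ⟨i, hi, rfl⟩, hx⟩
      obtain ⟨j, hj, rfl⟩ := List.mem_map.1 hx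
      rw [List.mem_range'_1] at hj
      have hjq : j ≤ B / i := by omega
      exact ⟨(Nat.mul_le_mul_left i hjq).trans (Nat.mul_div_le _ _), i, j, hi.1, hj.1, rfl⟩
    · rintro ⟨hx, i, j, hi, hj, rfl⟩
      have hiB : i ≤ B := (Nat.le_mul_of_pos_right i (by omega)).trans hx
      have hjq : j ≤ B / i := by
        rw [Nat.le_div_iff_mul_le (by omega), mul_comm]; exact hx
      exact ⟨_, ⟨i, by omega, rfl⟩, List.mem_map.2 ⟨j, List.mem_range'_1.2 (by omega), rfl⟩⟩
  have hlen : ms.flatten.length ≤ H := by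
    subst hms
    rw [List.length_flatten, List.map_map]
    refine le_trans ?_ hsum
    have : B + 1 - 2 = B - 1 := by omega
    rw [this]
    refine List.sum_le_sum fun i _ => ?_
    simp only [Function.comp, List.length_map, List.length_range']
    generalize B / i = q
    omega
  refine Spec.bindB (Spec.leB (Spec.sortP (compares_cmp (W := W)) fun x hx =>
    ((hcomp x).1 hx).1.trans (by omega)) ?_) fun cs hcs => ?_
  · have := Nat.size_le_size ((Nat.sub_le _ 1).trans hlen)
    gcongr
  obtain ⟨hc1, hc2⟩ := hcs
  refine Spec.bindB (Spec.maxP (W := W) (by omega) (by omega)) fun a ha => ?_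
  have ha2 : 2 ≤ a := by omega
  refine Spec.leB (Spec.range_bind (W := W) (x := a) (y := B + 1) (q := 0) (r := 0)
    (b := (B + H + 1) * u + ((N - 0 + 1) * u + 0)) (by omega) (by omega) ?_)
    (Nat.add_le_add_right (Nat.mul_le_mul_right _ (by omega)) _)
  refine Spec.bindB (Spec.leB (Spec.diffSorted (W := W) ?_ ?_ ?_ ?_) ?_) fun ps hps => ?_
  · intro x hx
    rw [List.mem_range'_1] at hx
    omega
  · intro x hx
    have := ((hcomp x).1 (hc1.mem_iff.1 hx)).1
    omega
  · exact List.pairwise_lt_range'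
  · exact hc2
  · refine Nat.mul_le_mul_right _ ?_
    rw [List.length_range', hc1.length_eq]
    omega
  refine Spec.range_bind (by omega) (by omega) (Spec.ret ?_)
  obtain ⟨hp1, hp2⟩ := hps
  have hps : ∀ x, x ∈ ps ↔ x.Prime ∧ M ≤ x ∧ x ≤ B := by
    intro x
    rw [hp2, List.mem_range'_1, hc1.mem_iff, hcomp]
    constructor
    · rintro ⟨h1, h2⟩
      refine ⟨?_, by omega, by omega⟩
      by_contra h3
      obtain ⟨m, h4, h5, h6⟩ := Nat.exists_dvd_of_not_prime2 (by omega) h3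
      obtain ⟨k, rfl⟩ := h4
      refine h2 ⟨by omega, m, k, h5, ?_, rfl⟩
      by_contra h7
      have : k ≤ 1 := by omega
      interval_cases k <;> omega
    · rintro ⟨h1, h2, h3⟩
      have := h1.two_le
      refine ⟨by omega, ?_⟩
      rintro ⟨-, i, j, hi, hj, rfl⟩
      exact Nat.not_prime_mul (by omega) (by omega) h1
  have hnd : ps.Nodup := List.Nodup.sublist hp1 List.nodup_range'
  -- every prime up to `B` has been found or is smaller than `M`
  have hcount : Nat.primeCounting B ≤ ps.length + M := by
    rw [Nat.primeCounting, Nat.primeCounting', Nat.count_eq_card_filter_range]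
    calc _ ≤ (ps.toFinset ∪ Finset.range M).card := by
          refine Finset.card_le_card fun x hx => ?_
          simp only [Finset.mem_filter, Finset.mem_range, Finset.mem_union, List.mem_toFinset,
            hps] at hx ⊢
          rcases lt_or_ge x M with h | h
          · exact Or.inr h
          · exact Or.inl ⟨hx.2, h, by omega⟩
      _ ≤ _ := by
          refine (Finset.card_union_le _ _).trans ?_
          rw [List.toFinset_card_of_nodup hnd, Finset.card_range]
  rw [map_fst_zip_eq_take, List.length_range']
  refine ⟨?_, List.Nodup.sublist (List.take_sublist _ _) hnd, fun p hp => (hps p).1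
    (List.mem_of_mem_take hp)⟩
  rw [List.length_take]
  omega

end Sieve

/-! ### Collisions of exponents -/

theorem mapDomain_apply_of_unique {ι : Type v} {κ : Type w} {R : Type u} [CommRing R] {F : ι →₀ R}
    {φ : ι → κ} {e : ι}
    (h : ∀ e' ∈ F.support, φ e' = φ e → e' = e) : F.mapDomain φ (φ e) = F e := by
  rw [Finsupp.mapDomain, Finsupp.sum_apply, Finsupp.sum, Finset.sum_eq_single e]
  · simp
  · intro e' he' hne
    rw [Finsupp.single_eq_of_ne]
    exact fun h' => hne (h e' he' h'.symm)
  · intro he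
    rw [Finsupp.notMem_support_iff.1 he]
    simp

theorem mapDomain_sub' {ι : Type v} {κ : Type w} {R : Type u} [CommRing R] (φ : ι → κ)
    (F G : ι →₀ R) :
    (F - G).mapDomain φ = F.mapDomain φ - G.mapDomain φ :=
  map_sub (Finsupp.mapDomain.addMonoidHom φ) F G

section Collisions

variable {ι : Type v} {κ : Type w} [DecidableEq ι] [DecidableEq κ]

/-- The elements of `S` which do not have an image of their own under `φ`. -/
def collided (S : Finset ι) (φ : ι → κ) : Finset ι :=
  S.filter fun e => ∃ e' ∈ S, e' ≠ e ∧ φ e' = φ e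

theorem eq_of_notMem_collided {S : Finset ι} {φ : ι → κ} {e e' : ι} (he : e ∈ S)
    (hC : e ∉ collided S φ) (he' : e' ∈ S) (h : φ e' = φ e) : e' = e := by
  by_contra hne
  exact hC (Finset.mem_filter.2 ⟨he, e', he', hne, h⟩)

/-- Every nonempty fibre of collided elements has at least two elements. -/
theorem two_mul_card_image_collided_le (S : Finset ι) (φ : ι → κ) :
    2 * ((collided S φ).image φ).card ≤ (collided S φ).card := by
  refine Finset.mul_card_image_le_card (f := φ) (collided S φ) 2 fun b hb => ?_
  obtain ⟨e, he, rfl⟩ := Finset.mem_image.1 hb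
  obtain ⟨heS, e', he'S, hne, h⟩ := Finset.mem_filter.1 he
  have : ({e, e'} : Finset ι) ⊆ (collided S φ).filter fun x => φ x = φ e := by
    intro x hx
    rcases Finset.mem_insert.1 hx with rfl | hx
    · exact Finset.mem_filter.2 ⟨he, rfl⟩
    · rw [Finset.mem_singleton] at hx
      subst hx
      exact Finset.mem_filter.2 ⟨Finset.mem_filter.2 ⟨he'S, e, heS, hne.symm, h.symm⟩, h⟩
  calc 2 = ({e, e'} : Finset ι).card := (Finset.card_pair hne.symm).symm
    _ ≤ _ := Finset.card_le_card this

/-- Outside the collided elements the map is injective. -/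
theorem card_image_le_collided (S : Finset ι) (φ : ι → κ) :
    (S.image φ).card + (collided S φ).card ≤ S.card + ((collided S φ).image φ).card := by
  have h1 : S.image φ ⊆ (S \ collided S φ).image φ ∪ (collided S φ).image φ := by
    rw [← Finset.image_union, Finset.sdiff_union_of_subset
      (show collided S φ ⊆ S from Finset.filter_subset _ _)]
  have h2 : (S \ collided S φ).card + (collided S φ).card = S.card :=
    Finset.card_sdiff_add_card_eq_card (Finset.filter_subset _ _)
  have h3 := (Finset.card_le_card h1).trans (Finset.card_union_le _ _)
  have h4 : ((S \ collided S φ).image φ).card ≤ (S \ collided S φ).card := Finset.card_image_le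
  omega

variable {R : Type u} [CommRing R]

/-- Terms which do not collide survive in the image. -/
theorem card_le_card_support_mapDomain (F : ι →₀ R) (φ : ι → κ) :
    F.support.card ≤ (F.mapDomain φ).support.card + (collided F.support φ).card := by
  have h2 : (F.support \ collided F.support φ).card + (collided F.support φ).card
      = F.support.card := Finset.card_sdiff_add_card_eq_card (Finset.filter_subset _ _)
  have h3 : (F.support \ collided F.support φ).card ≤ (F.mapDomain φ).support.card := by
    refine Finset.card_le_card_of_injOn φ ?_ ?_
    · intro e he
      obtain ⟨he, hC⟩ := Finset.mem_sdiff.1 he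
      rw [Finset.mem_coe, Finsupp.mem_support_iff,
        mapDomain_apply_of_unique fun e' he' h => eq_of_notMem_collided he hC he' h]
      exact Finsupp.mem_support_iff.1 he
    · intro e he e' he' h
      obtain ⟨he, hC⟩ := Finset.mem_sdiff.1 he
      exact (eq_of_notMem_collided he hC (Finset.mem_sdiff.1 he').1 h.symm).symm
  omega

/-- If `g` contains all terms of `F` without collisions, and at most one term in each fibre of `φ`
that meets the support of `F`, then subtracting `g` from `F` leaves at most the collided terms
and one wrong term for each fibre of collided terms. -/
theorem card_support_sub_le {F : ι →₀ R} {φ : ι → κ} {g : List (ι × R)}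
    (h1 : ∀ e ∈ F.support, e ∉ collided F.support φ → (e, F e) ∈ g)
    (h2 : (g.map fun m => φ m.1).Nodup) (h3 : ∀ m ∈ g, φ m.1 ∈ F.support.image φ) :
    (F - coeffs g).support.card ≤
      (collided F.support φ).card + ((collided F.support φ).image φ).card := by
  set C := collided F.support φ with hC
  have hnd : (g.map Prod.fst).Nodup := by
    refine List.Nodup.of_map φ ?_
    rwa [List.map_map]
  have hinj : ∀ m ∈ g, ∀ m' ∈ g, φ m.1 = φ m'.1 → m = m' := fun m hm m' hm' h =>
    List.inj_on_of_nodup_map h2 hm hm' h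
  -- a wrong term lies in a class of collided terms, and each class contains at most one term of `g`
  set K := ((g.map Prod.fst).toFinset).filter fun e => φ e ∈ C.image φ with hK
  have hsub : (F - coeffs g).support ⊆ C ∪ K := by
    intro e he
    by_contra hcon
    rw [Finset.mem_union, not_or] at hcon
    obtain ⟨heC, heK⟩ := hcon
    rw [Finsupp.mem_support_iff, Finsupp.sub_apply] at he
    by_cases heS : e ∈ F.support
    · have := coeffs_apply_of_mem hnd (h1 e heS heC)
      simp only at this
      rw [this, sub_self] at he
      exact he rfl
    · rw [Finsupp.notMem_support_iff] at heS
      have heg : e ∈ (coeffs g).support := by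
        rw [Finsupp.mem_support_iff]
        intro h
        rw [heS, h, sub_zero] at he
        exact he rfl
      obtain ⟨m, hm, rfl⟩ := exists_mem_of_mem_support_coeffs heg
      obtain ⟨e0, he0, h⟩ := Finset.mem_image.1 (h3 m hm)
      have he0C : e0 ∉ C := by
        intro h'
        refine heK (Finset.mem_filter.2 ⟨?_, Finset.mem_image.2 ⟨e0, h', h⟩⟩)
        exact List.mem_toFinset.2 (List.mem_map_of_mem hm)
      have := hinj _ (h1 e0 he0 he0C) _ hm h
      rw [← this] at heS
      exact (Finsupp.mem_support_iff.1 he0) heS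
  refine (Finset.card_le_card hsub).trans ((Finset.card_union_le _ _).trans ?_)
  refine Nat.add_le_add_left ?_ _
  refine Finset.card_le_card_of_injOn φ (fun e he => (Finset.mem_filter.1 he).2) ?_
  intro e he e' he' h
  obtain ⟨m, hm, rfl⟩ := List.mem_map.1 (List.mem_toFinset.1 (Finset.mem_filter.1 he).1)
  obtain ⟨m', hm', rfl⟩ := List.mem_map.1 (List.mem_toFinset.1 (Finset.mem_filter.1 he').1)
  rw [hinj m hm m' hm' h]

/-- If the image of `F` under `φ` has at most `c` terms less than `F`, then subtracting the
recovered terms leaves at most `3 c` terms: with `k` classes that contain collided terms,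
there are at least `2 k` collided terms and at most `c + k`, so that their number plus `k` is at
most `3 c`. -/
theorem two_mul_card_support_sub_le {F : ι →₀ R} {φ : ι → κ} {g : List (ι × R)} {c t : ℕ}
    (h1 : ∀ e ∈ F.support, e ∉ collided F.support φ → (e, F e) ∈ g)
    (h2 : (g.map fun m => φ m.1).Nodup) (h3 : ∀ m ∈ g, φ m.1 ∈ F.support.image φ)
    (hc : F.support.card ≤ (F.mapDomain φ).support.card + c) (ht : 6 * c ≤ t) :
    2 * (F - coeffs g).support.card ≤ t := by
  have h4 := card_support_sub_le h1 h2 h3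
  have h5 := two_mul_card_image_collided_le F.support φ
  have h6 := card_image_le_collided F.support φ
  have h7 : (F.mapDomain φ).support.card ≤ (F.support.image φ).card :=
    Finset.card_le_card Finsupp.mapDomain_support
  omega

end Collisions

/-! ### The probability of collisions -/

section Probability

variable {R : Type u} [CommRing R] {U : Interpolator R}

theorem dotN_mod_congr {p : ℕ} {e e' s : List ℕ}
    (h : List.Forall₂ (fun a b => a % p = b % p) e e') :
    (dotN e s : ZMod p) = dotN e' s := by
  induction h generalizing s with
  | nil => rfl
  | @cons a b e e' h1 _ ih =>
    cases s with
    | nil => simp [dotN]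
    | cons x s =>
      have h2 : (a : ZMod p) = b := (ZMod.natCast_eq_natCast_iff' a b p).2 h1
      have h3 := ih (s := s)
      simp only [dotN, List.zipWith_cons_cons, List.sum_cons, Nat.cast_add, Nat.cast_mul] at *
      rw [h2, h3]

open Classical in
/-- For a random vector modulo a prime, two different linear forms agree with probability at most
`1 / p`. -/
theorem expect_randVec_le {p n : ℕ} (hp : p.Prime) {e e' : List ℕ} (he : e.length = n)
    (he' : e'.length = n) (hne : ¬ List.Forall₂ (fun a b => a % p = b % p) e e') (c c' : ZMod p) :
    expect U (randVec p n : Prog ℕ R _)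
      (fun s => if (dotN e s : ZMod p) + c = dotN e' s + c' then 1 else 0) ≤ (p : ℝ≥0∞)⁻¹ := by
  have : Fact p.Prime := ⟨hp⟩
  have hp0 : (p : ℝ≥0∞) ≠ 0 := by exact_mod_cast hp.ne_zero
  have hpt : (p : ℝ≥0∞) ≠ ⊤ := ENNReal.natCast_ne_top p
  induction n generalizing e e' c c' with
  | zero =>
    rw [List.length_eq_zero_iff] at he he'
    subst he he'
    exact absurd List.Forall₂.nil hne
  | succ n ih =>
    obtain ⟨a, e, rfl⟩ := List.exists_cons_of_length_eq_add_one he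
    obtain ⟨b, e', rfl⟩ := List.exists_cons_of_length_eq_add_one he'
    simp only [List.length_cons, Nat.add_right_cancel_iff] at he he'
    rw [List.forall₂_cons, not_and_or] at hne
    rw [randVec, expect_rand hp.pos, div_eq_mul_inv]
    refine (mul_le_mul_left (?_ : _ ≤ (1 : ℝ≥0∞)) _).trans (by rw [one_mul])
    have hstep : ∀ x, expect U ((randVec p n : Prog ℕ R _).bind fun s => .ret (x :: s))
        (fun s =>
          if (dotN (a :: e) s : ZMod p) + c = dotN (b :: e') s + c' then (1 : ℝ≥0∞) else 0) =
        expect U (randVec p n : Prog ℕ R _) (fun s => if (dotN e s : ZMod p) + (a * x + c) =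
          dotN e' s + (b * x + c') then 1 else 0) := by
      intro x
      rw [expect_bind]
      congr 1
      funext s
      rw [expect_ret]
      congr 1
      simp only [dotN, List.zipWith_cons_cons, List.sum_cons, Nat.cast_add, Nat.cast_mul]
      rw [eq_iff_iff]
      constructor <;> intro h <;> linear_combination h
    -- if the tails agree modulo `p`, the first entry of `s` is determined by a linear equation with
    -- invertible coefficient; otherwise the induction hypothesis applies for each first entry
    by_cases htail : List.Forall₂ (fun a b => a % p = b % p) e e'
    · have hab : (a : ZMod p) ≠ b := by
        rw [Ne, ZMod.natCast_eq_natCast_iff']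
        exact hne.resolve_right fun h => h htail
      have hval : ∀ x, expect U ((randVec p n : Prog ℕ R _).bind fun s => .ret (x :: s))
          (fun s => if (dotN (a :: e) s : ZMod p) + c = dotN (b :: e') s + c' then
            (1 : ℝ≥0∞) else 0) = if (a * x + c : ZMod p) = b * x + c' then 1 else 0 := by
        intro x
        rw [hstep, ← expect_const (U := U) (randVec p n : Prog ℕ R _)
          (if (a * x + c : ZMod p) = b * x + c' then 1 else 0)]
        congr 1
        funext s
        simp only [dotN_mod_congr htail, add_right_inj]
      simp only [hval]
      rw [Finset.sum_boole]
      have : ((Finset.range p).filter fun x : ℕ =>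
          (a * x + c : ZMod p) = b * x + c').card ≤ 1 := by
        rw [Finset.card_le_one]
        intro x hx y hy
        simp only [Finset.mem_filter, Finset.mem_range] at hx hy
        have h1 : ((a : ZMod p) - b) * (x - y) = 0 := by
          linear_combination hx.2 - hy.2
        have h2 : (x : ZMod p) = y := by
          rcases mul_eq_zero.1 h1 with h | h
          · exact absurd (sub_eq_zero.1 h) hab
          · exact sub_eq_zero.1 h
        rw [ZMod.natCast_eq_natCast_iff', Nat.mod_eq_of_lt hx.1, Nat.mod_eq_of_lt hy.1] at h2
        exact h2
      exact_mod_cast this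
    · calc _ ≤ ∑ x ∈ Finset.range p, (p : ℝ≥0∞)⁻¹ := by
            refine Finset.sum_le_sum fun x _ => ?_
            rw [hstep]
            exact ih he he' htail _ _
        _ = 1 := by
            rw [Finset.sum_const, Finset.card_range, nsmul_eq_mul, ENNReal.mul_inv_cancel hp0 hpt]

theorem sum_range_getD {M : Type*} [AddCommMonoid M] (l : List ℕ) (f : ℕ → M) :
    ∑ i ∈ Finset.range l.length, f (l.getD i 0) = (l.map f).sum := by
  induction l with
  | nil => simp
  | cons a l ih =>
    rw [List.length_cons, Finset.sum_range_succ', List.map_cons, List.sum_cons, add_comm]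
    simp only [List.getD_cons_succ, List.getD_cons_zero]
    rw [ih]

/-- Few primes can divide all differences of the entries of two different vectors. -/
theorem card_primes_lt_size {D n : ℕ} {S : Finset ℕ} (hS : ∀ p ∈ S, p.Prime) {e e' : List ℕ}
    (he : e.length = n) (he' : e'.length = n) (hD : ∀ a ∈ e, a ≤ D) (hD' : ∀ a ∈ e', a ≤ D)
    (hne : e ≠ e')
    (h : ∀ p ∈ S, List.Forall₂ (fun a b => a % p = b % p) e e') : S.card < D.size := by
  obtain ⟨i, hi, hi', hei⟩ : ∃ i, ∃ (hi : i < e.length) (hi' : i < e'.length), e[i] ≠ e'[i] := by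
    by_contra! H
    exact hne (List.ext_getElem (by omega) fun i h1 h2 => H i h1 h2)
  have h1 := hD _ (List.getElem_mem hi)
  have h2 := hD' _ (List.getElem_mem hi')
  -- the absolute value of the difference, in truncated subtraction
  set x := (e[i] - e'[i]) + (e'[i] - e[i]) with hx
  have hx0 : x ≠ 0 := by omega
  have hxD : x ≤ D := by omega
  have hdvd : ∏ p ∈ S, p ∣ x := by
    refine Finset.prod_primes_dvd x (fun p hp => (hS p hp).prime) fun p hp => ?_
    have h3 := (h p hp).get hi hi'
    simp only [List.get_eq_getElem] at h3
    rcases le_total e[i] e'[i] with h4 | h4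
    · have : x = e'[i] - e[i] := by omega
      rw [this]
      exact (Nat.modEq_iff_dvd' h4).1 h3
    · have : x = e[i] - e'[i] := by omega
      rw [this]
      exact (Nat.modEq_iff_dvd' h4).1 h3.symm
  rw [Nat.lt_size]
  calc 2 ^ S.card ≤ ∏ p ∈ S, p := Finset.pow_card_le_prod S _ 2 fun p hp => (hS p hp).two_le
    _ ≤ x := Nat.le_of_dvd (Nat.pos_of_ne_zero hx0) hdvd
    _ ≤ D := hxD

/-- The drawing of a random pair `(p, s)`. -/
def drawPair {Z : Type} {K : Type u} (n : ℕ) (ps : List Z) : Prog Z K (List Z) :=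
  .pick ps fun p => (randVec p n).bind fun s => .ret (p :: s)

/-- The residue class `⟨e, s⟩ mod p` of the exponent vector `e` for the substitution
`v = p :: s`. -/
def residue (v : List ℕ) (e : List ℕ) : ℕ := dotN e v.tail % v.headD 0

open Classical in
/-- The two summands account for the primes modulo which `e` and `e'` agree, and for the choice of
`s` for the other primes. -/
theorem expect_drawPair_le {n D M : ℕ} {ps : List ℕ} (hps : ∀ p ∈ ps, p.Prime ∧ M ≤ p)
    (hnd : ps.Nodup) (hpos : 0 < ps.length) {e e' : List ℕ}
    (he : e.length = n) (he' : e'.length = n) (hD : ∀ a ∈ e, a ≤ D) (hD' : ∀ a ∈ e', a ≤ D)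
    (hne : e ≠ e') :
    expect U (drawPair n ps : Prog ℕ R _)
      (fun v => if residue v e = residue v e' then 1 else 0) ≤
        ((D.size - 1 : ℕ) : ℝ≥0∞) / ps.length + (M : ℝ≥0∞)⁻¹ := by
  have hN0 : (ps.length : ℝ≥0∞) ≠ 0 := by exact_mod_cast hpos.ne'
  have hNt : (ps.length : ℝ≥0∞) ≠ ⊤ := ENNReal.natCast_ne_top _
  rw [drawPair, expect_pick hpos, sum_range_getD ps (fun p => expect U ((randVec p n).bind fun s =>
    .ret (p :: s)) (fun v => if residue v e = residue v e' then 1 else 0)),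
    ← List.sum_toFinset _ hnd]
  have hterm : ∀ p ∈ ps.toFinset, expect U ((randVec p n : Prog ℕ R _).bind fun s =>
      .ret (p :: s)) (fun v => if residue v e = residue v e' then (1 : ℝ≥0∞) else 0) ≤
      (if List.Forall₂ (fun a b => a % p = b % p) e e' then 1 else 0) + (M : ℝ≥0∞)⁻¹ := by
    intro p hp
    obtain ⟨hpp, hpM⟩ := hps p (List.mem_toFinset.1 hp)
    split_ifs with h
    · calc _ ≤ expect U ((randVec p n : Prog ℕ R _).bind fun s => .ret (p :: s))
            (fun _ => (1 : ℝ≥0∞)) := expect_mono fun v => by split_ifs <;> simp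
        _ = 1 := expect_const _ _
        _ ≤ _ := le_self_add
    · rw [zero_add, expect_bind]
      refine le_trans (le_of_eq ?_) ((expect_randVec_le (R := R) (U := U) hpp he he' h 0 0).trans
        (ENNReal.inv_le_inv.2 (by exact_mod_cast hpM)))
      congr 1
      funext s
      rw [expect_ret]
      congr 1
      rw [eq_iff_iff, add_zero, add_zero, ZMod.natCast_eq_natCast_iff']
      rfl
  have hcard : ((ps.toFinset.filter fun p =>
      List.Forall₂ (fun a b => a % p = b % p) e e').card) ≤ D.size - 1 := by
    refine Nat.le_sub_one_of_lt (card_primes_lt_size (fun p hp => ?_) he he' hD hD' hne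
      fun p hp => (Finset.mem_filter.1 hp).2)
    exact (hps p (List.mem_toFinset.1 (Finset.mem_filter.1 hp).1)).1
  calc _ ≤ (((D.size - 1 : ℕ) : ℝ≥0∞) + ps.length * (M : ℝ≥0∞)⁻¹) / ps.length := by
        refine ENNReal.div_le_div_right ((Finset.sum_le_sum hterm).trans ?_) _
        rw [Finset.sum_add_distrib, Finset.sum_boole, Finset.sum_const,
          List.toFinset_card_of_nodup hnd, nsmul_eq_mul]
        gcongr
    _ = _ := by
        rw [ENNReal.add_div, mul_comm, mul_div_assoc, ENNReal.div_self hN0 hNt, mul_one]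

open Classical in
/-- With probability at least one half, a random pair `(p, s)` makes at most a sixth of the terms
collide. -/
theorem expect_bad_le {n D t : ℕ} {S : Finset (List ℕ)} {ps : List ℕ} (hS : S.card ≤ t)
    (ht : 0 < t) (hSn : ∀ e ∈ S, e.length = n ∧ ∀ a ∈ e, a ≤ D)
    (hps : ∀ p ∈ ps, p.Prime ∧ 32 * (t - 1) ≤ p) (hnd : ps.Nodup) (hpos : 0 < ps.length)
    (hN : 31 * ((t - 1) * (D.size - 1)) ≤ ps.length) :
    expect U (drawPair n ps : Prog ℕ R _)
      (fun v => if t < 6 * (collided S (residue v)).card then 1 else 0) ≤ 2⁻¹ := by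
  rcases Nat.lt_or_ge S.card 2 with h2 | h2
  · -- a single term cannot collide
    refine le_trans (expect_mono (ψ := fun _ => 0) fun v => ?_)
        (by rw [expect_const]; exact zero_le)
    have : (collided S (residue v)).card = 0 := by
      rw [Finset.card_eq_zero, collided, Finset.filter_eq_empty_iff]
      rintro e he ⟨e', he', hne, -⟩
      exact hne (Finset.card_le_one.1 (show S.card ≤ 1 by omega) _ he' _ he)
    rw [this, if_neg (by omega)]
  have ht2 : 2 ≤ t := h2.trans hS
  have ht0 : (t : ℝ≥0∞) ≠ 0 := by exact_mod_cast ht.ne'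
  have htt : (t : ℝ≥0∞) ≠ ⊤ := ENNReal.natCast_ne_top _
  set ε : ℝ≥0∞ := ((D.size - 1 : ℕ) : ℝ≥0∞) / ps.length + ((32 * (t - 1) : ℕ) : ℝ≥0∞)⁻¹ with hε
  -- the expected number of collided terms is at most the expected number of colliding pairs
  have hcoll : expect U (drawPair n ps : Prog ℕ R _)
      (fun v => ((collided S (residue v)).card : ℝ≥0∞)) ≤ t * ((t - 1 : ℕ) * ε) := by
    calc _ ≤ expect U (drawPair n ps : Prog ℕ R _) (fun v => ∑ e ∈ S, ∑ e' ∈ S.erase e,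
            if residue v e' = residue v e then (1 : ℝ≥0∞) else 0) := by
          refine expect_mono fun v => ?_
          rw [collided, Finset.card_filter]
          push_cast
          refine Finset.sum_le_sum fun e _ => ?_
          split_ifs with h
          · obtain ⟨e', he', hne, h⟩ := h
            calc (1 : ℝ≥0∞) = if residue v e' = residue v e then (1 : ℝ≥0∞) else 0 := by
                  rw [if_pos h]
              _ ≤ _ := Finset.single_le_sum (f := fun e' =>
                  if residue v e' = residue v e then (1 : ℝ≥0∞) else 0)
                  (fun _ _ => zero_le) (Finset.mem_erase.2 ⟨hne, he'⟩)
          · exact zero_le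
      _ = ∑ e ∈ S, ∑ e' ∈ S.erase e, expect U (drawPair n ps : Prog ℕ R _)
            (fun v => if residue v e' = residue v e then (1 : ℝ≥0∞) else 0) := by
          simp only [expect_sum]
      _ ≤ ∑ e ∈ S, ∑ e' ∈ S.erase e, ε := by
          refine Finset.sum_le_sum fun e he => Finset.sum_le_sum fun e' he' => ?_
          obtain ⟨hne, he'⟩ := Finset.mem_erase.1 he'
          exact expect_drawPair_le hps hnd hpos (hSn _ he').1 (hSn _ he).1 (hSn _ he').2
            (hSn _ he).2 hne
      _ = S.card * ((S.card - 1 : ℕ) * ε) := by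
          rw [Finset.sum_congr rfl fun e he => by
            rw [Finset.sum_const, Finset.card_erase_of_mem he, nsmul_eq_mul]]
          rw [Finset.sum_const, nsmul_eq_mul]
      _ ≤ _ := by gcongr
  have hε' : ((t - 1 : ℕ) : ℝ≥0∞) * ε ≤ 31⁻¹ + 32⁻¹ := by
    rw [hε, mul_add]
    refine add_le_add ?_ ?_
    · rw [← mul_div_assoc, ← one_div]
      rw [ENNReal.div_le_iff_le_mul (Or.inl (by exact_mod_cast hpos.ne'))
        (Or.inl (ENNReal.natCast_ne_top _)), ← ENNReal.mul_div_right_comm, one_mul]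
      rw [ENNReal.le_div_iff_mul_le (Or.inl (by norm_num)) (Or.inl (by norm_num))]
      have : (t - 1) * (D.size - 1) * 31 ≤ ps.length := by linarith
      exact_mod_cast this
    · have h1 : ((t - 1 : ℕ) : ℝ≥0∞) ≠ 0 := by
        have : t - 1 ≠ 0 := by omega
        exact_mod_cast this
      push_cast
      rw [ENNReal.mul_inv (Or.inl (by norm_num)) (Or.inl (by norm_num))]
      rw [mul_left_comm]
      have h2 : ((t : ℝ≥0∞) - 1) * ((t : ℝ≥0∞) - 1)⁻¹ = 1 := by
        have e : ((t - 1 : ℕ) : ℝ≥0∞) = (t : ℝ≥0∞) - 1 := by push_cast; rfl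
        rw [← e]
        exact ENNReal.mul_inv_cancel h1 (ENNReal.natCast_ne_top _)
      rw [h2, mul_one]
  -- Markov's inequality
  have hmarkov : (t : ℝ≥0∞) * expect U (drawPair n ps : Prog ℕ R _)
      (fun v => if t < 6 * (collided S (residue v)).card then 1 else 0) ≤
      6 * expect U (drawPair n ps : Prog ℕ R _)
      (fun v => ((collided S (residue v)).card : ℝ≥0∞)) := by
    rw [← expect_mul_left, ← expect_mul_left]
    refine expect_mono fun v => ?_
    split_ifs with h
    · rw [mul_one]
      exact_mod_cast h.le
    · simp
  have hfin : (t : ℝ≥0∞) * expect U (drawPair n ps : Prog ℕ R _)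
      (fun v => if t < 6 * (collided S (residue v)).card then 1 else 0) ≤ t * 2⁻¹ := by
    refine hmarkov.trans ?_
    calc _ ≤ 6 * ((t : ℝ≥0∞) * (31⁻¹ + 32⁻¹)) := by gcongr; exact hcoll.trans (by gcongr)
      _ = t * (6 * (31⁻¹ + 32⁻¹)) := by ring
      _ ≤ t * 2⁻¹ := by
        gcongr
        rw [← ENNReal.toReal_le_toReal (by finiteness) (by finiteness)]
        rw [ENNReal.toReal_mul, ENNReal.toReal_add (by finiteness) (by finiteness)]
        norm_num
  exact (ENNReal.mul_le_mul_iff_right ht0 htt).1 hfin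

open Classical in
/-- Independent draws: the probability that all of them are bad. -/
theorem expect_mapP_le {α : Type v} {β : Type w} {g : α → Prog ℕ R β} {l : List α}
    {B : β → Prop} {ε : ℝ≥0∞}
    (h : ∀ a ∈ l, expect U (g a) (fun b => if B b then 1 else 0) ≤ ε) :
    expect U (mapP g l) (fun l' => if ∀ b ∈ l', B b then 1 else 0) ≤ ε ^ l.length := by
  induction l with
  | nil => rw [mapP, expect_ret]; simp
  | cons a l ih =>
    simp only [List.mem_cons, forall_eq_or_imp] at h
    rw [mapP, expect_bind]
    calc _ = expect U (g a) (fun b => expect U (mapP g l)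
            (fun l' => if ∀ b ∈ l', B b then (1 : ℝ≥0∞) else 0) * if B b then 1 else 0) := by
          congr 1
          funext b
          rw [mul_comm, ← expect_mul_left, expect_bind]
          congr 1
          funext l'
          rw [expect_ret]
          by_cases hb : B b <;> simp [hb]
      _ = expect U (mapP g l) (fun l' => if ∀ b ∈ l', B b then (1 : ℝ≥0∞) else 0) *
            expect U (g a) (fun b => if B b then 1 else 0) := expect_mul_left _ _ _
      _ ≤ ε ^ l.length * ε := mul_le_mul' (ih h.2) h.1
      _ = _ := by rw [List.length_cons, pow_succ]

end Probability

/-! ### Substitutions and the recovery of terms -/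

section HalfPoly

variable {R : Type u} [CommRing R]

/-- The standing assumptions: `F` is the coefficient function of the polynomial to be interpolated,
with exponent vectors as keys; the primes of the substitutions are at most `P` and the integers
of the computation at most `W`; the procedure `U` interpolates correctly, and the calls with valid
bounds satisfy `V`. -/
structure Setting (U : Interpolator R) (V : Query → Prop) (n T D P W : ℕ) (F : List ℕ →₀ R) :
    Prop where
  n_pos : 0 < n
  T_pos : 0 < T
  D_pos : 0 < D
  le_P : 96 ≤ P
  le_W : n * (2 * P * D * P) ≤ W
  three_T_le : 3 * T ≤ W
  keys : ∀ e ∈ F.support, e.length = n ∧ e.sum ≤ D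
  card : F.support.card ≤ T
  interp : ∀ s B, s.length = n → maxN s * D ≤ B → Terms (U s B T) (F.mapDomain (dotN · s))
  query : ∀ s B, s.length = n → maxN s * D ≤ B → B ≤ 2 * P * D → V ⟨s, B, T⟩

/-- A list of terms in `n` variables of total degree at most `D`, with at most `m` terms. -/
def TermList (n D m : ℕ) (h : List (List ℕ × R)) : Prop :=
  h.length ≤ m ∧ ∀ x ∈ h, x.1.length = n ∧ x.1.sum ≤ D

/-- `v` consists of a prime `p ≤ P` and `n` residues modulo `p`, as a single list with `p` in
front. -/
def IsPair (n P : ℕ) (v : List ℕ) : Prop :=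
  ∃ p s, v = p :: s ∧ p.Prime ∧ p ≤ P ∧ s.length = n ∧ ∀ a ∈ s, a < p

/-- `x` is the outcome of the substitution `v`, for the polynomial with coefficients `G`. -/
structure IsTrial (T K : ℕ) (G : List ℕ →₀ R) (v : List ℕ) (x : Trial ℕ R) : Prop where
  eq : v = x.p :: x.s
  fi_terms : Terms x.fi (G.mapDomain (dotN · x.s))
  fi_le : ∀ m ∈ x.fi, m.1 ≤ K
  fi_length : x.fi.length ≤ 3 * T
  fm_sorted : Sorted x.fm
  fm_terms : Terms x.fm (G.mapDomain (residue v))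
  fm_le : ∀ m ∈ x.fm, m.1 ≤ K
  fm_length : x.fm.length ≤ 3 * T
  terms_eq : x.terms = x.fm.length

/-- The bit operations of one substitution. -/
def trialCost (W n T : ℕ) : ℕ := 3 * collectCost (3 * T) (unit W) + 20 * (n * T * unit W)

/-- The bit operations of the recovery of terms. -/
def recoverCost (W n T : ℕ) : ℕ :=
  (n + 1) * (3 * collectCost (3 * T) (unit W) + 60 * (T * unit W))

variable {U : Interpolator R} {V : Query → Prop} {n T D P W : ℕ} {F : List ℕ →₀ R}

/-- The bounds for the integers which follow from the standing assumptions. -/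
theorem Setting.bounds (S : Setting U V n T D P W F) :
    2 * P * D ≤ W ∧ n * (2 * P * D) ≤ W ∧ n * (D * P) ≤ W ∧ P + 1 ≤ W ∧ D ≤ W ∧ 2 * P ≤ W ∧
      D * P ≤ 2 * P * D ∧ D * P + D * P ≤ 2 * P * D ∧ 2 * P ≤ 2 * P * D := by
  have h1 := S.n_pos
  have h3 := S.D_pos
  have h4 := S.le_P
  have h5 := S.le_W
  have a1 : 2 * P * D ≤ 2 * P * D * P := Nat.le_mul_of_pos_right _ (by omega)
  have a2 : n * (2 * P * D) ≤ n * (2 * P * D * P) := Nat.mul_le_mul_left _ a1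
  have a3 : 2 * P * D ≤ n * (2 * P * D) := Nat.le_mul_of_pos_left _ h1
  have a4 : 2 * P ≤ 2 * P * D := Nat.le_mul_of_pos_right _ h3
  have a5 : D ≤ 2 * P * D := Nat.le_mul_of_pos_left _ (by omega)
  have a6 : D * P + D * P = 2 * P * D := by ring
  have a7 : n * (D * P) ≤ n * (2 * P * D) := Nat.mul_le_mul_left _ (by omega)
  refine ⟨?_, ?_, ?_, ?_, ?_, ?_, ?_, ?_, ?_⟩ <;> omega

theorem dotN_le_of_keys {e s : List ℕ} {B : ℕ} (he : e.sum ≤ D) (h : maxN s * D ≤ B) :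
    dotN e s ≤ B :=
  (dotN_le_sum_mul fun _ => le_maxN).trans ((Nat.mul_le_mul_right _ he).trans (by linarith))

theorem Setting.interp_le (S : Setting U V n T D P W F) {s : List ℕ} {B : ℕ} (hs : s.length = n)
    (h : maxN s * D ≤ B) : (U s B T).length ≤ T ∧ ∀ m ∈ U s B T, m.1 ≤ B := by
  have hT := S.interp s B hs h
  refine ⟨?_, fun m hm => ?_⟩
  · rw [hT.length_eq]
    exact (card_support_mapDomain_le _ _).trans S.card
  · obtain ⟨e, he, h'⟩ := exists_of_mem_support_mapDomain (hT.mem_iff.1 hm).1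
    rw [← h']
    exact dotN_le_of_keys (S.keys e he).2 h

/-- The substitution of one trial. -/
theorem Spec.trial (S : Setting U V n T D P W F) {h : List (List ℕ × R)}
    (hh : TermList n D (2 * T) h) {p : ℕ} {s : List ℕ} (hpP : p ≤ P)
    (hs : s.length = n) (hsp : ∀ a ∈ s, a < p) :
    Spec U V ((SparseInterp.normP s).bind fun m => (SparseInterp.arith .mul m D).bind fun B =>
          Prog.interp s B T fun F => (SparseInterp.substU h s).bind fun hs =>
            (SparseInterp.subU F hs).bind fun fi =>
          (SparseInterp.modU p fi).bind fun fm => (SparseInterp.lengthP fm).bind fun c =>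
          .ret (some ⟨p, s, fi, fm, c⟩) : Prog ℕ R (Option (Trial ℕ R)))
      1 (10 * T) (trialCost W n T)
      fun o => ∃ x, o = some x ∧ IsTrial T (2 * P * D) (F - coeffs h) (p :: s) x := by
  obtain ⟨b1, b2, b3, b4, b5, b6, b7, b8, b9⟩ := S.bounds
  have hn := S.n_pos
  have hTp := S.T_pos
  have hT3 := S.three_T_le
  set u := unit W with hu
  have hsP : ∀ a ∈ s, a ≤ P := fun a ha => (hsp a ha).le.trans hpP
  have hmax : maxN s ≤ P := maxN_le hsP
  have hB : maxN s * D ≤ D * P := by rw [mul_comm]; exact Nat.mul_le_mul_left _ hmax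
  have c2 : collectCost (2 * T) u ≤ collectCost (3 * T) u := collectCost_mono (by omega) le_rfl
  refine Spec.mono (q := 0 + (1 + 0))
    (r := 0 + (2 * T + (5 * T + (3 * T + (0 + 0)))))
    (b := (n + 1) * u + (u + (2 * T * ((2 * n + 1) * u) + collectCost (2 * T) u +
      (collectCost (3 * T) u + (3 * T * u + collectCost (3 * T) u + ((2 * (3 * T) + 1) * u + 0))))))
    ?_ le_rfl (by omega) ?_ fun _ h => h
  swap
  · unfold trialCost
    have e1 : n * u ≤ n * T * u := by nlinarith [Nat.zero_le (n * u)]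
    have e2 : T * u ≤ n * T * u := by nlinarith [Nat.zero_le (T * u)]
    have e3 : u ≤ T * u := Nat.le_mul_of_pos_left _ hTp
    linarith
  refine Spec.bind (q := 0) (r := 0) (hs ▸ Spec.normP fun a ha => (hsP a ha).trans (by omega))
      fun m hm => ?_
  subst hm
  refine Spec.arith_bind (op := .mul) (by omega) b5 (by simp only [ArithOp.eval]; omega) ?_
  simp only [ArithOp.eval]
  refine Spec.interp (S.query s _ hs le_rfl (by omega)) ?_
  obtain ⟨hlen, hle⟩ := S.interp_le hs (le_refl (maxN s * D))
  have hterms := S.interp s _ hs (le_refl (maxN s * D))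
  refine Spec.bind (q := 0) (q' := 0) (Spec.mono
      (Spec.substU (W := W) (A := D) (fun m hm => ⟨(hh.2 m hm).1, fun a ha =>
    (List.le_sum_of_mem ha).trans (hh.2 m hm).2⟩) hsP b5 (by omega) b3) le_rfl hh.1 ?_
      fun _ h => h) fun hl hhl => ?_
  · exact Nat.add_le_add (Nat.mul_le_mul_right _ hh.1) (collectCost_mono hh.1 le_rfl)
  obtain ⟨-, hhl⟩ := hhl
  have hhl_len : hl.length ≤ 2 * T := by
    rw [hhl.length_eq]
    exact (card_support_mapDomain_le _ _).trans ((card_support_coeffs_le h).trans hh.1)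
  have hhl_le : ∀ m ∈ hl, m.1 ≤ D * P := by
    intro m hm
    obtain ⟨e, he, h'⟩ := exists_of_mem_support_mapDomain (hhl.mem_iff.1 hm).1
    obtain ⟨m', hm', rfl⟩ := exists_mem_of_mem_support_coeffs he
    rw [← h']
    exact (dotN_le_sum_mul hsP).trans (Nat.mul_le_mul_right _ (hh.2 m' hm').2)
  have hfisum : coeffs (U s (maxN s * D) T) - coeffs hl = (F - coeffs h).mapDomain (dotN · s) := by
    rw [hterms.2.2, hhl.2.2, mapDomain_sub']
  refine Spec.bind (q := 0) (q' := 0) (Spec.mono (Spec.subU (W := W)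
    (fun m hm => (hle m hm).trans (by omega)) (fun m hm => (hhl_le m hm).trans (by omega))) le_rfl
    (by omega) (collectCost_mono (by omega) le_rfl) fun _ h => h) fun fi hfi => ?_
  obtain ⟨-, hfi⟩ := hfi
  rw [hfisum] at hfi
  have hfi_le : ∀ m ∈ fi, m.1 ≤ D * P := by
    intro m hm
    have h1 := (hfi.mem_iff.1 hm).1
    rw [← hfisum] at h1
    classical
    rcases Finset.mem_union.1 (Finsupp.support_sub h1) with h1 | h1
    · obtain ⟨m', hm', e⟩ := exists_mem_of_mem_support_coeffs h1
      exact e ▸ (hle m' hm').trans hB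
    · obtain ⟨m', hm', e⟩ := exists_mem_of_mem_support_coeffs h1
      exact e ▸ hhl_le m' hm'
  have hfi_len : fi.length ≤ 3 * T := by
    rw [hfi.length_eq, ← hfisum]
    classical
    refine (Finset.card_le_card Finsupp.support_sub).trans ((Finset.card_union_le _ _).trans ?_)
    have h1 := card_support_coeffs_le (U s (maxN s * D) T)
    have h2 := card_support_coeffs_le hl
    omega
  refine Spec.bind (q := 0) (q' := 0) (Spec.mono (Spec.modU (W := W) (by omega)
    (fun m hm => (hfi_le m hm).trans (by omega))) le_rfl
    (by omega) (Nat.add_le_add (Nat.mul_le_mul_right _ hfi_len) (collectCost_mono hfi_len le_rfl))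
      fun _ h => h) fun fm hfm => ?_
  obtain ⟨hfms, hfm⟩ := hfm
  have hfm_len : fm.length ≤ 3 * T := by
    rw [hfm.length_eq]
    exact (card_support_mapDomain_le _ _).trans ((card_support_coeffs_le fi).trans hfi_len)
  refine Spec.bind (q := 0) (q' := 0) (r := 0) (r' := 0)
      (Spec.leB (Spec.lengthP (W := W) (by omega) (by omega))
    (Nat.mul_le_mul_right _ (by omega))) fun c hc => Spec.ret ⟨_, rfl, ?_⟩
  refine ⟨rfl, hfi, fun m hm => (hfi_le m hm).trans b7, hfi_len, hfms, ?_, ?_, hfm_len, hc⟩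
  · rw [hfi.2.2, ← Finsupp.mapDomain_comp] at hfm
    exact hfm
  · intro m hm
    obtain ⟨e, he, h'⟩ := exists_of_mem_support_mapDomain (hfm.mem_iff.1 hm).1
    obtain ⟨m', hm', rfl⟩ := exists_mem_of_mem_support_coeffs he
    rw [← h']
    exact (Nat.mod_le _ _).trans ((hfi_le m' hm').trans b7)

theorem dotN_modify {e s : List ℕ} {k p : ℕ} (hk : k < s.length) :
    dotN e (s.modify k (· + p)) = dotN e s + e.getD k 0 * p := by
  induction s generalizing e k with
  | nil => simp at hk
  | cons a s ih =>
    cases e with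
    | nil => simp [dotN]
    | cons b e =>
      cases k with
      | zero => simp [dotN]; ring
      | succ k =>
        have := ih (e := e) (k := k) (by simpa using hk)
        simp only [dotN, List.modify_succ_cons, List.zipWith_cons_cons, List.sum_cons,
          List.getD_cons_succ] at this ⊢
        rw [this]; ring

theorem maxN_modify_le {s : List ℕ} {k p : ℕ} (hk : k < s.length) :
    maxN (s.modify k (· + p)) ≤ max (maxN s) (s[k] + p) := by
  refine maxN_le fun a ha => ?_
  obtain ⟨i, hi, rfl⟩ := List.getElem_of_mem ha
  rw [List.getElem_modify]
  split_ifs with h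
  · subst h
    exact le_max_right _ _
  · exact (le_maxN (List.getElem_mem _)).trans (le_max_left _ _)

/-- The recovery of terms from the best trial: the result contains every term without collisions,
and at most one term for each residue class that is met by an exponent. -/
theorem Spec.recover (S : Setting U V n T D P W F) {h : List (List ℕ × R)}
    (hh : TermList n D (2 * T) h) {v : List ℕ} {x : Trial ℕ R} (hv : IsPair n P v)
    (hx : IsTrial T (2 * P * D) (F - coeffs h) v x) :
    Spec U V (SparseInterp.recover n h T D x : Prog ℕ R _) n (7 * (n * T)) (recoverCost W n T)
      fun g =>
      TermList n D x.fm.length g ∧ (g.map fun m => residue v m.1).Nodup ∧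
      (∀ m ∈ g, residue v m.1 ∈ (F - coeffs h).support.image (residue v)) ∧
      ∀ e ∈ (F - coeffs h).support, e ∉ collided (F - coeffs h).support (residue v) →
        (e, (F - coeffs h) e) ∈ g := by
  obtain ⟨b1, b2, b3, b4, b5, b6, b7, b8, b9⟩ := S.bounds
  have hn := S.n_pos
  have hTp := S.T_pos
  have hDp := S.D_pos
  obtain ⟨p, s, fi, fm, c⟩ := x
  obtain ⟨p', s', hv', hpp, hpP, hs, hsp⟩ := hv
  obtain ⟨heq, hfi, hfi_le, hfi_len, hfms, hfm, hfm_le, hfm_len, hc⟩ := hx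
  simp only at *
  rw [hv'] at heq
  obtain ⟨rfl, rfl⟩ : p' = p ∧ s' = s := by simpa using heq
  subst hv'
  have hres : ∀ e, residue (p' :: s') e = dotN e s' % p' := fun _ => rfl
  set u := unit W with hu
  set G := F - coeffs h with hG
  have hsP : ∀ a ∈ s', a ≤ P := fun a ha => (hsp a ha).le.trans hpP
  have hmax : maxN s' ≤ P := maxN_le hsP
  have c2 : collectCost (2 * T) u ≤ collectCost (3 * T) u := collectCost_mono (by omega) le_rfl
  have hGkeys : ∀ e ∈ G.support, e.length = n ∧ e.sum ≤ D := by
    classical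
    intro e he
    rcases Finset.mem_union.1 (Finsupp.support_sub he) with h1 | h1
    · exact S.keys e h1
    · obtain ⟨m, hm, rfl⟩ := exists_mem_of_mem_support_coeffs h1
      exact hh.2 m hm
  have hcT : T ≤ 3 * T := by omega
  have hp'W : p' ≤ W := by omega
  have hp'W1 : p' + 1 ≤ W := by omega
  refine Spec.mono (q := 0 + (n + (0 + (0 + 0))))
    (r := 0 + (0 + (n * (2 * T) + (n * (5 * T) + 0))))
    (b := (n + 1) * u + (n * (3 * u) + ((2 * T * ((2 * n + 1) * u) +
      n * (2 * T * (2 * u) + collectCost (2 * T) u)) + (n * collectCost (3 * T) u +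
      ((n + 1) * extendCost W (3 * T) + 3 * T * ((3 * n + 4) * u))))))
    ?_ (by omega) (by nlinarith) ?_ fun _ h => h
  swap
  · unfold recoverCost extendCost
    rw [← hu]
    have e1 : n * u ≤ n * T * u := by nlinarith [Nat.zero_le (n * u)]
    have e3 : u ≤ T * u := Nat.le_mul_of_pos_left _ hTp
    have e4 := Nat.mul_le_mul_left n c2
    linarith [Nat.zero_le (n * T * u), Nat.zero_le (n * collectCost (3 * T) u),
      Nat.zero_le (collectCost (3 * T) u), Nat.zero_le (T * u)]
  refine Spec.bind (q := 0) (r := 0) (hs ▸ Spec.normP fun a ha => (hsP a ha).trans (by omega))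
      fun m hm => ?_
  subst hm
  refine Spec.bind (Q := fun Fs => Fs.length = n ∧ ∀ k (hk : k < Fs.length),
      Terms Fs[k] (F.mapDomain fun e => dotN e s' + e.getD k 0 * p') ∧ Fs[k].length ≤ T ∧
      ∀ m ∈ Fs[k], m.1 ≤ 2 * P * D) (Spec.mono (Spec.mapP_const (q := 1) (r := 0) (b := 3 * u)
    (Q := fun ka F' => Terms F' (F.mapDomain fun e => dotN e s' + e.getD ka.2 0 * p') ∧
      F'.length ≤ T ∧ ∀ m ∈ F', m.1 ≤ 2 * P * D)
    fun ka hka => ?_) (by simp [hs]) (by simp) (by simp [hs]) fun Fs hFs => ?_) fun Fs hFs => ?_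
  · obtain ⟨a, k⟩ := ka
    rw [List.mem_zipIdx_iff_getElem?] at hka
    simp only at hka
    obtain ⟨hk, hka⟩ := List.getElem?_eq_some_iff.1 hka
    have ha : a ≤ P := hsP _ (hka ▸ List.getElem_mem hk)
    have hm2 : max (maxN s') (a + p') ≤ 2 * P := by omega
    have hB : max (maxN s') (a + p') * D ≤ 2 * P * D := Nat.mul_le_mul_right _ hm2
    have hmod : maxN (s'.modify k (· + p')) * D ≤ max (maxN s') (a + p') * D :=
      Nat.mul_le_mul_right _ (hka ▸ maxN_modify_le hk)
    have hlen : (s'.modify k (· + p')).length = n := by rw [List.length_modify, hs]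
    refine Spec.le (q := 1 + 0) (r := 0) (b := u + (u + (u + 0)))
      (Spec.arith_bind (op := .add) (by omega) (by omega) (by simp only [ArithOp.eval]; omega) ?_)
    simp only [ArithOp.eval]
    refine Spec.bind (q := 0) (r := 0) (q' := 1) (r' := 0)
      (Spec.maxP (by omega) (by omega)) fun m' hm' => ?_
    subst hm'
    refine Spec.arith_bind (op := .mul) (by omega) b5 (by simp only [ArithOp.eval]; omega) ?_
    simp only [ArithOp.eval]
    refine Spec.interpShift (S.query _ _ hlen hmod hB) (Spec.ret ?_)
    obtain ⟨h1, h2⟩ := S.interp_le hlen hmod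
    refine ⟨?_, h1, fun m hm => (h2 m hm).trans hB⟩
    have := S.interp _ _ hlen hmod
    simpa only [dotN_modify hk] using this
  · have hl : Fs.length = n := by rw [← hFs.length_eq, List.length_zipIdx, hs]
    refine ⟨hl, fun k hk => ?_⟩
    have hk' : k < s'.zipIdx.length := by rw [hFs.length_eq]; exact hk
    simpa using hFs.get hk' hk
  obtain ⟨hFl, hFs⟩ := hFs
  refine Spec.bind (q := 0) (Spec.mono (Spec.polySubs (W := W) (K := 2 * P * D) (A := D) (S := P)
    (n := n) (by omega) hh.2 hsP b5
    (by omega) b3 ((Nat.add_le_add_left (Nat.mul_le_mul_left D hpP) _).trans b8) b1) le_rfl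
      (Nat.mul_le_mul_left n hh.1)
      (Nat.add_le_add (Nat.mul_le_mul_right _ hh.1) (Nat.mul_le_mul_left n (Nat.add_le_add
        (Nat.mul_le_mul_right _ hh.1) (collectCost_mono hh.1 le_rfl)))) fun _ h => h)
          fun hs hhs => ?_
  obtain ⟨hhl, hhs⟩ := hhs
  have hhs_len : ∀ k (hk : k < hs.length), hs[k].length ≤ 2 * T := by
    intro k hk
    rw [(hhs k hk).1.2.length_eq]
    exact (card_support_mapDomain_le _ _).trans ((card_support_coeffs_le h).trans hh.1)
  refine Spec.bind (q := 0) (Q := fun gs => gs.length = n ∧ ∀ k (hk : k < gs.length),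
      Terms gs[k] (G.mapDomain fun e => dotN e s' + e.getD k 0 * p') ∧
      gs[k].length ≤ 3 * T ∧ ∀ m ∈ gs[k], m.1 ≤ 2 * P * D)
    (Spec.mono (Spec.mapP_const (q := 0) (r := 5 * T) (b := collectCost (3 * T) u)
      (Q := fun x l => Terms l (coeffs x.1 - coeffs x.2))
      fun x hx => ?_) (by simp) (by simp [hFl, hhl]) (by simp [hFl, hhl])
      fun gs hgs => ?_) fun gs hgs => ?_
  · obtain ⟨k, hk, rfl⟩ := List.getElem_of_mem hx
    rw [List.length_zip] at hk
    rw [List.getElem_zip]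
    have h1 := hFs k (by omega)
    have h2 := hhs_len k (by omega)
    refine Spec.mono (Spec.subU (W := W) (fun m hm => ?_) fun m hm => ?_) le_rfl
      ?_ (collectCost_mono ?_ le_rfl) fun l hl => hl.2
    · exact (h1.2.2 m hm).trans (by omega)
    · exact ((hhs k (by omega)).2 m hm).trans (by omega)
    · have := h1.2.1
      simp only
      omega
    · have := h1.2.1
      simp only
      omega
  · have hl : gs.length = n := by rw [← hgs.length_eq, List.length_zip, hFl, hhl, min_self]
    refine ⟨hl, fun k hk => ?_⟩
    have hk' : k < (Fs.zip hs).length := by rw [hgs.length_eq]; exact hk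
    have h0 := hgs.get hk' hk
    simp only [List.get_eq_getElem, List.getElem_zip] at h0
    have h1 := hFs k (by omega)
    have h2 := hhs k (by omega)
    have h3 : coeffs Fs[k] - coeffs hs[k] =
        G.mapDomain fun e => dotN e s' + e.getD k 0 * p' := by
      rw [h1.1.2.2, h2.1.2.2.2, hG, mapDomain_sub']
    refine ⟨h3 ▸ h0, ?_, fun m hm => ?_⟩
    · rw [h0.length_eq]
      classical
      refine (Finset.card_le_card Finsupp.support_sub).trans ((Finset.card_union_le _ _).trans ?_)
      have h4 := card_support_coeffs_le Fs[k]
      have h5 := card_support_coeffs_le hs[k]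
      have h6 := hhs_len k (by omega)
      have h7 := h1.2.1
      omega
    · classical
      rcases Finset.mem_union.1 (Finsupp.support_sub (h0.mem_iff.1 hm).1) with h4 | h4
      · obtain ⟨m', hm', e⟩ := exists_mem_of_mem_support_coeffs h4
        exact e ▸ h1.2.2 m' hm'
      · obtain ⟨m', hm', e⟩ := exists_mem_of_mem_support_coeffs h4
        exact e ▸ h2.2 m' hm'
  obtain ⟨hgl, hgs⟩ := hgs
  refine Spec.mono (Spec.tsTerms (W := W) (n := n) (m := 3 * T) (S := P) (K := 2 * P * D) hpp.pos
    (by omega) hfms (fun m hm => (hfm_le m hm).trans b1) hfm_len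
    (hfi.2.2.symm ▸ hfi) hfi_le hfi_len hgl (fun g hg => ?_) hsP
    (by omega) b1 b5 b2 S.le_W) le_rfl (Nat.zero_le _) le_rfl ?_
  · obtain ⟨k, hk, rfl⟩ := List.getElem_of_mem hg
    have := hgs k hk
    exact ⟨this.1.2.2.symm ▸ this.1, this.2.2, this.2.1⟩
  rintro g ⟨hg1, hg2⟩
  have hd : ∀ d a, (d, a) ∈ fm → ∃ e ∈ G.support, residue (p' :: s') e = d := fun d a hda =>
    exists_of_mem_support_mapDomain (hfm.mem_iff.1 hda).1
  refine ⟨⟨by simpa using hg1.length_le, ?_⟩, ?_, ?_, ?_⟩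
  · rintro ⟨e, a⟩ hm
    obtain ⟨d, -, -, h3, h4⟩ := (hg2 e a).1 hm
    exact ⟨by rw [← hgl, h3.length_eq], h4⟩
  · exact List.Nodup.sublist hg1 hfms.nodup
  · rintro ⟨e, a⟩ hm
    obtain ⟨d, h1, h2, -, -⟩ := (hg2 e a).1 hm
    obtain ⟨e', he', h3⟩ := hd d a h1
    refine Finset.mem_image.2 ⟨e', he', ?_⟩
    rw [h3, ← h2.2.1]
    rfl
  · intro e he hC
    have huniq : ∀ e' ∈ G.support, residue (p' :: s') e' = residue (p' :: s') e → e' = e :=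
      fun e' he' h' => eq_of_notMem_collided he hC he' h'
    -- all exponents `φ e'` in question are congruent to `⟨e', s⟩` modulo `p`, so a term without
    -- collisions is alone in its class in `f(x^s)` and in all the `f(x^(s + p I_k))`
    have hsingle : ∀ φ : List ℕ → ℕ, (∀ e', φ e' % p' = dotN e' s' % p') →
        IsSingle p' (G.mapDomain φ) (residue (p' :: s') e) (φ e) := by
      intro φ hφ
      refine ⟨?_, hφ e, fun v' hv' hd' => ?_⟩
      · rw [Finsupp.mem_support_iff, mapDomain_apply_of_unique]
        · exact Finsupp.mem_support_iff.1 he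
        · intro e' he' h'
          refine huniq e' he' ?_
          rw [hres, hres, ← hφ, ← hφ, h']
      · obtain ⟨e', he', rfl⟩ := exists_of_mem_support_mapDomain hv'
        rw [huniq e' he' (by rw [hres, ← hφ, hd'])]
    refine (hg2 _ _).2 ⟨residue (p' :: s') e, hfm.mem_iff.2 ⟨?_, ?_⟩, ?_, ?_, (hGkeys e he).2⟩
    · rw [Finsupp.mem_support_iff, mapDomain_apply_of_unique huniq]
      exact Finsupp.mem_support_iff.1 he
    · exact (mapDomain_apply_of_unique huniq).symm
    · rw [hfi.2.2]
      exact hsingle (dotN · s') fun _ => rfl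
    · rw [List.forall₂_iff_get]
      refine ⟨by rw [hgl, (hGkeys e he).1], fun k hk hk' => ?_⟩
      simp only [List.get_eq_getElem]
      rw [(hgs k hk).1.2.2]
      have := hsingle (fun e => dotN e s' + e.getD k 0 * p') fun e' => by
        simp
      rw [List.getD_eq_getElem _ _ hk', mul_comm] at this
      exact this

end HalfPoly

/-! ### HalfPoly as a sequence of parts -/

section Parts

variable {Z : Type} {K : Type u}

/-- The part of `halfPoly` after the random draws. -/
def halfPolyRest (n : ℕ) (h : List (List Z × K)) (T T₁ D : Z) (subs : List (List Z)) :
    Prog Z K (Option (List (List Z × K))) :=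
  (sortP cmpVec subs).bind fun sorted => (dedupSorted cmpVec sorted).bind fun ss =>
  (mapP (fun v => match v with
      | [] => .ret none
      | p :: s => (normP s).bind fun m => (arith .mul m D).bind fun B =>
          Prog.interp s B T fun F => (substU h s).bind fun hs => (subU F hs).bind fun fi =>
          (modU p fi).bind fun fm => (lengthP fm).bind fun c =>
          .ret (some ⟨p, s, fi, fm, c⟩)) ss).bind fun trials =>
  match trials.filterMap id with
  | [] => .ret none
  | t :: ts => (best t ts).bind fun t₀ => (cmp t₀.terms T₁).bind fun o =>
      if o = .gt then .ret none
      else (recover n h T D t₀).bind fun g => .ret (some g)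

/-- The part of `halfPoly` after the computation of the number `l` of draws and of the primes. -/
def halfPolyDraw (n : ℕ) (h : List (List Z × K)) (T T₁ D zero l : Z) (ps : List Z) :
    Prog Z K (Option (List (List Z × K))) :=
  (range zero l).bind fun is => (mapP (fun _ => drawPair n ps) is).bind
    (halfPolyRest n h T T₁ D)

/-- The parameters of `halfPoly`: zero, the number of draws, the lower bound for the primes and the
number of primes. -/
def halfPolyParams (T₁ D : Z) (μ : ℝ) (w : Z) : Prog Z K (Z × Z × Z × Z) :=
  (lit 0).bind fun zero => (lit 1).bind fun one => (lit 31).bind fun c31 =>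
  (lit 32).bind fun c32 =>
  Prog.trials μ w T₁ fun l =>
  (arith .sub T₁ one).bind fun t => (arith .pow D t).bind fun d => (bitlen d).bind fun b =>
  (arith .sub b one).bind fun b' => (arith .mul c31 b').bind fun N₀ =>
  (maxP N₀ one).bind fun N => (arith .mul c32 t).bind fun M => .ret (zero, l, M, N)

theorem halfPoly_eq (n : ℕ) (h : List (List Z × K)) (T T₁ D : Z) (μ : ℝ) (w : Z) :
    halfPoly n h T T₁ D μ w = (halfPolyParams T₁ D μ w).bind fun x =>
      (firstPrimes x.2.2.1 x.2.2.2).bind (halfPolyDraw n h T T₁ D x.1 x.2.1) := rfl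

end Parts

/-- The bit operations of `halfPolyRest` for `l` draws. -/
def restCost (W n T l : ℕ) : ℕ :=
  l * l.size * ((n + 1) * unit W) + l * ((n + 1) * unit W) + l * trialCost W n T + l * unit W +
    unit W + recoverCost W n T

section HalfPoly

variable {R : Type u} [CommRing R] {U : Interpolator R} {V : Query → Prop} {n T D P W : ℕ}
  {F : List ℕ →₀ R}

/-- After the draws, a call of HalfPoly returns at most `T₁` terms, and if one of the substitutions
is good, then the number of terms of the remaining polynomial is halved. The best substitution has
at least as many terms as the good one; this is what `two_mul_card_support_sub_le` needs. -/
theorem Spec.halfPolyRest (S : Setting U V n T D P W F) {h : List (List ℕ × R)}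
    (hh : TermList n D (2 * T) h) {T₁ l : ℕ} (hT₁ : T₁ ≤ T) {subs : List (List ℕ)}
    (hsubs : ∀ v ∈ subs, IsPair n P v) (hl : subs.length ≤ l) :
    Spec U V (halfPolyRest n h T T₁ D subs : Prog ℕ R _) (l + n) (l * (10 * T) + 7 * (n * T))
      (restCost W n T l) fun r =>
        (∀ g, r = some g → TermList n D T₁ g) ∧
        ((F - coeffs h).support.card ≤ T₁ →
          (∃ v ∈ subs, 6 * (collided (F - coeffs h).support (residue v)).card ≤ T₁) →
          ∃ g, r = some g ∧ 2 * (F - coeffs h - coeffs g).support.card ≤ T₁) := by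
  obtain ⟨b1, b2, b3, b4, b5, b6, b7, b8, b9⟩ := S.bounds
  have hT3 := S.three_T_le
  set G := F - coeffs h with hG
  have hpair : ∀ v, IsPair n P v → v.length = n + 1 ∧ ∀ a ∈ v, a ≤ W := by
    rintro v ⟨p, s, rfl, -, hpP, hs, hsp⟩
    refine ⟨by simp [hs], fun a ha => ?_⟩
    rcases List.mem_cons.1 ha with rfl | ha
    · omega
    · have := hsp a ha
      omega
  unfold SparseInterp.halfPolyRest
  refine Spec.mono (q := 0 + (0 + (l + n))) (r := 0 + (0 + (l * (10 * T) + 7 * (n * T))))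
    (b := l * l.size * ((n + 1) * unit W) + (l * ((n + 1) * unit W) +
      (l * trialCost W n T + (l * unit W + (unit W + recoverCost W n T)))))
    (Spec.bind (Q := fun l' => l'.Perm subs) (Spec.mono (Spec.sortP compares_cmpVec
      fun v hv => hpair v (hsubs v hv)) le_rfl le_rfl ?_ fun l' hl' => hl'.1)
      fun sorted hsorted => ?_) (by omega) (by omega) (by unfold restCost; omega) fun _ h => h
  · have := Nat.size_le_size (show subs.length - 1 ≤ l by omega)
    gcongr
  have hsp : ∀ v ∈ sorted, IsPair n P v := fun v hv => hsubs v (hsorted.mem_iff.1 hv)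
  refine Spec.bind (q := 0) (r := 0) (Q := fun l' => l'.length ≤ l ∧ ∀ v, v ∈ l' ↔ v ∈ subs)
    (Spec.mono (Spec.dedupSorted compares_cmpVec fun v hv => hpair v (hsp v hv)) le_rfl le_rfl
      (Nat.mul_le_mul_right _ (hsorted.length_eq.trans_le hl)) fun l' hl' =>
        ⟨hl'.1.trans (hsorted.length_eq.trans_le hl), fun v => (hl'.2 v).trans hsorted.mem_iff⟩)
    fun ss hss => ?_
  obtain ⟨hssl, hss⟩ := hss
  refine Spec.bind (q := l) (r := l * (10 * T)) (q' := n) (r' := 7 * (n * T))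
    (Spec.mono (Spec.mapP_const (q := 1) (r := 10 * T) (b := trialCost W n T)
    (Q := fun v o => ∃ x, o = some x ∧ IsTrial T (2 * P * D) G v x) fun v hv => ?_)
    (by omega) (Nat.mul_le_mul_right _ hssl) (Nat.mul_le_mul_right _ hssl) fun _ h => h)
    fun trials htrials => ?_
  · obtain ⟨p, s, rfl, -, hpP, hs, hsp⟩ := hsubs v ((hss v).1 hv)
    exact Spec.trial S hh hpP hs hsp
  have hmem : ∀ x ∈ trials.filterMap id, ∃ v ∈ subs, IsTrial T (2 * P * D) G v x := by
    intro x hx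
    obtain ⟨o, ho, hox⟩ := List.mem_filterMap.1 hx
    obtain ⟨i, hi, rfl⟩ := List.getElem_of_mem ho
    have hi' : i < ss.length := by rw [htrials.length_eq]; exact hi
    obtain ⟨y, hy, hyt⟩ := htrials.get hi' hi
    simp only [List.get_eq_getElem] at hy hyt
    rw [hy] at hox
    obtain rfl : y = x := by simpa using hox
    exact ⟨_, (hss _).1 (List.getElem_mem _), hyt⟩
  have hmem' : ∀ v ∈ subs, ∃ x ∈ trials.filterMap id, IsTrial T (2 * P * D) G v x := by
    intro v hv
    obtain ⟨i, hi, rfl⟩ := List.getElem_of_mem ((hss v).2 hv)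
    have hi' : i < trials.length := by rw [← htrials.length_eq]; exact hi
    obtain ⟨y, hy, hyt⟩ := htrials.get hi hi'
    simp only [List.get_eq_getElem] at hy hyt
    exact ⟨y, List.mem_filterMap.2 ⟨_, List.getElem_mem hi', hy⟩, hyt⟩
  have hlen : (trials.filterMap id).length ≤ l :=
    (List.length_filterMap_le _ _).trans (htrials.length_eq ▸ hssl)
  generalize trials.filterMap id = ts at hmem hmem' hlen
  cases ts with
  | nil =>
    refine Spec.mono (Spec.ret ⟨by simp, fun _ hgood => ?_⟩) (Nat.zero_le _) (Nat.zero_le _)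
      (Nat.zero_le _) fun _ h => h
    obtain ⟨v, hv, -⟩ := hgood
    obtain ⟨x, hx, -⟩ := hmem' v hv
    simp at hx
  | cons t ts =>
    have hterms : ∀ x ∈ t :: ts, x.terms ≤ W := by
      intro x hx
      obtain ⟨v, -, hv⟩ := hmem x hx
      rw [hv.terms_eq]
      exact hv.fm_length.trans hT3
    refine Spec.mono (q := 0 + n) (r := 0 + 7 * (n * T))
      (Spec.bind (Spec.leB (b' := l * unit W) (Spec.best hterms)
        (Nat.mul_le_mul_right _ (by simp only [List.length_cons] at hlen; omega)))
      fun t₀ ht₀ => Spec.cmp_bind (hterms _ ht₀.1) (by omega) ?_) (by omega) (by omega) le_rfl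
      fun _ h => h
    obtain ⟨v, hv, hx⟩ := hmem t₀ ht₀.1
    split_ifs with hgt
    · rw [compare_gt_iff_gt] at hgt
      refine Spec.mono (Spec.ret ⟨by simp, fun hcard _ => ?_⟩) (Nat.zero_le _) (Nat.zero_le _)
        (Nat.zero_le _) fun _ h => h
      rw [hx.terms_eq, hx.fm_terms.length_eq] at hgt
      have := card_support_mapDomain_le (residue v) G
      omega
    · rw [compare_gt_iff_gt, not_lt, hx.terms_eq] at hgt
      refine Spec.mono (Spec.bind (q' := 0) (r' := 0) (b' := 0)
        (Spec.recover S hh (hsubs v hv) hx) fun g hg => Spec.ret ⟨?_, ?_⟩) le_rfl le_rfl le_rfl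
        fun _ h => h
      · rintro g' hg'
        obtain rfl : g = g' := by simpa using hg'
        exact ⟨hg.1.1.trans hgt, hg.1.2⟩
      · -- compare the chosen substitution with the good one
        rintro - ⟨v', hv', hgood⟩
        obtain ⟨x', hx'm, hx'⟩ := hmem' v' hv'
        refine ⟨g, rfl, two_mul_card_support_sub_le hg.2.2.2 hg.2.1 hg.2.2.1 ?_ hgood⟩
        have h1 := card_le_card_support_mapDomain G (residue v')
        have h2 := ht₀.2 x' hx'm
        rw [hx.terms_eq, hx'.terms_eq, hx.fm_terms.length_eq, hx'.fm_terms.length_eq] at h2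
        omega

/-- A list of primes from which HalfPoly may draw. -/
structure PrimeList (P : ℕ) (ps : List ℕ) : Prop where
  pos : 0 < ps.length
  prime : ∀ p ∈ ps, p.Prime ∧ p ≤ P
  length_le : ps.length ≤ P

theorem Spec.randVec {p n : ℕ} (hp : 0 < p) (hpW : p ≤ W) :
    Spec U V (randVec p n : Prog ℕ R _) 0 0 (n * unit W)
      fun s => s.length = n ∧ ∀ a ∈ s, a < p := by
  induction n with
  | zero => exact Spec.leB (Spec.ret (by simp))
  | succ n ih =>
    refine Spec.leB (b := unit W + (n * unit W + 0)) (Spec.rand hp hpW fun i hi => Spec.bindB ih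
      fun s hs => Spec.ret ?_) (by linarith)
    simp only [List.length_cons, hs.1, List.mem_cons, forall_eq_or_imp, true_and]
    exact ⟨hi, hs.2⟩

theorem Spec.drawPair {ps : List ℕ} (hps : PrimeList P ps) (hPW : P ≤ W) :
    Spec U V (drawPair n ps : Prog ℕ R _) 0 0 ((n + 1) * unit W) (IsPair n P) := by
  refine Spec.leB (b := unit W + (n * unit W + 0)) (Spec.pick hps.pos (hps.length_le.trans hPW)
    (fun x hx => (hps.prime x hx).2.trans hPW) fun p hp => Spec.bindB
    (Spec.randVec (hps.prime p hp).1.pos ((hps.prime p hp).2.trans hPW)) fun s hs => Spec.ret ?_)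
    (by linarith)
  exact ⟨p, s, rfl, (hps.prime p hp).1, (hps.prime p hp).2, hs.1, hs.2⟩

/-- The bit operations of `halfPolyDraw` for at most `l` draws. -/
def drawCost (W n T l : ℕ) : ℕ := (l + 1) * unit W + l * ((n + 1) * unit W) + restCost W n T l

theorem restCost_mono {l l' : ℕ} (h : l ≤ l') : restCost W n T l ≤ restCost W n T l' := by
  unfold restCost
  have := Nat.size_le_size h
  gcongr

theorem Spec.draws {ps : List ℕ} (hps : PrimeList P ps) (hPW : P ≤ W) (l : List ℕ) :
    Spec U V (SparseInterp.mapP (fun _ => SparseInterp.drawPair n ps) l : Prog ℕ R _) 0 0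
      (l.length * ((n + 1) * unit W))
      fun subs => subs.length = l.length ∧ ∀ v ∈ subs, IsPair n P v := by
  refine Spec.mono (Spec.mapP_const (q := 0) (r := 0) fun _ _ => Spec.drawPair hps hPW) (by simp)
    (by simp) le_rfl fun subs hs => ⟨hs.length_eq.symm, fun v hv => ?_⟩
  obtain ⟨i, hi, rfl⟩ := List.getElem_of_mem hv
  have hi' : i < l.length := by rw [hs.length_eq]; exact hi
  simpa using hs.get hi' hi

theorem Spec.halfPolyDraw (S : Setting U V n T D P W F) {h : List (List ℕ × R)}
    (hh : TermList n D (2 * T) h) {T₁ l : ℕ} (hT₁ : T₁ ≤ T) (hl : l ≤ W) {ps : List ℕ}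
    (hps : PrimeList P ps) :
    Spec U V (halfPolyDraw n h T T₁ D 0 l ps : Prog ℕ R _) (l + n)
      (l * (10 * T) + 7 * (n * T)) (drawCost W n T l)
      fun r => ∀ g, r = some g → TermList n D T₁ g := by
  obtain ⟨b1, b2, b3, b4, -⟩ := S.bounds
  unfold SparseInterp.halfPolyDraw
  refine Spec.mono (q := 0 + (l + n)) (r := 0 + (l * (10 * T) + 7 * (n * T)))
    (b := (l - 0 + 1) * unit W + (l * ((n + 1) * unit W) + restCost W n T l))
    (Spec.range_bind (Nat.zero_le _) hl (Spec.bind (Q := fun subs => subs.length = l ∧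
      ∀ v ∈ subs, IsPair n P v) (Spec.mono (Spec.draws (W := W) hps (by omega) _) le_rfl le_rfl
        (by simp)
        fun _ h => by simpa using h) fun subs hsubs => ?_))
    (by omega) (by omega) (by unfold drawCost; rw [Nat.sub_zero]; omega) fun _ h => h
  exact (Spec.halfPolyRest S hh hT₁ hsubs.2 hsubs.1.le).imp fun _ h => h.1

open Classical in
/-- HalfPoly fails to halve the number of missing terms with probability at most `2⁻ˡ`, as the draws
are independent. -/
theorem expect_halfPolyDraw_le (S : Setting U V n T D P W F) {h : List (List ℕ × R)}
    (hh : TermList n D (2 * T) h) {T₁ l : ℕ} (hT₁ : T₁ ≤ T) (hpos : 0 < T₁) (hl : l ≤ W)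
    {ps : List ℕ} (hps : PrimeList P ps) (hnd : ps.Nodup) (hge : ∀ p ∈ ps, 32 * (T₁ - 1) ≤ p)
    (hN : 31 * ((T₁ - 1) * (D.size - 1)) ≤ ps.length)
    (hcard : (F - coeffs h).support.card ≤ T₁) :
    expect U (halfPolyDraw n h T T₁ D 0 l ps : Prog ℕ R _) (fun r =>
      if ∃ g, r = some g ∧ 2 * (F - coeffs h - coeffs g).support.card ≤ T₁ then 0 else 1) ≤
      2⁻¹ ^ l := by
  obtain ⟨b1, b2, b3, b4, -⟩ := S.bounds
  have hkeys : ∀ e ∈ (F - coeffs h).support, e.length = n ∧ ∀ a ∈ e, a ≤ D := by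
    intro e he
    have : e.length = n ∧ e.sum ≤ D := by
      rcases Finset.mem_union.1 (Finsupp.support_sub he) with h1 | h1
      · exact S.keys e h1
      · obtain ⟨m, hm, rfl⟩ := exists_mem_of_mem_support_coeffs h1
        exact hh.2 m hm
    exact ⟨this.1, fun a ha => (List.le_sum_of_mem ha).trans this.2⟩
  unfold halfPolyDraw
  refine Spec.expect_bind_le (Spec.range_bind (k := .ret) (Q := fun is => is.length = l)
    (Nat.zero_le W) hl (Spec.ret (V := V) (by simp))) fun is his => ?_
  rw [expect_bind]
  refine le_trans (Spec.expect_le (Spec.draws (V := V) hps (by omega : P ≤ W) is)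
      fun subs hsubs => ?_)
    (his ▸ expect_mapP_le (B := fun v =>
      T₁ < 6 * (collided (F - coeffs h).support (residue v)).card) fun _ _ => ?_)
  · split_ifs with hbad
    · refine (expect_mono fun r => ?_).trans (expect_const (U := U) _ 1).le
      split_ifs <;> simp
    · push Not at hbad
      refine (Spec.expect_le (Spec.halfPolyRest S hh hT₁ hsubs.2 le_rfl) fun r hr => ?_).trans
        (expect_const (U := U) _ 0).le
      rw [if_pos (hr.2 hcard hbad)]
  · convert expect_bad_le hcard hpos hkeys
      (fun p hp => ⟨(hps.prime p hp).1, hge p hp⟩) hnd hps.pos hN using 4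

end HalfPoly

/-! ### Parameters, tolerance, and the loop of MulPolySI -/

/-- The number of draws in a call of HalfPoly with tolerance `μ / w` and term bound `t`. -/
noncomputable def drawNumber (μ : ℝ) (w t : ℕ) : ℕ := ⌈32 * Real.log (t * (μ / w)⁻¹)⌉₊

theorem drawNumber_mono {μ : ℝ} {w t t' : ℕ} (hμ : 0 < μ) (hw : 0 < w) (ht : 0 < t) (h : t ≤ t') :
    drawNumber μ w t ≤ drawNumber μ w t' := by
  unfold drawNumber
  have h1 : (0 : ℝ) < w := by exact_mod_cast hw
  have h2 : (0 : ℝ) < t := by exact_mod_cast ht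
  have h3 : (t : ℝ) ≤ t' := by exact_mod_cast h
  gcongr

/-- The number of draws is large enough for the tolerance `μ / w`. -/
theorem two_inv_pow_drawNumber_le {μ : ℝ} {w t : ℕ} (hμ : 0 < μ) (hμ1 : μ ≤ 1) (hw : 0 < w)
    (ht : 0 < t) : (2⁻¹ : ℝ≥0∞) ^ drawNumber μ w t ≤ ENNReal.ofReal (μ / w) := by
  have h1 : (1 : ℝ) ≤ w := by exact_mod_cast hw
  have h2 : (1 : ℝ) ≤ t := by exact_mod_cast ht
  have hν : 0 < μ / w := by positivity
  have hν1 : μ / w ≤ 1 := by rw [div_le_one (by linarith)]; linarith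
  have hx : (μ / w)⁻¹ ≤ t * (μ / w)⁻¹ := le_mul_of_one_le_left (by positivity) h2
  have hx1 : 1 ≤ (μ / w)⁻¹ := (one_le_inv₀ hν).2 hν1
  have hlog : 0 ≤ Real.log (t * (μ / w)⁻¹) := Real.log_nonneg (hx1.trans hx)
  have hl : 32 * Real.log (t * (μ / w)⁻¹) ≤ drawNumber μ w t := Nat.le_ceil _
  have key : (2⁻¹ : ℝ) ^ drawNumber μ w t ≤ μ / w := by
    rw [← Real.exp_log (show (0 : ℝ) < 2⁻¹ by norm_num), ← Real.exp_nat_mul, Real.log_inv,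
      ← Real.exp_log hν, Real.exp_le_exp]
    have h3 : -Real.log (μ / w) ≤ Real.log (t * (μ / w)⁻¹) := by
      rw [← Real.log_inv]
      exact Real.log_le_log (by positivity) hx
    have h4 := Real.log_two_gt_d9
    nlinarith
  rw [← ENNReal.ofReal_ofNat 2, ← ENNReal.ofReal_inv_of_pos two_pos, ← ENNReal.ofReal_pow
      (by norm_num)]
  exact ENNReal.ofReal_le_ofReal key

theorem size_pow_le (D t : ℕ) : (D ^ t).size ≤ t * D.size + 1 := by
  rw [Nat.size_le]
  calc D ^ t ≤ (2 ^ D.size) ^ t := Nat.pow_le_pow_left (Nat.lt_size_self D).le t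
    _ = 2 ^ (t * D.size) := by rw [← pow_mul, mul_comm]
    _ < 2 ^ (t * D.size + 1) := Nat.pow_lt_pow_right (by norm_num) (by omega)

theorem mul_size_sub_one_le {D : ℕ} (hD : 0 < D) (t : ℕ) :
    t * (D.size - 1) ≤ (D ^ t).size - 1 := by
  have h1 : 2 ^ (D.size - 1) ≤ D := by
    rw [← Nat.lt_size]
    have : 0 < D.size := Nat.size_pos.2 hD
    omega
  have h2 : t * (D.size - 1) < (D ^ t).size := by
    rw [Nat.lt_size, mul_comm, pow_mul]
    exact Nat.pow_le_pow_left h1 t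
  omega

theorem sieveBound_mono {M M' N N' : ℕ} (hM : M ≤ M') (hN : N ≤ N') :
    sieveBound M N ≤ sieveBound M' N' := by
  unfold sieveBound
  have := Nat.size_le_size (show M + N + 2 ≤ M' + N' + 2 by omega)
  gcongr

theorem le_sieveBound (M N : ℕ) : 16 * (M + N + 2) ≤ sieveBound M N := by
  unfold sieveBound
  exact Nat.le_mul_of_pos_right _ (Nat.size_pos.2 (by omega))

/-- A bound for the primes which are used. -/
def primeBound (T D : ℕ) : ℕ := sieveBound (32 * T) (31 * (T * D.size))

/-- The bit operations for the parameters of HalfPoly, for at most `l` draws. -/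
def paramsCost (W T D l : ℕ) : ℕ :=
  9 * unit W + opCost (2 * W.size + l) + 2 * opCost (D.size + T.size + (T * D.size + 1))

/-- The bit operations of one call of HalfPoly with at most `l` draws. -/
def halfCost (W n T D l : ℕ) : ℕ :=
  paramsCost W T D l + sieveCost (primeBound T D + 1) (primeBound T D) + drawCost W n T l

section HalfPoly

variable {R : Type u} [CommRing R] {U : Interpolator R} {V : Query → Prop} {n T D W : ℕ}
  {F : List ℕ →₀ R} {μ : ℝ}

/-- The cost of this instruction depends on the number of draws itself, not on its bit length. -/
theorem Spec.trials {α : Type v} {w t s q r b : ℕ} {k : ℕ → Prog ℕ R α} {Q : α → Prop}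
    (hs : w.size + t.size + drawNumber μ w t ≤ s)
    (h : Spec U V (k (drawNumber μ w t)) q r b Q) :
    Spec U V (.trials μ w t k) q r (opCost s + b) Q :=
  Spec.le (Spec.map_bits h) le_rfl le_rfl (Nat.add_le_add_right (opCost_mono hs) _)

/-- Arithmetic with integers which may exceed `W`; it is needed for the power `D ^ (T₁ - 1)`. -/
theorem Spec.arith_bind_of_size_le {α : Type v} {op : ArithOp} {x y s q r b : ℕ}
    {k : ℕ → Prog ℕ R α} {Q : α → Prop} (hs : x.size + y.size + (op.eval x y).size ≤ s)
    (h : Spec U V (k (op.eval x y)) q r b Q) :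
    Spec U V ((SparseInterp.arith op x y).bind k) q r (opCost s + b) Q :=
  Spec.le (Spec.map_bits h) le_rfl le_rfl (Nat.add_le_add_right (opCost_mono hs) _)

theorem Spec.bitlen_bind_of_size_le {α : Type v} {x s q r b : ℕ}
    {k : ℕ → Prog ℕ R α} {Q : α → Prop} (hs : x.size ≤ s) (h : Spec U V (k x.size) q r b Q) :
    Spec U V ((SparseInterp.bitlen x).bind k) q r (opCost s + b) Q :=
  Spec.le (Spec.map_bits h) le_rfl le_rfl (Nat.add_le_add_right (opCost_mono hs) _)

theorem Spec.halfPolyParams (S : Setting U V n T D (primeBound T D) W F) {T₁ w : ℕ}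
    (hT₁ : T₁ ≤ T) (hw : w ≤ W) :
    Spec U V (halfPolyParams T₁ D μ w : Prog ℕ R _) 0 0 (paramsCost W T D (drawNumber μ w T₁))
      fun x => x = (0, drawNumber μ w T₁, 32 * (T₁ - 1), max (31 * ((D ^ (T₁ - 1)).size - 1)) 1) := by
  obtain ⟨b1, b2, b3, b4, b5, b6, b7, b8, b9⟩ := S.bounds
  have hT3 := S.three_T_le
  have hP : 16 * (32 * T + 31 * (T * D.size) + 2) ≤ primeBound T D := le_sieveBound _ _
  have hpow := size_pow_le D (T₁ - 1)
  have hle : (T₁ - 1) * D.size ≤ T * D.size := Nat.mul_le_mul_right _ (by omega)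
  have ht := Nat.size_le_size (show T₁ - 1 ≤ T by omega)
  have hwW := Nat.size_le_size hw
  have hTW := Nat.size_le_size (show T₁ ≤ W by omega)
  unfold SparseInterp.halfPolyParams
  refine Spec.leB (b := unit W + (unit W + (unit W + (unit W +
    (opCost (2 * W.size + drawNumber μ w T₁) + (unit W +
    (opCost (D.size + T.size + (T * D.size + 1)) + (opCost (D.size + T.size + (T * D.size + 1)) +
    (unit W + (unit W + (unit W + (unit W + 0)))))))))))) ?_ (by unfold paramsCost; omega)
  refine Spec.lit_bind (by omega) (Spec.lit_bind (by omega) (Spec.lit_bind (by omega)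
    (Spec.lit_bind (by omega) ?_)))
  refine Spec.trials (by omega) (Spec.arith_bind (op := .sub) (by omega) (by omega)
    (by simp only [ArithOp.eval]; omega) ?_)
  simp only [ArithOp.eval]
  refine Spec.arith_bind_of_size_le (op := .pow) (by simp only [ArithOp.eval]; omega)
    (Spec.bitlen_bind_of_size_le (by simp only [ArithOp.eval]; omega) ?_)
  simp only [ArithOp.eval]
  refine Spec.arith_bind (op := .sub) (by omega) (by omega) (by simp only [ArithOp.eval]; omega) ?_
  simp only [ArithOp.eval]
  refine Spec.arith_bind (op := .mul) (by omega) (by omega) (by simp only [ArithOp.eval]; omega) ?_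
  simp only [ArithOp.eval]
  refine Spec.bindB (Spec.maxP (W := W) (by omega) (by omega)) fun N hN => ?_
  refine Spec.arith_bind (op := .mul) (by omega) (by omega) (by simp only [ArithOp.eval]; omega) ?_
  exact Spec.ret (by rw [hN]; rfl)

/-- The primes of one call of HalfPoly. -/
theorem Spec.halfPolyPrimes (S : Setting U V n T D (primeBound T D) W F) {T₁ : ℕ} (hT₁ : T₁ ≤ T) :
    Spec U V (SparseInterp.firstPrimes (32 * (T₁ - 1)) (max (31 * ((D ^ (T₁ - 1)).size - 1)) 1) :
        Prog ℕ R _)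
      0 0 (sieveCost (primeBound T D + 1) (primeBound T D)) fun ps =>
      PrimeList (primeBound T D) ps ∧ ps.Nodup ∧ (∀ p ∈ ps, 32 * (T₁ - 1) ≤ p) ∧
        31 * ((T₁ - 1) * (D.size - 1)) ≤ ps.length := by
  have hpow := size_pow_le D (T₁ - 1)
  have hle : (T₁ - 1) * D.size ≤ T * D.size := Nat.mul_le_mul_right _ (by omega)
  have hpos : 0 < T * D.size := Nat.mul_pos S.T_pos (Nat.size_pos.2 S.D_pos)
  have hN : max (31 * ((D ^ (T₁ - 1)).size - 1)) 1 ≤ 31 * (T * D.size) := by omega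
  have hB : sieveBound (32 * (T₁ - 1)) (max (31 * ((D ^ (T₁ - 1)).size - 1)) 1) ≤
    primeBound T D := sieveBound_mono (by omega) hN
  have hP : 16 * (32 * T + 31 * (T * D.size) + 2) ≤ primeBound T D := le_sieveBound _ _
  refine Spec.mono (Spec.firstPrimes (W := primeBound T D + 1) (by omega)) le_rfl le_rfl ?_
    fun ps hps => ?_
  · unfold sieveCost
    have h1 := Nat.size_le_size hB
    have h2 := Nat.mul_le_mul hB h1
    have h3 := Nat.size_le_size h2
    gcongr
  · obtain ⟨h1, h2, h3⟩ := hps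
    have h4 := mul_size_sub_one_le S.D_pos (T₁ - 1)
    exact ⟨⟨by omega, fun p hp => ⟨(h3 p hp).1, (h3 p hp).2.2.trans hB⟩, by omega⟩, h2,
      fun p hp => (h3 p hp).2.1, by omega⟩

theorem Spec.halfPoly (S : Setting U V n T D (primeBound T D) W F) {h : List (List ℕ × R)}
    (hh : TermList n D (2 * T) h) {T₁ w l : ℕ} (hT₁ : T₁ ≤ T) (hw : w ≤ W)
    (hl : drawNumber μ w T₁ ≤ l) (hlW : l ≤ W) :
    Spec U V (halfPoly n h T T₁ D μ w : Prog ℕ R _) (l + n)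
      (l * (10 * T) + 7 * (n * T)) (halfCost W n T D l)
      fun r => ∀ g, r = some g → TermList n D T₁ g := by
  rw [halfPoly_eq]
  refine Spec.mono (q := 0 + (0 + (l + n))) (r := 0 + (0 + (l * (10 * T) + 7 * (n * T))))
    (b := paramsCost W T D (drawNumber μ w T₁) + (sieveCost (primeBound T D + 1) (primeBound T D) +
      drawCost W n T l))
    (Spec.bind (Spec.halfPolyParams S hT₁ hw) fun x hx => ?_) (by omega) (by omega) ?_
    fun _ h => h
  · subst hx
    refine Spec.bind (Spec.halfPolyPrimes S hT₁) fun ps hps => ?_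
    refine Spec.mono (Spec.halfPolyDraw S hh hT₁ (hl.trans hlW) hps.1) (by omega)
      (Nat.add_le_add_right (Nat.mul_le_mul_right _ hl) _) ?_ fun _ h => h
    unfold drawCost
    have := restCost_mono (W := W) (n := n) (T := T) hl
    gcongr
  · unfold halfCost paramsCost
    have := opCost_mono (show 2 * W.size + drawNumber μ w T₁ ≤ 2 * W.size + l by omega)
    omega

open Classical in
/-- A call of HalfPoly fails to halve the number of missing terms with probability at most
`μ / w`. -/
theorem expect_halfPoly_le (S : Setting U V n T D (primeBound T D) W F) {h : List (List ℕ × R)}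
    (hh : TermList n D (2 * T) h) {T₁ w : ℕ} (hT₁ : T₁ ≤ T) (hpos : 0 < T₁) (hw : w ≤ W)
    (hw0 : 0 < w) (hμ : 0 < μ) (hμ1 : μ ≤ 1) (hl : drawNumber μ w T₁ ≤ W)
    (hcard : (F - coeffs h).support.card ≤ T₁) :
    expect U (halfPoly n h T T₁ D μ w : Prog ℕ R _) (fun r =>
      if ∃ g, r = some g ∧ 2 * (F - coeffs h - coeffs g).support.card ≤ T₁ then 0 else 1) ≤
      ENNReal.ofReal (μ / w) := by
  rw [halfPoly_eq]
  refine Spec.expect_bind_le (Spec.halfPolyParams S hT₁ hw) fun x hx => ?_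
  subst hx
  refine Spec.expect_bind_le (Spec.halfPolyPrimes S hT₁) fun ps hps => ?_
  exact (expect_halfPolyDraw_le S hh hT₁ hpos hl hps.1 hps.2.1 hps.2.2.1 hps.2.2.2 hcard).trans
    (two_inv_pow_drawNumber_le hμ hμ1 hw0 hpos)

/-- The bit operations of one round. -/
def roundCost (W n T D l : ℕ) : ℕ :=
  halfCost W n T D l + collectCost (2 * T) (n * unit W) + 4 * unit W

/-- Adding the new terms keeps the number of terms bounded. -/
theorem Spec.addM_termList (S : Setting U V n T D (primeBound T D) W F) {h g : List (List ℕ × R)}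
    {m T₁ : ℕ} (hh : TermList n D m h) (hg : TermList n D T₁ g) (hm : m + T₁ ≤ 2 * T) :
    Spec U V (SparseInterp.addM h g) 0 (2 * T) (collectCost (2 * T) (n * unit W)) fun l =>
      TermList n D (m + T₁) l ∧ Terms l (coeffs h + coeffs g) := by
  have hD := S.bounds.2.2.2.2.1
  have hlen : h.length + g.length ≤ m + T₁ := Nat.add_le_add hh.1 hg.1
  have hkeys : ∀ {m : ℕ} {l : List (List ℕ × R)}, TermList n D m l →
      ∀ x ∈ l, x.1.length = n ∧ ∀ a ∈ x.1, a ≤ W := fun hl x hx =>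
    ⟨(hl.2 x hx).1, fun a ha => (List.le_sum_of_mem ha).trans ((hl.2 x hx).2.trans hD)⟩
  refine Spec.mono (Spec.addM (hkeys hh) (hkeys hg)) le_rfl (by omega)
    (collectCost_mono (by omega) le_rfl) fun l hl => ⟨⟨?_, fun x hx => ?_⟩, hl.2⟩
  · rw [hl.2.length_eq, ← coeffs_append]
    exact (card_support_coeffs_le _).trans (by rw [List.length_append]; exact hlen)
  · have h2 := hl.2
    rw [← coeffs_append] at h2
    obtain ⟨y, hy, hyx⟩ := h2.key_mem hx
    rw [← hyx]
    rcases List.mem_append.1 hy with hy | hy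
    exacts [hh.2 y hy, hg.2 y hy]

/-- In the loop, `h` has at most `2 T - 2 T₁` terms: at most `T₁` terms are added in a round, and
then `T₁` is at least halved. -/
theorem Spec.rounds (S : Setting U V n T D (primeBound T D) W F) {w l : ℕ} (hμ : 0 < μ)
    (hw0 : 0 < w) (hw : w ≤ W) (hl : drawNumber μ w T ≤ l) (hlW : l ≤ W) (is : List ℕ) :
    ∀ {m T₁ : ℕ} {h : List (List ℕ × R)}, TermList n D m h → m + 2 * T₁ ≤ 2 * T →
    Spec U V (rounds n T D μ w is T₁ h : Prog ℕ R _) (is.length * (l + n))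
      (is.length * (l * (10 * T) + 7 * (n * T) + 2 * T)) (is.length * roundCost W n T D l)
      fun _ => True := by
  have hT3 := S.three_T_le
  have hTp := S.T_pos
  induction is with
  | nil => intro m T₁ h _ _; exact (Spec.ret trivial).le
  | cons i is ih =>
    intro m T₁ h hh hm
    refine Spec.le (q := l + n + is.length * (l + n))
      (r := l * (10 * T) + 7 * (n * T) + (2 * T +
        is.length * (l * (10 * T) + 7 * (n * T) + 2 * T)))
      (b := unit W + (unit W + (halfCost W n T D l + (collectCost (2 * T) (n * unit W) +
        (unit W + (unit W + is.length * roundCost W n T D l))))))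
      (Spec.lit_bind (by omega) (Spec.cmp_bind (by omega) (by omega) ?_))
      (by simp only [List.length_cons]; linarith) (by simp only [List.length_cons]; linarith)
      (by
        simp only [List.length_cons]
        have : halfCost W n T D l + collectCost (2 * T) (n * unit W) + 4 * unit W =
          roundCost W n T D l := rfl
        linarith)
    split_ifs with hpos
    swap
    · exact Spec.le (Spec.ret trivial) (Nat.zero_le _) (Nat.zero_le _) (Nat.zero_le _)
    rw [compare_gt_iff_gt] at hpos
    refine Spec.bind (Spec.halfPoly S ⟨hh.1.trans (by omega), hh.2⟩ (by omega) hw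
      ((drawNumber_mono hμ hw0 hpos (by omega)).trans hl) hlW) fun r hr => ?_
    cases r with
    | none => exact Spec.le (Spec.ret trivial) (Nat.zero_le _) (Nat.zero_le _) (Nat.zero_le _)
    | some g =>
      refine Spec.le (q := 0 + is.length * (l + n)) (Spec.bind
        (Spec.addM_termList S hh (hr g rfl) (by omega)) fun h' hh' =>
        Spec.lit_bind (by omega) (Spec.arith_bind (op := .div) (by omega) (by omega)
          (by simp only [ArithOp.eval]; omega) (ih hh'.1 ?_))) (by omega) le_rfl le_rfl
      simp only [ArithOp.eval]
      omega

open Classical in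
/-- With tolerance `ε` for a single round, `k` rounds fail with probability at most `k ε`. As the
number of missing terms is halved in each round, nothing is missing after the last round. -/
theorem expect_rounds_le (S : Setting U V n T D (primeBound T D) W F) {w l : ℕ} (hμ : 0 < μ)
    (hμ1 : μ ≤ 1) (hw0 : 0 < w) (hw : w ≤ W) (hl : drawNumber μ w T ≤ l) (hlW : l ≤ W)
    (is : List ℕ) :
    ∀ {m T₁ : ℕ} {h : List (List ℕ × R)}, TermList n D m h → m + 2 * T₁ ≤ 2 * T →
      Terms h (coeffs h) → (F - coeffs h).support.card ≤ T₁ → T₁ < 2 ^ is.length →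
    expect U (rounds n T D μ w is T₁ h : Prog ℕ R _)
      (fun r => if ∃ h', r = some h' ∧ Terms h' F then 0 else 1) ≤
      is.length * ENNReal.ofReal (μ / w) := by
  have hT3 := S.three_T_le
  have hTp := S.T_pos
  have hdone : ∀ {h : List (List ℕ × R)}, Terms h (coeffs h) → (F - coeffs h).support.card ≤ 0 →
      ∃ h', some h = some h' ∧ Terms h' F := by
    intro h hh h0
    rw [Nat.le_zero, Finset.card_eq_zero, Finsupp.support_eq_empty, sub_eq_zero] at h0
    exact ⟨h, rfl, h0 ▸ hh⟩
  induction is with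
  | nil =>
    intro m T₁ h _ _ hterms hcard hT₁
    simp only [List.length_nil, pow_zero, Nat.lt_one_iff] at hT₁
    rw [rounds, expect_ret, if_pos (hdone hterms (hT₁ ▸ hcard))]
    exact zero_le
  | cons i is ih =>
    intro m T₁ h hh hm hterms hcard hT₁
    refine Spec.expect_bind_le (Spec.lit (V := V) (Nat.zero_le W)) fun z hz => ?_
    subst hz
    refine Spec.expect_bind_le (Spec.cmp (V := V) (W := W) (by omega) (by omega)) fun o ho => ?_
    subst ho
    split_ifs with hpos
    swap
    · rw [compare_gt_iff_gt, not_lt, Nat.le_zero] at hpos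
      rw [expect_ret, if_pos (hdone hterms (hpos ▸ hcard))]
      exact zero_le
    rw [compare_gt_iff_gt] at hpos
    have hh2 : TermList n D (2 * T) h := ⟨hh.1.trans (by omega), hh.2⟩
    have hl₁ : drawNumber μ w T₁ ≤ l := (drawNumber_mono hμ hw0 hpos (by omega)).trans hl
    rw [expect_bind]
    calc _ ≤ expect U (halfPoly n h T T₁ D μ w) (fun r =>
          (if ∃ g, r = some g ∧ 2 * (F - coeffs h - coeffs g).support.card ≤ T₁ then 0 else 1) +
            is.length * ENNReal.ofReal (μ / w)) := ?_
      _ ≤ ENNReal.ofReal (μ / w) + is.length * ENNReal.ofReal (μ / w) := by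
        rw [expect_add, expect_const]
        gcongr
        exact expect_halfPoly_le S hh2 (by omega) hpos hw hw0 hμ hμ1 (hl₁.trans hlW) hcard
      _ = _ := by
        rw [List.length_cons, Nat.cast_succ, add_mul, one_mul, add_comm]
    refine (Spec.halfPoly S hh2 (by omega) hw hl₁ hlW).expect_le fun r hr => ?_
    split_ifs with hgood
    · obtain ⟨g, rfl, hg⟩ := hgood
      rw [zero_add]
      refine Spec.expect_bind_le (Spec.addM_termList S hh (hr g rfl) (by omega)) fun h' hh' => ?_
      refine Spec.expect_bind_le (Spec.lit (V := V) (c := 2) (W := W) (by omega)) fun z hz => ?_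
      subst hz
      refine Spec.expect_bind_le (Spec.arith (V := V) (op := .div) (W := W) (by omega) (by omega)
        (by simp only [ArithOp.eval]; omega)) fun z hz => ?_
      subst hz
      simp only [ArithOp.eval]
      refine ih hh'.1 (by omega) (hh'.2.2.2.symm ▸ hh'.2) ?_ ?_
      · rw [hh'.2.2.2, ← sub_sub]
        omega
      · rw [List.length_cons, pow_succ] at hT₁
        omega
    · refine le_trans ((expect_mono fun r => ?_).trans (expect_const (U := U) _ 1).le)
        le_self_add
      split_ifs <;> simp

/-- The number of rounds. -/
def roundNumber (T : ℕ) : ℕ := (T - 1).size + 1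

theorem lt_two_pow_roundNumber (T : ℕ) : T < 2 ^ roundNumber T := by
  have := Nat.lt_size_self (T - 1)
  unfold roundNumber
  rw [pow_succ]
  omega

theorem roundNumber_le {T : ℕ} (hT : 0 < T) : roundNumber T ≤ T := by
  have : (T - 1).size ≤ T - 1 := Nat.size_le.2 Nat.lt_two_pow_self
  unfold roundNumber
  omega

theorem termList_nil {R : Type u} {n D : ℕ} : TermList n D 0 ([] : List (List ℕ × R)) :=
  ⟨le_rfl, by simp⟩

/-- The worst-case costs of MulPolySI. -/
theorem Spec.mulPolySI (S : Setting U V n T D (primeBound T D) W F) (hμ : 0 < μ)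
    (hl : drawNumber μ (roundNumber T) T ≤ W) :
    Spec U V (mulPolySI n T D μ : Prog ℕ R _)
      (roundNumber T * (drawNumber μ (roundNumber T) T + n))
      (roundNumber T * (drawNumber μ (roundNumber T) T * (10 * T) + 7 * (n * T) + 2 * T))
      ((roundNumber T + 6) * unit W +
        roundNumber T * roundCost W n T D (drawNumber μ (roundNumber T) T))
      fun _ => True := by
  have hT3 := S.three_T_le
  have hTp := S.T_pos
  have hrT := roundNumber_le hTp
  have hr0 : 0 < roundNumber T := Nat.succ_pos _
  have hr : (T - 1).size + 1 = roundNumber T := rfl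
  refine Spec.le (b := unit W + (unit W + (unit W + (unit W + (unit W +
    ((roundNumber T - 0 + 1) * unit W +
    roundNumber T * roundCost W n T D (drawNumber μ (roundNumber T) T)))))))
    (Spec.lit_bind (by omega) (Spec.lit_bind (by omega) (Spec.arith_bind (op := .sub) (by omega)
    (by omega) (by simp only [ArithOp.eval]; omega) (Spec.bitlen_bind
    (by simp only [ArithOp.eval]; omega) (Spec.arith_bind (op := .add)
    (by simp only [ArithOp.eval]; omega) (by omega) (by simp only [ArithOp.eval]; omega)
    (Spec.range_bind (Nat.zero_le _) (by simp only [ArithOp.eval]; omega) ?_))))))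
    le_rfl le_rfl (by rw [Nat.sub_zero]; linarith)
  simp only [ArithOp.eval, hr]
  have := Spec.rounds S hμ hr0 (by omega) le_rfl hl (List.range' 0 (roundNumber T - 0))
    termList_nil (T₁ := T) (by omega)
  simpa using this

open Classical in
/-- MulPolySI fails with probability at most `μ`. -/
theorem expect_mulPolySI_le (S : Setting U V n T D (primeBound T D) W F) (hμ : 0 < μ) (hμ1 : μ ≤ 1)
    (hl : drawNumber μ (roundNumber T) T ≤ W) :
    expect U (mulPolySI n T D μ : Prog ℕ R _)
      (fun r => if ∃ h', r = some h' ∧ Terms h' F then 0 else 1) ≤ ENNReal.ofReal μ := by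
  have hT3 := S.three_T_le
  have hTp := S.T_pos
  have hrT := roundNumber_le hTp
  have hr0 : 0 < roundNumber T := Nat.succ_pos _
  have hr : (T - 1).size + 1 = roundNumber T := rfl
  refine Spec.expect_bind_le (Spec.lit (V := V) (Nat.zero_le W)) fun z hz => ?_
  subst hz
  refine Spec.expect_bind_le (Spec.lit (V := V) (c := 1) (W := W) (by omega)) fun z hz => ?_
  subst hz
  refine Spec.expect_bind_le (Spec.arith (V := V) (op := .sub) (W := W) (by omega) (by omega)
    (by simp only [ArithOp.eval]; omega)) fun z hz => ?_
  subst hz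
  simp only [ArithOp.eval]
  refine Spec.expect_bind_le (Spec.bitlen_bind (k := .ret) (Q := fun z => z = (T - 1).size)
    (W := W) (by omega) (Spec.ret (V := V) rfl)) fun z hz => ?_
  subst hz
  refine Spec.expect_bind_le (Spec.arith (V := V) (op := .add) (W := W) (by omega) (by omega)
    (by simp only [ArithOp.eval]; omega)) fun z hz => ?_
  subst hz
  simp only [ArithOp.eval, hr]
  refine Spec.expect_bind_le (Spec.range_bind (k := .ret) (W := W)
    (Q := fun is => is = List.range' 0 (roundNumber T - 0)) (by omega) (by omega)
    (Spec.ret (V := V) rfl)) fun z hz => ?_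
  subst hz
  refine (expect_rounds_le S hμ hμ1 hr0 (by omega) le_rfl hl _ termList_nil (T₁ := T) (by omega)
    ⟨by simp, by simp, rfl⟩ (by simpa using S.card)
    (by simpa using lt_two_pow_roundNumber T)).trans ?_
  have h1 : (0 : ℝ) < roundNumber T := by exact_mod_cast hr0
  rw [List.length_range', Nat.sub_zero, ← ENNReal.ofReal_natCast,
    ← ENNReal.ofReal_mul h1.le, mul_div_cancel₀ _ h1.ne']

end HalfPoly

/-! ### Multivariate polynomials -/

section Polynomials

variable {R : Type u} [CommRing R] {n : ℕ}

/-- The coefficient function of a multivariate polynomial, with exponent vectors written as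
lists. -/
noncomputable def mvCoeffs (f : MvPolynomial (Fin n) R) : List ℕ →₀ R :=
  coeffs (f.support.toList.map fun e : Fin n →₀ ℕ => (List.ofFn fun i => e i, f.coeff e))

theorem mem_support_mvCoeffs {f : MvPolynomial (Fin n) R} {e : List ℕ}
    (he : e ∈ (mvCoeffs f).support) : e.length = n ∧ e.sum ≤ f.totalDegree := by
  obtain ⟨m, hm, rfl⟩ := exists_mem_of_mem_support_coeffs he
  obtain ⟨e, he', rfl⟩ := List.mem_map.1 hm
  refine ⟨List.length_ofFn, ?_⟩
  rw [List.sum_ofFn, ← Finsupp.sum_fintype e (fun _ a => a) fun _ => rfl]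
  exact MvPolynomial.le_totalDegree (Finset.mem_toList.1 he')

theorem card_support_mvCoeffs_le (f : MvPolynomial (Fin n) R) :
    (mvCoeffs f).support.card ≤ f.support.card :=
  (card_support_coeffs_le _).trans (by simp)

theorem coeff_sum_monomial (l : List (ℕ × R)) (k : ℕ) :
    (l.map fun m => Polynomial.monomial m.1 m.2).sum.coeff k = coeffs l k := by
  induction l with
  | nil => simp
  | cons m l ih =>
    rw [List.map_cons, List.sum_cons, Polynomial.coeff_add, ih, coeffs_cons, Finsupp.add_apply,
      Polynomial.coeff_monomial, Finsupp.single_apply]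

theorem dotN_ofFn (e : Fin n → ℕ) {s : List ℕ} (hs : s.length = n) :
    dotN (List.ofFn e) s = ∑ i : Fin n, s.getD i 0 * e i := by
  have h : List.zipWith (· * ·) (List.ofFn e) s = List.ofFn fun i : Fin n => s.getD i 0 * e i := by
    refine List.ext_getElem (by simp [hs]) fun i h1 h2 => ?_
    have hi : i < s.length := by simpa [hs] using h2
    simp only [List.getElem_zipWith, List.getElem_ofFn, List.getD_eq_getElem _ _ hi]
    exact Nat.mul_comm _ _
  rw [dotN, h, List.sum_ofFn]

/-- The substitution in terms of coefficient functions. -/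
theorem coeff_kron (f : MvPolynomial (Fin n) R) {s : List ℕ} (hs : s.length = n) (k : ℕ) :
    (kron f s).coeff k = (mvCoeffs f).mapDomain (dotN · s) k := by
  rw [mvCoeffs, ← coeffs_map, ← coeff_sum_monomial]
  congr 1
  rw [List.map_map, List.map_map, kron, MvPolynomial.aeval_def, MvPolynomial.eval₂_eq',
    ← Finset.sum_map_toList]
  congr 1
  refine List.map_congr_left fun e _ => ?_
  simp only [Function.comp, dotN_ofFn e hs, ← pow_mul]
  rw [Finset.prod_pow_eq_pow_sum, ← Polynomial.C_mul_X_pow_eq_monomial]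
  rfl

theorem support_kron (f : MvPolynomial (Fin n) R) {s : List ℕ} (hs : s.length = n) :
    (kron f s).support = ((mvCoeffs f).mapDomain (dotN · s)).support := by
  ext k
  rw [Polynomial.mem_support_iff, Finsupp.mem_support_iff, coeff_kron f hs]

theorem ListsTerms.terms {f : MvPolynomial (Fin n) R} {s : List ℕ} (hs : s.length = n)
    {l : List (ℕ × R)} (h : ListsTerms l (kron f s)) :
    Terms l ((mvCoeffs f).mapDomain (dotN · s)) := by
  refine ⟨h.1, h.2.1, Finsupp.ext fun k => ?_⟩
  rw [← coeff_kron f hs, ← h.2.2, coeff_sum_monomial]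

/-- The multivariate polynomial with a given list of terms depends on the coefficient function
only. -/
theorem sum_monomial_eq (l : List (List ℕ × R)) :
    (l.map fun m => MvPolynomial.monomial
      (Finsupp.equivFunOnFinite.symm fun i : Fin n => m.1.getD i 0) m.2).sum =
    (coeffs l).sum fun e a => MvPolynomial.monomial
      (Finsupp.equivFunOnFinite.symm fun i : Fin n => e.getD i 0) a := by
  induction l with
  | nil => simp
  | cons m l ih =>
    rw [List.map_cons, List.sum_cons, ih, coeffs_cons, Finsupp.sum_add_index',
        Finsupp.sum_single_index]
    · simp
    · simp
    · intro e a b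
      rw [map_add]

theorem Terms.represents {f : MvPolynomial (Fin n) R} {l : List (List ℕ × R)}
    (h : Terms l (mvCoeffs f)) : Represents l f := by
  refine ⟨h.1, fun m hm => ⟨(mem_support_mvCoeffs (h.mem_iff.1 hm).1).1, h.2.1 m hm⟩, ?_⟩
  rw [sum_monomial_eq, h.2.2, mvCoeffs, ← sum_monomial_eq, List.map_map]
  conv_rhs => rw [f.as_sum, ← Finset.sum_map_toList]
  congr 1
  refine List.map_congr_left fun e _ => ?_
  simp only [Function.comp]
  congr 1
  ext i
  simp

end Polynomials

/-- The conditions on the univariate interpolations which are guaranteed. -/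
def ValidQuery {R : Type u} [CommRing R] {n : ℕ} (f : MvPolynomial (Fin n) R) (T D : ℕ)
    (q : Query) : Prop :=
  q.exps.length = n ∧ (kron f q.exps).natDegree ≤ q.degBound ∧
    q.degBound ≤ 2 * primeBound T D * D ∧ (kron f q.exps).support.card ≤ q.termBound ∧
    q.termBound ≤ T

/-- A bound for the integers of the computation. -/
noncomputable def wordBound (n T D : ℕ) (μ : ℝ) : ℕ :=
  n * (2 * primeBound T D * D * primeBound T D) + 3 * T + drawNumber μ (roundNumber T) T

/-- The hypotheses on `f` and on the interpolation procedure imply the standing assumptions. -/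
theorem setting {R : Type u} [CommRing R] {n T D : ℕ} {μ : ℝ} {f : MvPolynomial (Fin n) R}
    {U : Interpolator R} (hn : 0 < n) (hT : 0 < T) (hD : 0 < D) (hfT : f.support.card ≤ T)
    (hfD : f.totalDegree ≤ D) (hU : Interpolates U f) :
    Setting U (ValidQuery f T D) n T D (primeBound T D) (wordBound n T D μ) (mvCoeffs f) := by
  have hdeg : ∀ s B, s.length = n → maxN s * D ≤ B → (kron f s).natDegree ≤ B := by
    intro s B hs hB
    refine Polynomial.natDegree_le_iff_coeff_eq_zero.2 fun k hk => ?_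
    by_contra hne
    rw [coeff_kron f hs] at hne
    obtain ⟨e, he, rfl⟩ := exists_of_mem_support_mapDomain (Finsupp.mem_support_iff.2 hne)
    have h1 := dotN_le_of_keys ((mem_support_mvCoeffs he).2.trans hfD) hB
    omega
  have hsupp : ∀ s, s.length = n → (kron f s).support.card ≤ T := by
    intro s hs
    rw [support_kron f hs]
    exact (card_support_mapDomain_le _ _).trans ((card_support_mvCoeffs_le f).trans hfT)
  exact
    { n_pos := hn
      T_pos := hT
      D_pos := hD
      le_P := by
        have h1 : 16 * (32 * T + 31 * (T * D.size) + 2) ≤ primeBound T D := le_sieveBound _ _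
        omega
      le_W := by unfold wordBound; omega
      three_T_le := by unfold wordBound; omega
      keys := fun e he => ⟨(mem_support_mvCoeffs he).1, (mem_support_mvCoeffs he).2.trans hfD⟩
      card := (card_support_mvCoeffs_le f).trans hfT
      interp := fun s B hs hB => (hU s B T hs (hdeg s B hs hB) (hsupp s hs)).terms hs
      query := fun s B hs hB hB' => ⟨hs, hdeg s B hs hB, hB', hsupp s hs, le_rfl⟩ }

/-- An event is as probable as its complement is improbable. -/
theorem ofReal_one_sub_le {R : Type u} [CommRing R] {α : Type v} {U : Interpolator R}
    {p : Prog ℕ R α} {A : α → Prop} [DecidablePred A] {μ : ℝ} (hμ : 0 ≤ μ)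
    (h : expect U p (fun a => if A a then 0 else 1) ≤ ENNReal.ofReal μ) :
    ENNReal.ofReal (1 - μ) ≤ (run U p).toOuterMeasure {x | A x.1} := by
  have h1 : (run U p).toOuterMeasure {x | A x.1} = expect U p fun a => if A a then 1 else 0 := by
    rw [PMF.toOuterMeasure_apply]
    refine tsum_congr fun x => ?_
    by_cases hx : A x.1 <;> simp [Set.indicator, hx]
  have h2 : (1 : ℝ≥0∞) = expect U p (fun a => if A a then 1 else 0) +
      expect U p fun a => if A a then 0 else 1 := by
    rw [← expect_add]
    refine (expect_const (U := U) p 1).symm.trans (congrArg _ (funext fun a => ?_))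
    split_ifs <;> simp
  rw [h1, ENNReal.ofReal_sub _ hμ, ENNReal.ofReal_one, tsub_le_iff_right]
  exact h2.le.trans (by gcongr)

/-- MulPolySI returns `f` with probability at least `1 - μ`. -/
theorem ofReal_le_toOuterMeasure {R : Type u} [CommRing R] {n T D : ℕ} {μ : ℝ}
    {f : MvPolynomial (Fin n) R} {U : Interpolator R} (hn : 0 < n) (hT : 0 < T) (hD : 0 < D)
    (hμ : 0 < μ) (hμ1 : μ < 1) (hfT : f.support.card ≤ T) (hfD : f.totalDegree ≤ D)
    (hU : Interpolates U f) :
    ENNReal.ofReal (1 - μ) ≤ (run U (mulPolySI n T D μ)).toOuterMeasure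
      {x | ∃ h, x.1 = some h ∧ Represents h f} := by
  classical
  refine (ofReal_one_sub_le hμ.le (expect_mulPolySI_le (setting (μ := μ) hn hT hD hfT hfD hU) hμ
    hμ1.le (by unfold wordBound; omega))).trans (MeasureTheory.measure_mono ?_)
  rintro x ⟨h, hx, hh⟩
  exact ⟨h, hx, hh.represents⟩

/-! ### Asymptotic bounds -/

theorem one_le_lg (x : ℝ) : 1 ≤ lg x := le_max_left _ _

theorem lg_pos (x : ℝ) : 0 < lg x := zero_lt_one.trans_le (one_le_lg x)

theorem lg_mono {x y : ℝ} (hx : 0 < x) (h : x ≤ y) : lg x ≤ lg y :=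
  max_le_max le_rfl (Real.logb_le_logb_of_le one_lt_two hx h)

theorem lg_mul_le {x y : ℝ} (hx : 0 < x) (hy : 0 < y) : lg (x * y) ≤ lg x + lg y := by
  have h1 : Real.logb 2 x ≤ lg x := le_max_right _ _
  have h2 : Real.logb 2 y ≤ lg y := le_max_right _ _
  refine max_le (by linarith [one_le_lg x, lg_pos y]) ?_
  rw [Real.logb_mul hx.ne' hy.ne']
  linarith

theorem lg_pow_le {x : ℝ} (hx : 0 < x) (k : ℕ) : lg (x ^ k) ≤ (k + 1) * lg x := by
  induction k with
  | zero =>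
    have : lg 1 = 1 := by simp [lg]
    simpa [this] using one_le_lg x
  | succ k ih =>
    rw [pow_succ]
    have := lg_mul_le (pow_pos hx k) hx
    push_cast
    linarith

theorem log_le_lg {x : ℝ} (hx : 1 ≤ x) : Real.log x ≤ lg x := by
  have h1 : Real.log x ≤ Real.logb 2 x := by
    rw [Real.logb, le_div_iff₀ (Real.log_pos one_lt_two)]
    have h2 := Real.log_two_lt_d9
    nlinarith [Real.log_nonneg hx]
  exact h1.trans (le_max_right _ _)

theorem lg_le_self {x : ℝ} (hx : 1 ≤ x) : lg x ≤ 2 * x := by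
  refine max_le (by linarith) ?_
  rw [Real.logb, div_le_iff₀ (Real.log_pos one_lt_two)]
  have h1 := Real.log_two_gt_d9
  have h2 := Real.log_le_sub_one_of_pos (by linarith : 0 < x)
  nlinarith

theorem size_le_two_mul_lg (x : ℕ) : (x.size : ℝ) ≤ 2 * lg x := by
  rcases Nat.eq_zero_or_pos x with rfl | hx
  · rw [Nat.size_zero, Nat.cast_zero]
    linarith [lg_pos 0]
  · have hs : 0 < x.size := Nat.size_pos.2 hx
    have h1 : 2 ^ (x.size - 1) ≤ x := by rw [← Nat.lt_size]; omega
    have h2 : ((x.size - 1 : ℕ) : ℝ) ≤ Real.logb 2 x := by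
      rw [Real.le_logb_iff_rpow_le one_lt_two (by exact_mod_cast hx), Real.rpow_natCast]
      exact_mod_cast h1
    rw [Nat.cast_pred hs] at h2
    have h3 : Real.logb 2 x ≤ lg x := le_max_right _ _
    linarith [one_le_lg (x : ℝ)]

/-- The parameters on which the bounds depend. -/
structure Instance where
  n : ℕ
  T : ℕ
  D : ℕ
  μ : ℝ
  n_pos : 0 < n
  T_pos : 0 < T
  μ_pos : 0 < μ
  μ_lt : μ < 1

/-- The bound `n T log D log (1/μ)`. -/
noncomputable def Instance.bound (x : Instance) : ℝ := x.n * x.T * lg x.D * lg (1 / x.μ)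

/-- The monomial `n^a T^b (log D)^e (log (1/μ))^k`. -/
noncomputable def Instance.mono (x : Instance) (a b e k : ℕ) : ℝ :=
  x.n ^ a * x.T ^ b * lg x.D ^ e * lg (1 / x.μ) ^ k

/-- `f` is bounded by the monomial with exponents `a, b, e, k`, up to a constant and a power of the
logarithm of `n T log D log (1/μ)`. -/
def Soft (f : Instance → ℕ) (a b e k : ℕ) : Prop :=
  ∃ C c : ℕ, ∀ x, (f x : ℝ) ≤ C * x.mono a b e k * lg x.bound ^ c

theorem Instance.one_le (x : Instance) :
    (1 : ℝ) ≤ x.n ∧ (1 : ℝ) ≤ x.T ∧ 1 ≤ lg x.D ∧ 1 ≤ lg (1 / x.μ) :=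
  ⟨by exact_mod_cast x.n_pos, by exact_mod_cast x.T_pos, one_le_lg _, one_le_lg _⟩

theorem Instance.mono_le (x : Instance) {a b e k a' b' e' k' : ℕ} (ha : a ≤ a') (hb : b ≤ b')
    (he : e ≤ e') (hk : k ≤ k') : x.mono a b e k ≤ x.mono a' b' e' k' := by
  obtain ⟨h1, h2, h3, h4⟩ := x.one_le
  unfold Instance.mono
  have := zero_lt_one.trans_le h3
  have := zero_lt_one.trans_le h4
  gcongr

theorem Instance.mono_zero (x : Instance) : x.mono 0 0 0 0 = 1 := by simp [Instance.mono]

theorem Instance.one_le_mono (x : Instance) (a b e k : ℕ) : 1 ≤ x.mono a b e k :=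
  x.mono_zero ▸ x.mono_le (Nat.zero_le _) (Nat.zero_le _) (Nat.zero_le _) (Nat.zero_le _)

theorem Instance.bound_eq (x : Instance) : x.bound = x.mono 1 1 1 1 := by
  simp [Instance.mono, Instance.bound]

theorem Instance.mono_le_pow (x : Instance) (a b e k : ℕ) :
    x.mono a b e k ≤ x.bound ^ (a + b + e + k) := by
  have h : x.bound ^ (a + b + e + k) = x.mono (a + b + e + k) (a + b + e + k) (a + b + e + k)
      (a + b + e + k) := by
    simp only [Instance.mono, Instance.bound, mul_pow]
  rw [h]
  exact x.mono_le (by omega) (by omega) (by omega) (by omega)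

theorem Instance.one_le_bound (x : Instance) : 1 ≤ x.bound := x.bound_eq ▸ x.one_le_mono 1 1 1 1

section Soft

variable {f g : Instance → ℕ} {a b e k a' b' e' k' : ℕ}

theorem Soft.of_le (h : Soft g a b e k) (hf : ∀ x, f x ≤ g x) : Soft f a b e k := by
  obtain ⟨C, c, h⟩ := h
  exact ⟨C, c, fun x => le_trans (by exact_mod_cast hf x) (h x)⟩

theorem Soft.le (h : Soft f a b e k) (ha : a ≤ a' := by decide) (hb : b ≤ b' := by decide)
    (he : e ≤ e' := by decide) (hk : k ≤ k' := by decide) : Soft f a' b' e' k' := by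
  obtain ⟨C, c, h⟩ := h
  refine ⟨C, c, fun x => (h x).trans ?_⟩
  have := x.mono_le ha hb he hk
  have := lg_pos x.bound
  gcongr

theorem Soft.add (h : Soft f a b e k) (h' : Soft g a' b' e' k') :
    Soft (fun x => f x + g x) (max a a') (max b b') (max e e') (max k k') := by
  obtain ⟨C, c, h⟩ := h.le (le_max_left a a') (le_max_left b b') (le_max_left e e')
    (le_max_left k k')
  obtain ⟨C', c', h'⟩ := h'.le (le_max_right a a') (le_max_right b b') (le_max_right e e')
    (le_max_right k k')
  refine ⟨C + C', max c c', fun x => ?_⟩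
  have h1 := x.one_le_mono (max a a') (max b b') (max e e') (max k k')
  set M := x.mono (max a a') (max b b') (max e e') (max k k')
  have h2 := one_le_lg x.bound
  have h3 : lg x.bound ^ c ≤ lg x.bound ^ max c c' := pow_le_pow_right₀ h2 (le_max_left _ _)
  have h4 : lg x.bound ^ c' ≤ lg x.bound ^ max c c' := pow_le_pow_right₀ h2 (le_max_right _ _)
  push_cast
  calc (f x : ℝ) + g x ≤ C * M * lg x.bound ^ c + C' * M * lg x.bound ^ c' :=
          add_le_add (h x) (h' x)
    _ ≤ C * M * lg x.bound ^ max c c' + C' * M * lg x.bound ^ max c c' := by gcongr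
    _ = _ := by ring

theorem Soft.mul (h : Soft f a b e k) (h' : Soft g a' b' e' k') :
    Soft (fun x => f x * g x) (a + a') (b + b') (e + e') (k + k') := by
  obtain ⟨C, c, h⟩ := h
  obtain ⟨C', c', h'⟩ := h'
  refine ⟨C * C', c + c', fun x => ?_⟩
  have h1 := x.one_le_mono a b e k
  have h2 := lg_pos x.bound
  push_cast
  calc (f x : ℝ) * g x ≤ (C * x.mono a b e k * lg x.bound ^ c) *
        (C' * x.mono a' b' e' k' * lg x.bound ^ c') := by
        refine mul_le_mul (h x) (h' x) (by positivity) (by positivity)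
    _ = _ := by simp only [Instance.mono, pow_add]; ring

theorem Soft.const (m : ℕ) : Soft (fun _ => m) 0 0 0 0 :=
  ⟨m, 0, fun x => by simp [x.mono_zero]⟩

/-- Bit lengths of quantities of polynomial size are polylogarithmic. -/
theorem Soft.size (h : Soft f a b e k) : Soft (fun x => (f x).size) 0 0 0 0 := by
  obtain ⟨C, c, h⟩ := h
  have key : ∀ x : Instance, ((f x).size : ℝ) ≤
      2 * (lg (C + 1) + (a + b + e + k + 1) + (c + 1) * 2) * lg x.bound := by
    intro x
    have h1 := x.one_le_bound
    have h2 := one_le_lg x.bound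
    have h3 := x.one_le_mono a b e k
    have hC : (0 : ℝ) < C + 1 := by positivity
    have hle : (f x : ℝ) + 1 ≤ (C + 1) * x.bound ^ (a + b + e + k) * lg x.bound ^ c := by
      have h4 := x.mono_le_pow a b e k
      have h5 : 1 ≤ x.mono a b e k * lg x.bound ^ c := one_le_mul_of_one_le_of_one_le h3
        (one_le_pow₀ h2)
      calc (f x : ℝ) + 1 ≤ C * x.mono a b e k * lg x.bound ^ c +
            x.mono a b e k * lg x.bound ^ c := add_le_add (h x) h5
        _ = (C + 1) * x.mono a b e k * lg x.bound ^ c := by ring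
        _ ≤ _ := by gcongr
    have h4 : lg (f x + 1 : ℝ) ≤ lg (C + 1) + (a + b + e + k + 1) * lg x.bound +
        (c + 1) * (2 * lg x.bound) := by
      refine (lg_mono (by positivity) hle).trans ((lg_mul_le (by positivity) (by positivity)).trans
        (add_le_add ((lg_mul_le hC (by positivity)).trans (add_le_add le_rfl ?_)) ?_))
      · have := lg_pow_le (zero_lt_one.trans_le h1) (a + b + e + k)
        push_cast at this
        exact this
      · refine (lg_pow_le (zero_lt_one.trans_le h2) c).trans ?_
        gcongr
        exact lg_le_self h2
    have h5 : ((f x).size : ℝ) ≤ 2 * lg (f x + 1 : ℝ) := by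
      have h6 := size_le_two_mul_lg (f x + 1)
      have h7 : ((f x).size : ℝ) ≤ ((f x + 1).size : ℝ) := by
        exact_mod_cast Nat.size_le_size (Nat.le_succ _)
      push_cast at h6
      linarith
    have h8 : lg (C + 1) ≤ lg (C + 1) * lg x.bound := le_mul_of_one_le_right (lg_pos _).le h2
    linarith
  refine ⟨⌈2 * (lg (C + 1) + (a + b + e + k + 1) + (c + 1) * 2)⌉₊, 1, fun x => (key x).trans ?_⟩
  rw [x.mono_zero, mul_one, pow_one]
  have := lg_pos x.bound
  gcongr
  exact Nat.le_ceil _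

theorem Soft.opCost (h : Soft f a b e k) : Soft (fun x => opCost (f x)) a b e k := by
  have h1 := (h.add (Soft.const 1)).mul
    ((h.size.add (Soft.const 1)).mul (h.size.add (Soft.const 1)))
  simp only [Nat.max_zero, Nat.add_zero] at h1
  exact h1.of_le fun x => (by unfold SparseInterp.opCost; rw [pow_two])

theorem Soft.n : Soft Instance.n 1 0 0 0 := ⟨1, 0, fun x => by simp [Instance.mono]⟩

theorem Soft.T : Soft Instance.T 0 1 0 0 := ⟨1, 0, fun x => by simp [Instance.mono]⟩

theorem Soft.size_D : Soft (fun x => x.D.size) 0 0 1 0 :=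
  ⟨2, 0, fun x => by simpa [Instance.mono] using size_le_two_mul_lg x.D⟩

end Soft

/-! ### The number of rounds and of draws -/

theorem roundNumber_le_lg (T : ℕ) : (roundNumber T : ℝ) ≤ 3 * lg T := by
  have h1 := size_le_two_mul_lg (T - 1)
  have h2 : lg (T - 1 : ℕ) ≤ lg T := by
    rcases Nat.eq_zero_or_pos (T - 1) with h | h
    · rw [h, Nat.cast_zero]
      simp [lg]
    · exact lg_mono (by exact_mod_cast h) (by exact_mod_cast Nat.sub_le _ _)
  unfold roundNumber
  push_cast
  linarith [one_le_lg T]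

/-- As `log w ≤ w = O(log T)`, the number of draws is `O(log T + log (1/μ))`. -/
theorem drawNumber_le {T : ℕ} {μ : ℝ} (hT : 0 < T) (hμ : 0 < μ) (hμ1 : μ < 1) :
    (drawNumber μ (roundNumber T) T : ℝ) ≤ 129 * lg T + 32 * lg (1 / μ) := by
  have hw := roundNumber_le_lg T
  have hw1 : (1 : ℝ) ≤ roundNumber T := by exact_mod_cast Nat.succ_pos _
  have hT1 : (1 : ℝ) ≤ T := by exact_mod_cast hT
  have hm : 1 ≤ 1 / μ := by rw [le_div_iff₀ hμ]; linarith
  have hx : (T : ℝ) * (μ / roundNumber T)⁻¹ = T * (roundNumber T * (1 / μ)) := by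
    rw [inv_div, div_eq_mul_one_div]
  have hlog : Real.log (T * (μ / roundNumber T)⁻¹) ≤ lg T + 3 * lg T + lg (1 / μ) := by
    rw [hx, Real.log_mul (by positivity) (by positivity), Real.log_mul (by positivity)
      (by positivity)]
    have h1 := log_le_lg hT1
    have h2 := Real.log_le_sub_one_of_pos (by linarith : (0 : ℝ) < roundNumber T)
    have h3 := log_le_lg hm
    linarith
  have hnn : 0 ≤ 32 * Real.log (T * (μ / roundNumber T)⁻¹) := by
    rw [hx]
    have h1 : 1 ≤ (roundNumber T : ℝ) * (1 / μ) := one_le_mul_of_one_le_of_one_le hw1 hm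
    have := Real.log_nonneg (one_le_mul_of_one_le_of_one_le hT1 h1)
    linarith
  have := Nat.ceil_lt_add_one hnn
  unfold drawNumber
  linarith [one_le_lg T]

theorem Instance.lg_T_le (x : Instance) : lg x.T ≤ lg x.bound := by
  obtain ⟨h1, h2, h3, h4⟩ := x.one_le
  refine lg_mono (by linarith) ?_
  rw [x.bound_eq]
  refine le_trans (le_of_eq ?_) (x.mono_le (a := 0) (b := 1) (e := 0) (k := 0) (by omega) le_rfl
    (by omega) (by omega))
  simp [Instance.mono]

theorem Soft.roundNumber : Soft (fun x => roundNumber x.T) 0 0 0 0 := by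
  refine ⟨3, 1, fun x => (roundNumber_le_lg x.T).trans ?_⟩
  have := x.lg_T_le
  rw [x.mono_zero]
  push_cast
  linarith

theorem Soft.drawNumber :
    Soft (fun x => drawNumber x.μ (SparseInterp.roundNumber x.T) x.T) 0 0 0 1 := by
  refine ⟨161, 1, fun x => (drawNumber_le x.T_pos x.μ_pos x.μ_lt).trans ?_⟩
  have h1 := x.lg_T_le
  have h2 := one_le_lg x.bound
  have h3 := one_le_lg (1 / x.μ)
  simp only [Instance.mono, pow_zero, one_mul, pow_one]
  push_cast
  nlinarith

/-! ### Bit operations -/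

theorem Soft.sieveBound {M N : Instance → ℕ} {a b e k : ℕ} (hM : Soft M a b e k)
    (hN : Soft N a b e k) : Soft (fun x => SparseInterp.sieveBound (M x) (N x)) a b e k := by
  have hX := (hM.add hN).add (Soft.const 2)
  exact ((Soft.const 16).mul hX |>.mul hX.size).le (by simp) (by simp) (by simp) (by simp)

theorem Soft.primeBound : Soft (fun x => primeBound x.T x.D) 0 1 1 0 :=
  Soft.sieveBound ((Soft.const 32).mul Soft.T).le
    ((Soft.const 31).mul (Soft.T.mul Soft.size_D)).le

theorem size_mul_le (x y : ℕ) : (x * y).size ≤ x.size + y.size := by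
  rw [Nat.size_le, pow_add]
  exact Nat.mul_lt_mul'' (Nat.lt_size_self x) (Nat.lt_size_self y)

theorem size_add_le (x y : ℕ) : (x + y).size ≤ x.size + y.size + 1 := by
  rw [Nat.size_le]
  have h1 := Nat.lt_size_self x
  have h2 := Nat.lt_size_self y
  have h3 : 2 ^ x.size ≤ 2 ^ (x.size + y.size) := Nat.pow_le_pow_right (by norm_num) (by omega)
  have h4 : 2 ^ y.size ≤ 2 ^ (x.size + y.size) := Nat.pow_le_pow_right (by norm_num) (by omega)
  rw [pow_succ]
  omega

/-- The bound for an integer operation is `O~(log D)`; note that the integers themselves are not of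
polynomial size in `log D`. -/
theorem Soft.unit_wordBound : Soft (fun x => unit (wordBound x.n x.T x.D x.μ)) 0 0 1 0 := by
  have hP := Soft.primeBound
  have h : Soft (fun x => (wordBound x.n x.T x.D x.μ).size) 0 0 1 0 := by
    refine Soft.of_le (g := fun x => x.n.size +
        ((2 * SparseInterp.primeBound x.T x.D).size + x.D.size +
      (SparseInterp.primeBound x.T x.D).size) + (3 * x.T).size + 1 +
      (SparseInterp.drawNumber x.μ (SparseInterp.roundNumber x.T) x.T).size + 1) ?_ fun x => ?_
    · exact (((((Soft.n.size.add ((((Soft.const 2).mul hP).size.add Soft.size_D).add hP.size)).add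
        ((Soft.const 3).mul Soft.T).size).add (Soft.const 1)).add Soft.drawNumber.size).add
        (Soft.const 1)).le
    · refine (size_add_le _ _).trans (Nat.add_le_add_right (Nat.add_le_add_right
        ((size_add_le _ _).trans (Nat.add_le_add_right (Nat.add_le_add_right ?_ _) _)) _) _)
      refine (size_mul_le _ _).trans (Nat.add_le_add_left ((size_mul_le _ _).trans
        (Nat.add_le_add_right (size_mul_le _ _) _)) _)
  exact (((Soft.const 3).mul h).opCost).le

theorem Soft.size_wordBound : Soft (fun x => (wordBound x.n x.T x.D x.μ).size) 0 0 1 0 :=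
  Soft.unit_wordBound.of_le fun x => by
    have h : 3 * (wordBound x.n x.T x.D x.μ).size + 1 ≤ unit (wordBound x.n x.T x.D x.μ) := by
      unfold unit SparseInterp.opCost
      exact Nat.le_mul_of_pos_right _ (by positivity)
    omega

theorem Soft.collectCost {m u : Instance → ℕ} {a b e k a' b' e' k' : ℕ} (hm : Soft m a b e k)
    (hu : Soft u a' b' e' k') :
    Soft (fun x => collectCost (m x) (u x)) (a + a') (b + b') (e + e') (k + k') := by
  have h : Soft (fun x => (m x - 1).size) 0 0 0 0 := (hm.of_le fun x => Nat.sub_le _ _).size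
  exact ((hm.mul (h.add (Soft.const 1))).mul hu).le (by simp) (by simp) (by simp) (by simp)

theorem Soft.sieveCost :
    Soft (fun x => sieveCost (SparseInterp.primeBound x.T x.D + 1)
      (SparseInterp.primeBound x.T x.D)) 0 1 1 0 := by
  have hB := Soft.primeBound
  have hBB := hB.mul hB.size
  have hu : Soft (fun x => unit (SparseInterp.primeBound x.T x.D + 1)) 0 0 0 0 :=
    ((Soft.const 3).mul (hB.add (Soft.const 1)).size).opCost.le
  exact ((((Soft.const 20).mul (hB.add (Soft.const 1))).add ((Soft.const 3).mul hBB)).add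
    (hBB.mul hBB.size) |>.mul hu).le

theorem Soft.bitOps : Soft (fun x => (SparseInterp.roundNumber x.T + 6) *
      unit (wordBound x.n x.T x.D x.μ) + SparseInterp.roundNumber x.T *
      roundCost (wordBound x.n x.T x.D x.μ) x.n x.T x.D
        (SparseInterp.drawNumber x.μ (SparseInterp.roundNumber x.T) x.T)) 1 1 1 1 := by
  have hu := Soft.unit_wordBound
  have hl := Soft.drawNumber
  have hw := Soft.roundNumber
  have hn1 := Soft.n.add (Soft.const 1)
  have h3 := Soft.collectCost ((Soft.const 3).mul Soft.T) hu
  have htrial : Soft (fun x => trialCost (wordBound x.n x.T x.D x.μ) x.n x.T) 1 1 1 0 :=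
    (((Soft.const 3).mul h3).add ((Soft.const 20).mul ((Soft.n.mul Soft.T).mul hu))).le
  have hrecover : Soft (fun x => recoverCost (wordBound x.n x.T x.D x.μ) x.n x.T) 1 1 1 0 :=
    (hn1.mul (((Soft.const 3).mul h3).add ((Soft.const 60).mul (Soft.T.mul hu)))).le
  have hrest : Soft (fun x => restCost (wordBound x.n x.T x.D x.μ) x.n x.T
      (SparseInterp.drawNumber x.μ (SparseInterp.roundNumber x.T) x.T)) 1 1 1 1 :=
    (((((((hl.mul hl.size).mul (hn1.mul hu)).add (hl.mul (hn1.mul hu))).add (hl.mul htrial)).add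
      (hl.mul hu)).add hu).add hrecover).le
  have hdraw : Soft (fun x => drawCost (wordBound x.n x.T x.D x.μ) x.n x.T
      (SparseInterp.drawNumber x.μ (SparseInterp.roundNumber x.T) x.T)) 1 1 1 1 :=
    ((((hl.add (Soft.const 1)).mul hu).add (hl.mul (hn1.mul hu))).add hrest).le
  have hparams : Soft (fun x => paramsCost (wordBound x.n x.T x.D x.μ) x.T x.D
      (SparseInterp.drawNumber x.μ (SparseInterp.roundNumber x.T) x.T)) 1 1 1 1 :=
    ((((Soft.const 9).mul hu).add (((Soft.const 2).mul Soft.size_wordBound).add hl).opCost).add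
      ((Soft.const 2).mul ((Soft.size_D.add Soft.T.size).add
        ((Soft.T.mul Soft.size_D).add (Soft.const 1))).opCost)).le
  have hround : Soft (fun x => roundCost (wordBound x.n x.T x.D x.μ) x.n x.T x.D
      (SparseInterp.drawNumber x.μ (SparseInterp.roundNumber x.T) x.T)) 1 1 1 1 :=
    ((((hparams.add Soft.sieveCost).add hdraw).add (Soft.collectCost ((Soft.const 2).mul Soft.T)
      (Soft.n.mul hu))).add ((Soft.const 4).mul hu)).le
  exact (((hw.add (Soft.const 6)).mul hu).add (hw.mul hround)).le

/-! ### Queries and ring operations -/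

theorem query_bound (x : Instance) :
    ((roundNumber x.T * (drawNumber x.μ (roundNumber x.T) x.T + x.n) : ℕ) : ℝ) ≤
      387 * (x.n * lg x.T + lg x.T ^ 2 + lg x.T * lg (1 / x.μ)) := by
  have h1 := roundNumber_le_lg x.T
  have h2 := drawNumber_le x.T_pos x.μ_pos x.μ_lt
  have h3 := lg_pos x.T
  have h4 := lg_pos (1 / x.μ)
  have h5 := x.one_le.1
  push_cast
  calc (roundNumber x.T : ℝ) * (drawNumber x.μ (roundNumber x.T) x.T + x.n)
      ≤ 3 * lg x.T * (129 * lg x.T + 32 * lg (1 / x.μ) + x.n) := by gcongr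
    _ ≤ _ := by nlinarith [mul_pos h3 h4, mul_pos h3 (zero_lt_one.trans_le h5)]

theorem ring_bound (x : Instance) :
    ((roundNumber x.T * (drawNumber x.μ (roundNumber x.T) x.T * (10 * x.T) + 7 * (x.n * x.T) +
      2 * x.T) : ℕ) : ℝ) ≤ 5000 * soft 2 (x.n * x.T * lg (1 / x.μ)) := by
  obtain ⟨hn, hT, -, hm⟩ := x.one_le
  have h1 := roundNumber_le_lg x.T
  have h2 := drawNumber_le x.T_pos x.μ_pos x.μ_lt
  have h3 := one_le_lg x.T
  set L := lg x.T
  set m := lg (1 / x.μ)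
  have h4 : L ≤ lg (x.n * x.T * m) := by
    refine lg_mono (by linarith) ?_
    calc (x.T : ℝ) = 1 * x.T * 1 := by ring
      _ ≤ _ := by gcongr
  have hTnm : (x.T : ℝ) ≤ x.n * x.T * m := by
    calc (x.T : ℝ) = 1 * x.T * 1 := by ring
      _ ≤ _ := by gcongr
  push_cast
  calc (roundNumber x.T : ℝ) * (drawNumber x.μ (roundNumber x.T) x.T * (10 * x.T) +
        7 * (x.n * x.T) + 2 * x.T)
      ≤ 3 * L * ((129 * L + 32 * m) * (10 * x.T) + 7 * (x.n * x.T) + 2 * x.T) := by gcongr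
    _ ≤ 3 * L * (((129 * L + 32 * L) * (10 * (x.n * x.T * m))) + 7 * (L * (x.n * x.T * m)) +
          2 * (L * (x.n * x.T * m))) := by
        have e1 : (129 * L + 32 * m) * (10 * x.T) ≤ (129 * L + 32 * L) * (10 * (x.n * x.T * m)) := by
          have f1 : L * x.T ≤ L * (x.n * x.T * m) := by gcongr
          have f2 : m * x.T ≤ L * (x.n * x.T * m) := by
            calc m * x.T = 1 * (1 * x.T * m) := by ring
              _ ≤ _ := by gcongr
          linarith
        have e2 : (x.n * x.T : ℝ) ≤ L * (x.n * x.T * m) := by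
          calc (x.n * x.T : ℝ) = 1 * (x.n * x.T * 1) := by ring
            _ ≤ _ := by gcongr
        have e3 : (x.T : ℝ) ≤ L * (x.n * x.T * m) := by
          calc (x.T : ℝ) = 1 * (1 * x.T * 1) := by ring
            _ ≤ _ := by gcongr
        gcongr
    _ = 4857 * (x.n * x.T * m * L ^ 2) := by ring
    _ ≤ 5000 * (x.n * x.T * m * lg (x.n * x.T * m) ^ 2) := by gcongr; norm_num
    _ = _ := rfl

/-- The degree bounds are `O(T D log² (T D))`. -/
theorem degree_bound {T D : ℕ} (hT : 0 < T) (hD : 0 < D) :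
    ((2 * primeBound T D * D : ℕ) : ℝ) ≤ 70000 * soft 2 (T * D) := by
  have hT1 : (1 : ℝ) ≤ T := by exact_mod_cast hT
  have hD1 : (1 : ℝ) ≤ D := by exact_mod_cast hD
  set s := D.size with hs
  have hs1 : 0 < s := Nat.size_pos.2 hD
  have hsD : s ≤ D := Nat.size_le.2 Nat.lt_two_pow_self
  set X := 32 * T + 31 * (T * s) + 2 with hX
  have hTs : T ≤ T * s := Nat.le_mul_of_pos_right _ hs1
  have hX1 : X ≤ 65 * (T * s) := by omega
  have hX2 : X ≤ 2 ^ 7 * (T * D) := by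
    have : T * s ≤ T * D := Nat.mul_le_mul_left _ hsD
    omega
  have hTD : (0 : ℝ) < T * D := by positivity
  have hL := one_le_lg (T * D : ℝ)
  have hXs : (X.size : ℝ) ≤ 16 * lg (T * D) := by
    have h1 : X.size ≤ 7 + 1 + (T * D).size :=
      (Nat.size_le_size hX2).trans ((size_mul_le _ _).trans (by rw [Nat.size_pow]))
    have h2 := size_le_two_mul_lg (T * D)
    have h3 : (X.size : ℝ) ≤ 7 + 1 + ((T * D).size : ℕ) := by exact_mod_cast h1
    push_cast at h2
    linarith
  have hss : (s : ℝ) ≤ 2 * lg (T * D) := by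
    refine (size_le_two_mul_lg D).trans ?_
    have : lg D ≤ lg (T * D) := lg_mono (by linarith) (le_mul_of_one_le_left (by linarith) hT1)
    linarith
  have hP : primeBound T D = 16 * X * X.size := rfl
  rw [hP]
  have hX3 : (X : ℝ) ≤ 65 * (T * s) := by exact_mod_cast hX1
  push_cast
  calc 2 * (16 * (X : ℝ) * X.size) * D
      ≤ 2 * (16 * (65 * (T * (2 * lg (T * D)))) * (16 * lg (T * D))) * D := by
        gcongr
        exact hX3.trans (by gcongr)
    _ = 66560 * (T * D * lg (T * D) ^ 2) := by ring
    _ ≤ 70000 * (T * D * lg (T * D) ^ 2) := by gcongr; norm_num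
    _ = _ := rfl

theorem soft_mono {c c' : ℕ} (h : c ≤ c') {g : ℝ} (hg : 0 ≤ g) : soft c g ≤ soft c' g :=
  mul_le_mul_of_nonneg_left (pow_le_pow_right₀ (one_le_lg g) h) hg

theorem mul_soft_le {C C' c c' : ℕ} (hC : C ≤ C') (hc : c ≤ c') {g : ℝ} (hg : 0 ≤ g) :
    C * soft c g ≤ C' * soft c' g := by
  have h1 := soft_mono hc hg
  have h2 : (C : ℝ) ≤ C' := by exact_mod_cast hC
  have h3 : 0 ≤ soft c g := mul_nonneg hg (pow_nonneg (lg_pos g).le c)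
  gcongr

end SparseInterp

theorem mainTheorem2 :
    ∃ C c : ℕ, ∀ (R : Type*) [CommRing R] (n T D : ℕ) (μ : ℝ) (f : MvPolynomial (Fin n) R)
      (U : SparseInterp.Interpolator R),
      0 < n → 0 < T → 0 < D → 0 < μ → μ < 1 →
      f.support.card ≤ T → f.totalDegree ≤ D → SparseInterp.Interpolates U f →
      -- the output is `f` with probability at least `1 - μ`
      ENNReal.ofReal (1 - μ) ≤
        (SparseInterp.run U (SparseInterp.mulPolySI n T D μ)).toOuterMeasure
          {x | ∃ h, x.1 = some h ∧ SparseInterp.Represents h f} ∧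
      -- the costs, for all random choices
      ∀ x ∈ (SparseInterp.run U (SparseInterp.mulPolySI n T D μ)).support,
        (x.2.queries.length : ℝ) ≤
          C * (n * SparseInterp.lg T + SparseInterp.lg T ^ 2 +
            SparseInterp.lg T * SparseInterp.lg (1 / μ)) ∧
        (∀ q ∈ x.2.queries, q.exps.length = n ∧
          (SparseInterp.kron f q.exps).natDegree ≤ q.degBound ∧
          (q.degBound : ℝ) ≤ C * SparseInterp.soft c (T * D) ∧
          (SparseInterp.kron f q.exps).support.card ≤ q.termBound ∧ q.termBound ≤ T) ∧
        (x.2.ringOps : ℝ) ≤ C * SparseInterp.soft c (n * T * SparseInterp.lg (1 / μ)) ∧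
        (x.2.bitOps : ℝ) ≤
          C * SparseInterp.soft c
            (n * T * SparseInterp.lg D * SparseInterp.lg (1 / μ)) := by
  obtain ⟨C, c, hbit⟩ := SparseInterp.Soft.bitOps
  refine ⟨max C 70000, max c 2, fun R _ n T D μ f U hn hT hD hμ hμ1 hfT hfD hU =>
    ⟨SparseInterp.ofReal_le_toOuterMeasure hn hT hD hμ hμ1 hfT hfD hU, fun x hx => ?_⟩⟩
  obtain ⟨-, h1, h2, h3, h4⟩ := SparseInterp.Spec.mulPolySI
    (SparseInterp.setting (μ := μ) hn hT hD hfT hfD hU) hμ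
    (by unfold SparseInterp.wordBound; omega) x hx
  let y : SparseInterp.Instance := ⟨n, T, D, μ, hn, hT, hμ, hμ1⟩
  have hm := SparseInterp.lg_pos (1 / μ)
  have hd := SparseInterp.lg_pos D
  have hC : (70000 : ℕ) ≤ max C 70000 := le_max_right _ _
  refine ⟨?_, fun q hq => ?_, ?_, ?_⟩
  · refine (Nat.cast_le.2 h1).trans ((SparseInterp.query_bound y).trans ?_)
    have h5 : (387 : ℝ) ≤ (max C 70000 : ℕ) := by
      exact_mod_cast (by norm_num : 387 ≤ 70000).trans hC
    have h6 := SparseInterp.lg_pos T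
    have h7 : 0 ≤ n * SparseInterp.lg T + SparseInterp.lg T ^ 2 +
        SparseInterp.lg T * SparseInterp.lg (1 / μ) := by positivity
    exact mul_le_mul_of_nonneg_right h5 h7
  · obtain ⟨e1, e2, e3, e4, e5⟩ := h2 q hq
    refine ⟨e1, e2, (Nat.cast_le.2 e3).trans ((SparseInterp.degree_bound hT hD).trans ?_), e4, e5⟩
    exact_mod_cast SparseInterp.mul_soft_le hC (le_max_right c 2) (by positivity)
  · refine (Nat.cast_le.2 h3).trans ((SparseInterp.ring_bound y).trans ?_)
    exact_mod_cast SparseInterp.mul_soft_le ((by norm_num : 5000 ≤ 70000).trans hC)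
      (le_max_right c 2) (g := n * T * SparseInterp.lg (1 / μ)) (by positivity)
  · refine (Nat.cast_le.2 h4).trans ((hbit y).trans ?_)
    rw [← y.bound_eq, mul_assoc]
    exact SparseInterp.mul_soft_le (le_max_left C 70000) (le_max_left c 2)
      (zero_le_one.trans y.one_le_bound)
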